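/- Let $p$ be a prime. Let $X_0$ be the set of isomorphism classes of finite abelian $p$-groups (equivalently, finite $\mathbb{Z}_p$-modules) and $X_1$ the set of isomorphism classes of finitely generated $\mathbb{Z}_p$-modules of rank $1$. Let $\mu_0(G)=c_0/|\mathrm{Aut}(G)|$ be the Cohen–Lenstra measure on $X_0$, where $c_0=\prod_{i\ge 1}(1-p^{-i})$. For $G\in X_0$ let $d^*(G)\in X_1$ be the middle term of the extension of $G$ by $\mathbb{Z}_p$ given by a uniformly random element of the finite group $\mathrm{Ext}(G,\mathbb{Z}_p)$; for $H\in X_1$ let $d(H)$ be the quotient of $H$ by (the submodule generated by) a Haar-random element of $H$, which lies in $X_0$ almost surely. Extend $d$ and $d^*$ linearly to summable signed measures and put $\Delta_0=d\,d^*$. For $G\in X_0$ let $\delta_0(G)\in X_0$ be the kernel of a uniformly random element of $\mathrm{Hom}(G,\mathbb{Q}_p/\mathbb{Z}_p)$, and extend $\delta_0$ linearly to finitely supported signed measures on $X_0$. For a finite abelian group $F$ let $\mathbf{Moment}[F]$ be the measure on $X_0$ with $$\mathbf{Moment}[F](G)=\#\mathrm{Sur}(G,F)\,\mu_0(G),$$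 and extend $F\mapsto\mathbf{Moment}[F]$, $F\in X_0$, linearly to finitely supported signed measures on $X_0$. For $F,F'\in X_0$ write $F'\le F$ if $F$ admits a surjection onto $F'$; this is a partial order on $X_0$. Then: 1. For every finite abelian group $F$, $\mathbf{Moment}[F]$ is summable and $$\Delta_0\big(\mathbf{Moment}[F]\big)=\frac1{|F|}\sum_{\varphi\in\mathrm{Hom}(\mathbb{Z}_p,F)}\mathbf{Moment}[\mathrm{coker}\,\varphi].$$ 2. For every finitely supported signed measure $\nu$ on $X_0$, $\mathbf{Moment}(\nu)$ is summable and $$\Delta_0\big(\mathbf{Moment}(\nu)\big)=\mathbf{Moment}\big(\delta_0(\nu)\big).$$ 3. $\Delta_0$ acts upper-triangularly on moments: for every $F\in X_0$ there are real coefficients $(b_{F'})_{F'\le F}$, only finitely many of them non-zero, with $b_F=1/|F|$ and $$\Delta_0\big(\mathbf{Moment}[F]\big)=\sum_{F'\le F} b_{F'}\,\mathbf{Moment}[F'].$$ -/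

import Mathlib

namespace CohenLenstra

/-! ### Two finiteness facts -/

theorem finite_range_of_killed (p : ℕ) [Fact p.Prime] {A : Type*} [AddCommGroup A]
    (f : ℤ_[p] →+ A) {n : ℕ} (hn : n ≠ 0) (hf : ∀ a : A, a ∈ Set.range f → n • a = 0) :
    (Set.range f).Finite := by
  have hI : Ideal.span {(n : ℤ_[p])} ≠ ⊥ := by
    simp [hn]
  have hfin : Finite (ℤ_[p] ⧸ Ideal.span {(n : ℤ_[p])}) :=
    AddSubgroup.quotient_finite_of_isOpen (Ideal.span {(n : ℤ_[p])}).toAddSubgroup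
      (IsDedekindDomain.isOpen_of_ne_bot hI)
  have hsub : Set.range f ⊆
      Set.range (fun q : ℤ_[p] ⧸ Ideal.span {(n : ℤ_[p])} => f (Quotient.out q)) := by
    rintro _ ⟨x, rfl⟩
    refine ⟨Ideal.Quotient.mk _ x, ?_⟩
    have h : Ideal.Quotient.mk (Ideal.span {(n : ℤ_[p])})
        (Quotient.out (Ideal.Quotient.mk (Ideal.span {(n : ℤ_[p])}) x)) =
        Ideal.Quotient.mk (Ideal.span {(n : ℤ_[p])}) x := Quotient.out_eq _
    rw [Ideal.Quotient.eq, Ideal.mem_span_singleton] at h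
    obtain ⟨c, hc⟩ := h
    have h0 : f (Quotient.out (Ideal.Quotient.mk (Ideal.span {(n : ℤ_[p])}) x) - x) = 0 := by
      rw [hc, ← nsmul_eq_mul, map_nsmul]
      exact hf _ ⟨c, rfl⟩
    rw [map_sub, sub_eq_zero] at h0
    exact h0
  exact (Set.finite_range _).subset hsub

/-- There are only finitely many group homomorphisms from `ℤ_p` to a finite abelian group. -/
instance finite_addMonoidHom (p : ℕ) [Fact p.Prime] (F : Type*) [AddCommGroup F] [Finite F] :
    Finite (ℤ_[p] →+ F) := by
  have hn : Nat.card F ≠ 0 := Nat.card_pos.ne'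
  have hI : Ideal.span {(Nat.card F : ℤ_[p])} ≠ ⊥ := by
    rw [Ne, Ideal.span_singleton_eq_bot]; exact_mod_cast hn
  have hfin : Finite (ℤ_[p] ⧸ Ideal.span {(Nat.card F : ℤ_[p])}) :=
    AddSubgroup.quotient_finite_of_isOpen (Ideal.span {(Nat.card F : ℤ_[p])}).toAddSubgroup
      (IsDedekindDomain.isOpen_of_ne_bot hI)
  refine Finite.of_injective
    (fun (f : ℤ_[p] →+ F) (q : ℤ_[p] ⧸ Ideal.span {(Nat.card F : ℤ_[p])}) =>
      f (Quotient.out q)) ?_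
  intro f g hfg
  have key : ∀ (φ : ℤ_[p] →+ F) (x : ℤ_[p]),
      φ (Quotient.out (Ideal.Quotient.mk (Ideal.span {(Nat.card F : ℤ_[p])}) x)) = φ x := by
    intro φ x
    have h : Ideal.Quotient.mk (Ideal.span {(Nat.card F : ℤ_[p])})
        (Quotient.out (Ideal.Quotient.mk (Ideal.span {(Nat.card F : ℤ_[p])}) x)) =
        Ideal.Quotient.mk (Ideal.span {(Nat.card F : ℤ_[p])}) x := Quotient.out_eq _
    rw [Ideal.Quotient.eq, Ideal.mem_span_singleton] at h
    obtain ⟨c, hc⟩ := h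
    rw [← sub_eq_zero, ← map_sub, hc, ← nsmul_eq_mul, map_nsmul, card_nsmul_eq_zero']
  ext x
  rw [← key f x, ← key g x]
  exact congrFun hfg _

/-! ### The sets `X₀` and `X₁` -/

/-- A finite `ℤ_p`-module, i.e. a finite abelian `p`-group (whose `ℤ_p`-module structure is
unique), i.e. a finitely generated `ℤ_p`-module of rank `0`. -/
structure FinMod (p : ℕ) [Fact p.Prime] where
  carrier : Type
  [addCommGroup : AddCommGroup carrier]
  [module : Module ℤ_[p] carrier]
  [finite : Finite carrier]

/-- A finitely generated `ℤ_p`-module of rank `1`. -/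
structure RankOneMod (p : ℕ) [Fact p.Prime] where
  carrier : Type
  [addCommGroup : AddCommGroup carrier]
  [module : Module ℤ_[p] carrier]
  [fg : Module.Finite ℤ_[p] carrier]
  finrank_eq : Module.finrank ℤ_[p] carrier = 1

attribute [instance] FinMod.addCommGroup FinMod.module FinMod.finite
attribute [instance] RankOneMod.addCommGroup RankOneMod.module RankOneMod.fg

/-- Isomorphism of finite `ℤ_p`-modules. -/
instance finModSetoid (p : ℕ) [Fact p.Prime] : Setoid (FinMod p) where
  r M N := Nonempty (M.carrier ≃ₗ[ℤ_[p]] N.carrier)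
  iseqv := ⟨fun _ => ⟨LinearEquiv.refl _ _⟩, fun ⟨e⟩ => ⟨e.symm⟩, fun ⟨e⟩ ⟨f⟩ => ⟨e.trans f⟩⟩

/-- Isomorphism of finitely generated `ℤ_p`-modules of rank one. -/
instance rankOneModSetoid (p : ℕ) [Fact p.Prime] : Setoid (RankOneMod p) where
  r M N := Nonempty (M.carrier ≃ₗ[ℤ_[p]] N.carrier)
  iseqv := ⟨fun _ => ⟨LinearEquiv.refl _ _⟩, fun ⟨e⟩ => ⟨e.symm⟩, fun ⟨e⟩ ⟨f⟩ => ⟨e.trans f⟩⟩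

/-- The set `X₀` of (isomorphism classes of) finite abelian `p`-groups. -/
def XZero (p : ℕ) [Fact p.Prime] : Type 1 := Quotient (finModSetoid p)

/-- The set `X₁` of (isomorphism classes of) finitely generated `ℤ_p`-modules of rank one. -/
def XOne (p : ℕ) [Fact p.Prime] : Type 1 := Quotient (rankOneModSetoid p)

/-- The isomorphism class of a finite `ℤ_p`-module. -/
def XZero.mk (p : ℕ) [Fact p.Prime] (M : Type) [AddCommGroup M] [Module ℤ_[p] M] [Finite M] :
    XZero p :=
  Quotient.mk (finModSetoid p) ⟨M⟩

/-- A group representing the isomorphism class `G`. -/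
abbrev XZero.Grp {p : ℕ} [Fact p.Prime] (G : XZero p) : Type := (Quotient.out G).carrier

/-- A module representing the isomorphism class `H`. -/
abbrev XOne.Mod {p : ℕ} [Fact p.Prime] (H : XOne p) : Type := (Quotient.out H).carrier

/-- The partial order on `X₀`: `F' ≤ F` if and only if `F` admits a surjection to `F'`. -/
noncomputable instance (p : ℕ) [Fact p.Prime] : PartialOrder (XZero p) where
  le F' F := ∃ f : F.Grp →ₗ[ℤ_[p]] F'.Grp, Function.Surjective f
  le_refl F := ⟨LinearMap.id, Function.surjective_id⟩
  le_trans _ _ _ := fun ⟨f, hf⟩ ⟨g, hg⟩ => ⟨f.comp g, hf.comp hg⟩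
  le_antisymm F' F := by
    rintro ⟨f, hf⟩ ⟨g, hg⟩
    have hcard : Nat.card F.Grp = Nat.card F'.Grp :=
      le_antisymm (Nat.card_le_card_of_surjective g hg) (Nat.card_le_card_of_surjective f hf)
    have hbij : Function.Bijective f :=
      (Nat.bijective_iff_surjective_and_card f).2 ⟨hf, hcard⟩
    have e : F.Grp ≃ₗ[ℤ_[p]] F'.Grp := LinearEquiv.ofBijective f hbij
    exact (Quotient.out_equiv_out.1 ⟨e.symm⟩)

/-! ### The Cohen–Lenstra measure and the moment measures

A signed measure on the discrete set `X₀` (or `X₁`) is given by its values on points. -/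

/-- The constant `c₀ = ∏_{i ≥ 1} (1 - p^{-i})`. -/
noncomputable def cZero (p : ℕ) : ℝ := ∏' i : ℕ, (1 - 1 / (p : ℝ) ^ (i + 1))

/-- The Cohen–Lenstra measure `μ₀(G) = c₀ / #Aut(G)`. -/
noncomputable def muZero (p : ℕ) [Fact p.Prime] (G : XZero p) : ℝ :=
  cZero p / Nat.card (G.Grp ≃+ G.Grp)

/-- The measure `Moment[F]` on `X₀`, for a finite abelian group `F`: its value at `G` is
`#Sur(G, F) μ₀(G)`. -/
noncomputable def moment (p : ℕ) [Fact p.Prime] (F : Type*) [AddCommGroup F] :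
    XZero p → ℝ :=
  fun G => Nat.card {f : G.Grp →+ F // Function.Surjective f} * muZero p G

/-- `Moment`, extended by linearity to finitely supported signed measures on `X₀`. -/
noncomputable def momentOp (p : ℕ) [Fact p.Prime] : (XZero p →₀ ℝ) →ₗ[ℝ] (XZero p → ℝ) :=
  Finsupp.linearCombination ℝ (fun F : XZero p => moment p F.Grp)

/-! ### The operator `d` -/

/-- A finitely generated `ℤ_p`-module is compact for its canonical topology. -/
theorem compactSpace_moduleTopology (p : ℕ) [Fact p.Prime] (M : Type*) [AddCommGroup M]
    [Module ℤ_[p] M] [Module.Finite ℤ_[p] M] :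
    @CompactSpace M (moduleTopology ℤ_[p] M) := by
  let : TopologicalSpace M := moduleTopology ℤ_[p] M
  have : IsModuleTopology ℤ_[p] M := ⟨rfl⟩
  have : ContinuousAdd M := IsModuleTopology.toContinuousAdd ℤ_[p] M
  obtain ⟨n, f, hf⟩ := Module.Finite.exists_fin' ℤ_[p] M
  have hc : Continuous f := IsModuleTopology.continuous_of_linearMap f
  exact ⟨by simpa [hf.range_eq] using isCompact_range hc⟩

/-- The probability that a random element of a finitely generated `ℤ_p`-module `M`, drawn from
the normalized Haar measure of the compact group `M` (with its `p`-adic topology), lies in `s`. -/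
noncomputable def haarProb (p : ℕ) [Fact p.Prime] (M : Type*) [AddCommGroup M]
    [Module ℤ_[p] M] [Module.Finite ℤ_[p] M] (s : Set M) : ℝ :=
  letI : TopologicalSpace M := moduleTopology ℤ_[p] M
  haveI : IsModuleTopology ℤ_[p] M := ⟨rfl⟩
  haveI : IsTopologicalAddGroup M := IsModuleTopology.topologicalAddGroup ℤ_[p] M
  haveI : CompactSpace M := compactSpace_moduleTopology p M
  letI : MeasurableSpace M := borel M
  haveI : BorelSpace M := ⟨rfl⟩
  (MeasureTheory.Measure.addHaarMeasure (⊤ : TopologicalSpace.PositiveCompacts M)).real s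

/-- The probability that `d(H)`, the quotient of `H` by a Haar random element, is isomorphic
to `G`. -/
noncomputable def dProb (p : ℕ) [Fact p.Prime] (H : XOne p) (G : XZero p) : ℝ :=
  haarProb p H.Mod
    {h | Nonempty ((H.Mod ⧸ Submodule.span ℤ_[p] {h}) ≃ₗ[ℤ_[p]] G.Grp)}

/-- The operator `d` from measures on `X₁` to measures on `X₀`. -/
noncomputable def dOp (p : ℕ) [Fact p.Prime] (ν : XOne p → ℝ) : XZero p → ℝ :=
  fun G => ∑' H : XOne p, ν H * dProb p H G

/-! ### The operator `d^*` -/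

/-- An extension `0 → ℤ_p → E → G → 0` of `ℤ_p`-modules. -/
structure Extension (p : ℕ) [Fact p.Prime] (G : Type) [AddCommGroup G] [Module ℤ_[p] G] where
  middle : Type
  [addCommGroup : AddCommGroup middle]
  [module : Module ℤ_[p] middle]
  inl : ℤ_[p] →ₗ[ℤ_[p]] middle
  proj : middle →ₗ[ℤ_[p]] G
  inl_injective : Function.Injective inl
  exact : Function.Exact inl proj
  proj_surjective : Function.Surjective proj

attribute [instance] Extension.addCommGroup Extension.module

/-- Equivalence of extensions: an isomorphism of the middle terms that induces the identity on
`ℤ_p` and on `G`. -/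
instance extensionSetoid (p : ℕ) [Fact p.Prime] (G : Type) [AddCommGroup G]
    [Module ℤ_[p] G] : Setoid (Extension p G) where
  r E E' := ∃ e : E.middle ≃ₗ[ℤ_[p]] E'.middle,
    (∀ x, e (E.inl x) = E'.inl x) ∧ ∀ y, E'.proj (e y) = E.proj y
  iseqv :=
    { refl := fun _ => ⟨LinearEquiv.refl _ _, fun _ => rfl, fun _ => rfl⟩
      symm := fun ⟨e, h₁, h₂⟩ => ⟨e.symm, fun x => by rw [← h₁ x, e.symm_apply_apply],
        fun y => by rw [← h₂, e.apply_symm_apply]⟩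
      trans := fun ⟨e, h₁, h₂⟩ ⟨e', h₁', h₂'⟩ => ⟨e.trans e',
        fun x => by rw [LinearEquiv.trans_apply, h₁, h₁'],
        fun y => by rw [LinearEquiv.trans_apply, h₂', h₂]⟩ }

/-- `Ext(G, ℤ_p)`: the set of equivalence classes of extensions of `G` by `ℤ_p`. -/
def ExtZp (p : ℕ) [Fact p.Prime] (G : Type) [AddCommGroup G] [Module ℤ_[p] G] : Type 1 :=
  Quotient (extensionSetoid p G)

/-- The probability that `d^*(G)`, the extension of `G` corresponding to a uniformly random
element of the finite set `Ext(G, ℤ_p)`, is isomorphic to `H`. -/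
noncomputable def dStarProb (p : ℕ) [Fact p.Prime] (G : XZero p) (H : XOne p) : ℝ :=
  (Nat.card {c : ExtZp p G.Grp // ∃ E : Extension p G.Grp,
      Quotient.mk (extensionSetoid p G.Grp) E = c ∧
        Nonempty (E.middle ≃ₗ[ℤ_[p]] H.Mod)} : ℝ) /
    Nat.card (ExtZp p G.Grp)

/-- The operator `d^*` from measures on `X₀` to measures on `X₁`. -/
noncomputable def dStarOp (p : ℕ) [Fact p.Prime] (ν : XZero p → ℝ) : XOne p → ℝ :=
  fun H => ∑' G : XZero p, ν G * dStarProb p G H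

/-- The Cohen–Lenstra operator `Δ₀ = d d^*`. All sums converge absolutely whenever `ν` is
summable, because the transition probabilities are nonnegative with row sums `1`. -/
noncomputable def DeltaZero (p : ℕ) [Fact p.Prime] (ν : XZero p → ℝ) : XZero p → ℝ :=
  dOp p (dStarOp p ν)

/-! ### The operator `δ₀` -/

/-- The `ℤ_p`-module `ℚ_p / ℤ_p`. -/
abbrev QpModZp (p : ℕ) [Fact p.Prime] : Type :=
  ℚ_[p] ⧸ LinearMap.range (Algebra.linearMap ℤ_[p] ℚ_[p])

theorem finite_torsion_QpModZp (p : ℕ) [Fact p.Prime] {n : ℕ} (hn : n ≠ 0) :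
    {x : QpModZp p | n • x = 0}.Finite := by
  have hn' : (n : ℚ_[p]) ≠ 0 := by exact_mod_cast hn
  let f : ℤ_[p] →+ QpModZp p :=
    { toFun := fun a => Submodule.Quotient.mk ((a : ℚ_[p]) / n)
      map_zero' := by simp
      map_add' := fun a b => by
        rw [← Submodule.Quotient.mk_add, PadicInt.coe_add, add_div] }
  have hf : ∀ a : ℤ_[p], f a = Submodule.Quotient.mk ((a : ℚ_[p]) / n) := fun _ => rfl
  refine (finite_range_of_killed p f hn ?_).subset ?_
  · rintro _ ⟨a, rfl⟩
    rw [hf, ← Submodule.Quotient.mk_smul, Submodule.Quotient.mk_eq_zero]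
    exact ⟨a, by rw [nsmul_eq_mul, mul_div_cancel₀ _ hn']; rfl⟩
  · intro x hx
    obtain ⟨y, rfl⟩ := Submodule.Quotient.mk_surjective _ x
    rw [Set.mem_ofPred_eq, ← Submodule.Quotient.mk_smul, Submodule.Quotient.mk_eq_zero] at hx
    obtain ⟨a, ha⟩ := hx
    refine ⟨a, ?_⟩
    have h : (a : ℚ_[p]) = n * y := by rw [← nsmul_eq_mul]; exact ha
    rw [hf, h, mul_div_cancel_left₀ _ hn']

/-- A finite abelian `p`-group has only finitely many characters. -/
instance finite_characters (p : ℕ) [Fact p.Prime] (G : Type) [AddCommGroup G]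
    [Module ℤ_[p] G] [Finite G] : Finite (G →ₗ[ℤ_[p]] QpModZp p) := by
  have hn : Nat.card G ≠ 0 := Nat.card_pos.ne'
  have : Finite {x : QpModZp p | Nat.card G • x = 0} :=
    (finite_torsion_QpModZp p hn).to_subtype
  refine Finite.of_injective
    (fun (χ : G →ₗ[ℤ_[p]] QpModZp p) (g : G) =>
      (⟨χ g, by
        rw [Set.mem_ofPred_eq, ← map_nsmul, card_nsmul_eq_zero', map_zero]⟩ :
          {x : QpModZp p | Nat.card G • x = 0})) ?_
  intro χ χ' h
  ext g
  exact congrArg Subtype.val (congrFun h g)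

noncomputable instance fintypeCharacters (p : ℕ) [Fact p.Prime] (G : Type) [AddCommGroup G]
    [Module ℤ_[p] G] [Finite G] : Fintype (G →ₗ[ℤ_[p]] QpModZp p) := Fintype.ofFinite _

noncomputable instance fintypeAddMonoidHom (p : ℕ) [Fact p.Prime] (F : Type*) [AddCommGroup F]
    [Finite F] : Fintype (ℤ_[p] →+ F) := Fintype.ofFinite _

/-- The law of `δ₀(G)`, the kernel of a uniformly random element `χ` of `Hom(G, ℚ_p/ℤ_p)`, as a
finitely supported measure on `X₀`. -/
noncomputable def deltaLaw (p : ℕ) [Fact p.Prime] (G : XZero p) : XZero p →₀ ℝ :=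
  (1 / (Nat.card (G.Grp →ₗ[ℤ_[p]] QpModZp p) : ℝ)) •
    ∑ χ : G.Grp →ₗ[ℤ_[p]] QpModZp p, Finsupp.single (XZero.mk p (LinearMap.ker χ)) (1 : ℝ)

/-- The operator `δ₀`, extended by linearity to finitely supported signed measures on `X₀`. -/
noncomputable def deltaOp (p : ℕ) [Fact p.Prime] : (XZero p →₀ ℝ) →ₗ[ℝ] (XZero p →₀ ℝ) :=
  Finsupp.linearCombination ℝ (deltaLaw p)

end CohenLenstra

open CohenLenstra

/-! The operators `d` and `d^*` are adjoint with respect to weights on `X₀` and `X₁`, so `Δ₀` is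
computed by taking two expectations. Both transition probabilities are multiples of the number of
surjections `π : H → G` with cyclic kernel. Such a `π` is an extension of `G` by `ℤ_p` with middle
term `H`, up to a finite group of automorphisms (`dStarProb_eq`). It also accounts for a set of
measure `(1 - 1/p)/#G` of elements `h`, the generators of its kernel, with `H/h ≅ G` (`dProb_eq`).
Hence `μ₀(G) P(d^* G = H) = μ₁(H) P(d H = G)`, where `μ₁(H) = c₀ / ((1 - 1/p) #AutOver)`.

Summing over `G`, `d^*` turns `#Sur(·, F) μ₀` into `μ₁(H) E #Sur(d H, F) = μ₁(H) #Sur(H, F) / #F`,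
since each surjection to `F` kills a random element with probability `1/#F`
(`hasSum_numSurj_mul_dProb`). Using the balance backwards, `d` gives `μ₀(G)/#F · E #Sur(d^* G, F)`.
This last expectation is `∑ a, #Sur(G, F/a)`: a map from the middle term sends `1 ∈ ℤ_p` to some `a`
and induces `G → F/a`, and each induced map arises from exactly `#G = #Ext(G, ℤ_p)` pairs
(extension, lift) (`Extension.card_liftPair`). This is the formula in part 1.

Part 2 follows by duality: `ker χ` is isomorphic to the dual of `G` modulo `χ`, and `G` is
isomorphic to its dual, so `δ₀(G)` has the law of `G/a` for uniform `a`. In part 3 only `a = 0`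
gives `F/a ≅ F`.

Summability of `#Sur(G, F)/#Aut G` comes from a bound, uniform in `n`, for the submodule zeta
function of `ℤ_p^n` at `n` (`submoduleZeta_free_le`). It also shows that `X₀` is countable, as
countable additivity of Haar measure requires. -/

namespace CohenLenstra

open Function

/-! ### Finite and finitely generated `ℤ_p`-modules -/

section Basics

variable {p : ℕ} [Fact p.Prime]

theorem exists_eq_pow_mul_unit {n : ℕ} (hn : n ≠ 0) :
    ∃ (k : ℕ) (u : ℤ_[p]ˣ), (n : ℤ_[p]) = u * (p : ℤ_[p]) ^ k :=
  ⟨_, PadicInt.unitCoeff (Nat.cast_ne_zero.2 hn), PadicInt.unitCoeff_spec _⟩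

theorem exists_pow_smul_eq_zero (G : Type*) [AddCommGroup G] [Module ℤ_[p] G] [Finite G] :
    ∃ k : ℕ, ∀ g : G, (p : ℤ_[p]) ^ k • g = 0 := by
  obtain ⟨k, u, h⟩ := exists_eq_pow_mul_unit (p := p) (n := Nat.card G) Nat.card_pos.ne'
  refine ⟨k, fun g => ?_⟩
  have h1 : (Nat.card G : ℤ_[p]) • g = 0 := by
    rw [Nat.cast_smul_eq_nsmul, card_nsmul_eq_zero']
  rw [h, mul_smul] at h1
  exact u.isUnit.smul_eq_zero.1 h1

theorem exists_card_eq_pow_of_nsmul (A : Type*) [AddCommGroup A] [Finite A] {k : ℕ}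
    (h : ∀ a : A, p ^ k • a = 0) : ∃ j : ℕ, Nat.card A = p ^ j := by
  have : IsPGroup p (Multiplicative A) := fun g => ⟨k, by
    rw [← ofAdd_toAdd g, ← ofAdd_nsmul, h, ofAdd_zero]⟩
  exact (IsPGroup.iff_card (G := Multiplicative A)).1 this

theorem exists_card_eq_pow (G : Type*) [AddCommGroup G] [Module ℤ_[p] G] [Finite G] :
    ∃ k : ℕ, Nat.card G = p ^ k := by
  obtain ⟨k, hk⟩ := exists_pow_smul_eq_zero (p := p) G
  refine exists_card_eq_pow_of_nsmul G (k := k) fun g => ?_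
  rw [← Nat.cast_smul_eq_nsmul ℤ_[p], Nat.cast_pow, hk]

theorem natCast_card_ne_zero (G : Type*) [Finite G] [Nonempty G] :
    (Nat.card G : ℤ_[p]) ≠ 0 :=
  Nat.cast_ne_zero.2 Nat.card_pos.ne'

/-- Modulo a power `p ^ k` that kills `B`, the scalar `r` is a natural number, and additive maps
commute with natural scalars. -/
theorem map_padicInt_smul {A B : Type*} [AddCommGroup A] [Module ℤ_[p] A] [AddCommGroup B]
    [Module ℤ_[p] B] [Finite B] (f : A →+ B) (r : ℤ_[p]) (a : A) : f (r • a) = r • f a := by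
  obtain ⟨k, hk⟩ := exists_pow_smul_eq_zero (p := p) B
  obtain ⟨s, hs⟩ := Ideal.mem_span_singleton.1 (PadicInt.appr_spec k r)
  have hr : r = (r.appr k : ℤ_[p]) + ((p ^ k : ℕ) : ℤ_[p]) * s := by
    rw [Nat.cast_pow, ← hs]; ring
  rw [hr, add_smul, add_smul, map_add, mul_smul, mul_smul, Nat.cast_smul_eq_nsmul,
    Nat.cast_smul_eq_nsmul, map_nsmul, map_nsmul, Nat.cast_smul_eq_nsmul]
  congr 1
  rw [← Nat.cast_smul_eq_nsmul ℤ_[p], Nat.cast_pow, hk, hk]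

/-- Additive maps to a finite `ℤ_p`-module are linear. -/
noncomputable def addMonoidHomEquivLinearMap (A B : Type*) [AddCommGroup A] [Module ℤ_[p] A] [AddCommGroup B]
    [Module ℤ_[p] B] [Finite B] : (A →+ B) ≃ (A →ₗ[ℤ_[p]] B) where
  toFun f := { f with map_smul' := map_padicInt_smul f }
  invFun f := f.toAddMonoidHom
  left_inv _ := rfl
  right_inv _ := rfl

/-- Additive isomorphisms of finite `ℤ_p`-modules are linear. -/
noncomputable def addEquivEquivLinearEquiv (A B : Type*) [AddCommGroup A] [Module ℤ_[p] A] [AddCommGroup B]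
    [Module ℤ_[p] B] [Finite B] : (A ≃+ B) ≃ (A ≃ₗ[ℤ_[p]] B) where
  toFun f := { f with map_smul' := map_padicInt_smul f.toAddMonoidHom }
  invFun f := f.toAddEquiv
  left_inv _ := rfl
  right_inv _ := rfl

variable (p) in
/-- The number of surjective linear maps. -/
noncomputable def numSurj (A B : Type*) [AddCommGroup A] [Module ℤ_[p] A] [AddCommGroup B]
    [Module ℤ_[p] B] : ℕ :=
  Nat.card {f : A →ₗ[ℤ_[p]] B // Surjective f}

variable (p) in
/-- The number of linear automorphisms. -/
noncomputable def numAut (A : Type*) [AddCommGroup A] [Module ℤ_[p] A] : ℕ :=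
  Nat.card (A ≃ₗ[ℤ_[p]] A)

variable {A B C : Type*} [AddCommGroup A] [Module ℤ_[p] A] [AddCommGroup B]
    [Module ℤ_[p] B] [AddCommGroup C] [Module ℤ_[p] C]

theorem card_addSurj_eq_numSurj [Finite B] :
    Nat.card {f : A →+ B // Surjective f} = numSurj p A B :=
  Nat.card_congr ((addMonoidHomEquivLinearMap A B).subtypeEquiv fun _ => Iff.rfl)

theorem card_addAut_eq_numAut [Finite A] : Nat.card (A ≃+ A) = numAut p A :=
  Nat.card_congr (addEquivEquivLinearEquiv A A)

theorem numSurj_congr_left (e : A ≃ₗ[ℤ_[p]] B) : numSurj p A C = numSurj p B C :=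
  Nat.card_congr ((LinearEquiv.congrLeft C ℤ_[p] e).toEquiv.subtypeEquiv fun f =>
    ⟨fun h => h.comp e.symm.surjective, fun h => by
      have := h.comp e.surjective
      convert this using 1
      ext x; simp⟩)

instance finite_linearMap_of_finite [Module.Finite ℤ_[p] A] [Finite B] :
    Finite (A →ₗ[ℤ_[p]] B) := by
  obtain ⟨s, hs⟩ := Module.Finite.fg_top (R := ℤ_[p]) (M := A)
  refine Finite.of_injective (fun (f : A →ₗ[ℤ_[p]] B) (x : s) => f x) fun f g h => ?_
  exact LinearMap.ext_on hs fun x hx => congrFun h ⟨x, hx⟩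

instance finite_quotient_of_finite [Finite A] (N : Submodule ℤ_[p] A) : Finite (A ⧸ N) :=
  Finite.of_surjective _ N.mkQ_surjective

instance finite_linearEquiv_of_finite [Finite A] : Finite (A ≃ₗ[ℤ_[p]] A) :=
  Finite.of_injective _ LinearEquiv.toLinearMap_injective

theorem numAut_pos [Finite A] : 0 < numAut p A := Nat.card_pos

theorem card_eq_card_ker_mul_card_of_surjective (f : A →ₗ[ℤ_[p]] B) (hf : Surjective f) :
    Nat.card A = Nat.card (LinearMap.ker f) * Nat.card B := by
  rw [Submodule.card_eq_card_quotient_mul_card (LinearMap.ker f), mul_comm,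
    Nat.card_congr (f.quotKerEquivOfSurjective hf).toEquiv, mul_comm]

theorem card_ker_mul_card_range (f : A →ₗ[ℤ_[p]] B) :
    Nat.card (LinearMap.ker f) * Nat.card (LinearMap.range f) = Nat.card A := by
  rw [card_eq_card_ker_mul_card_of_surjective f.rangeRestrict f.surjective_rangeRestrict,
    LinearMap.ker_rangeRestrict]

/-- A finitely generated `ℤ_p`-module killed by a non-zero scalar is finite. -/
theorem finite_of_smul_eq_zero [Module.Finite ℤ_[p] A] {r : ℤ_[p]} (hr : r ≠ 0)
    (h : ∀ a : A, r • a = 0) : Finite A := by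
  have : Finite (ℤ_[p] ⧸ Ideal.span {r}) :=
    AddSubgroup.quotient_finite_of_isOpen (Ideal.span {r}).toAddSubgroup
      (IsDedekindDomain.isOpen_of_ne_bot (by simpa using hr))
  obtain ⟨n, f, hf⟩ := Module.Finite.exists_fin' ℤ_[p] A
  have hle : ∀ x y : Fin n → ℤ_[p],
      (∀ i, Ideal.Quotient.mk (Ideal.span {r}) (x i) = Ideal.Quotient.mk _ (y i)) → f x = f y := by
    intro x y hxy
    have : ∀ i, ∃ c, x i - y i = r * c := fun i =>
      Ideal.mem_span_singleton.1 (Ideal.Quotient.eq.1 (hxy i))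
    choose c hc using this
    rw [← sub_eq_zero, ← map_sub, show x - y = r • c from funext hc, map_smul, h]
  refine Finite.of_surjective
    (fun q : Fin n → ℤ_[p] ⧸ Ideal.span {r} => f fun i => Quotient.out (q i)) fun a => ?_
  obtain ⟨x, rfl⟩ := hf a
  exact ⟨fun i => Ideal.Quotient.mk _ (x i), hle _ _ fun i => Quotient.out_eq _⟩

theorem finite_of_isTorsion [Module.Finite ℤ_[p] A] (h : ∀ a : A, ∃ r : ℤ_[p], r ≠ 0 ∧ r • a = 0) :
    Finite A := by
  obtain ⟨n, s, hs⟩ := Module.Finite.exists_fin (R := ℤ_[p]) (M := A)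
  choose r hr0 hr using h
  refine finite_of_smul_eq_zero (r := ∏ i, r (s i)) (Finset.prod_ne_zero_iff.2 fun i _ => hr0 _)
    fun a => ?_
  have ha : a ∈ Submodule.span ℤ_[p] (Set.range s) := hs ▸ Submodule.mem_top
  induction ha using Submodule.span_induction with
  | mem x hx =>
    obtain ⟨i, rfl⟩ := hx
    rw [← Finset.prod_erase_mul _ _ (Finset.mem_univ i), mul_smul, hr, smul_zero]
  | zero => simp
  | add x y _ _ hx hy => rw [smul_add, hx, hy, add_zero]
  | smul c x _ hx => rw [smul_comm, hx, smul_zero]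

theorem finite_quotient_span_singleton {r : ℤ_[p]} (hr : r ≠ 0) :
    Finite (ℤ_[p] ⧸ Ideal.span {r}) :=
  finite_of_smul_eq_zero (p := p) hr fun a => by
    obtain ⟨x, rfl⟩ := Ideal.Quotient.mk_surjective a
    rw [← Ideal.Quotient.mk_eq_mk, ← Submodule.Quotient.mk_smul, Submodule.Quotient.mk_eq_zero]
    exact Ideal.mem_span_singleton.2 ⟨x, rfl⟩

theorem card_quotient_span_p_pow (k : ℕ) :
    Nat.card (ℤ_[p] ⧸ Ideal.span {(p : ℤ_[p]) ^ k}) = p ^ k := by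
  rw [← PadicInt.ker_toZModPow,
    Nat.card_congr (RingHom.quotientKerEquivOfSurjective
      (ZMod.ringHom_surjective (PadicInt.toZModPow (p := p) k))).toEquiv, Nat.card_zmod]

theorem exists_ideal_eq_span_pow {I : Ideal ℤ_[p]} (hI : I ≠ ⊥) :
    ∃ k : ℕ, I = Ideal.span {(p : ℤ_[p]) ^ k} :=
  PadicInt.ideal_eq_span_pow_p hI

end Basics

/-! ### Duality with values in `ℚ_p / ℤ_p` -/

section Dual

variable (p : ℕ) [Fact p.Prime]

/-- The class of `x` in `ℚ_p / ℤ_p`. -/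
noncomputable def toQpModZp : ℚ_[p] →ₗ[ℤ_[p]] QpModZp p := Submodule.mkQ _

variable {p}

theorem toQpModZp_surjective : Surjective (toQpModZp p) := Submodule.mkQ_surjective _

theorem toQpModZp_eq_zero {x : ℚ_[p]} : toQpModZp p x = 0 ↔ ∃ z : ℤ_[p], (z : ℚ_[p]) = x := by
  rw [toQpModZp, Submodule.mkQ_apply, Submodule.Quotient.mk_eq_zero, LinearMap.mem_range]; rfl

theorem padicInt_smul_eq_mul (r : ℤ_[p]) (x : ℚ_[p]) : r • x = (r : ℚ_[p]) * x := rfl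

/-- `ℚ_p / ℤ_p` is an injective `ℤ_p`-module. -/
theorem baer_QpModZp : Module.Baer ℤ_[p] (QpModZp p) := by
  intro I g
  obtain ⟨r, rfl⟩ := (IsPrincipalIdealRing.principal I).principal
  by_cases hr : r = 0
  · refine ⟨0, fun x hx => ?_⟩
    have : x = 0 := by simpa [hr] using hx
    subst this
    exact (map_zero g).symm
  · have hr' : (r : ℚ_[p]) ≠ 0 := PadicInt.coe_ne_zero.2 hr
    obtain ⟨y, hy⟩ := toQpModZp_surjective (g ⟨r, Submodule.mem_span_singleton_self r⟩)
    refine ⟨LinearMap.toSpanSingleton _ _ (toQpModZp p (y / r)), fun x hx => ?_⟩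
    obtain ⟨c, rfl⟩ := Submodule.mem_span_singleton.1 hx
    rw [LinearMap.toSpanSingleton_apply, ← map_smul, padicInt_smul_eq_mul]
    have : (⟨c • r, hx⟩ : Submodule.span ℤ_[p] {r}) = c • ⟨r, Submodule.mem_span_singleton_self r⟩ :=
      rfl
    rw [this, map_smul, ← hy, ← map_smul, padicInt_smul_eq_mul]
    congr 1
    simp only [smul_eq_mul, PadicInt.coe_mul]
    field_simp

theorem exists_character_extension {A B : Type} [AddCommGroup A] [Module ℤ_[p] A] [AddCommGroup B]
    [Module ℤ_[p] B] (i : A →ₗ[ℤ_[p]] B) (hi : Injective i) (χ : A →ₗ[ℤ_[p]] QpModZp p) :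
    ∃ χ' : B →ₗ[ℤ_[p]] QpModZp p, χ' ∘ₗ i = χ :=
  baer_QpModZp.extension_property i hi χ

/-- The cyclic module `ℤ_p / r` is self-dual. -/
theorem nonempty_dual_cyclic {r : ℤ_[p]} (hr : r ≠ 0) :
    Nonempty (((ℤ_[p] ⧸ Ideal.span {r}) →ₗ[ℤ_[p]] QpModZp p) ≃ₗ[ℤ_[p]]
      (ℤ_[p] ⧸ Ideal.span {r})) := by
  have hr' : (r : ℚ_[p]) ≠ 0 := PadicInt.coe_ne_zero.2 hr
  have hz : Ideal.span {r} ≤ LinearMap.ker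
      (LinearMap.toSpanSingleton ℤ_[p] _ (toQpModZp p ((r : ℚ_[p])⁻¹))) := by
    intro x hx
    obtain ⟨c, rfl⟩ := Ideal.mem_span_singleton.1 hx
    rw [LinearMap.mem_ker, LinearMap.toSpanSingleton_apply, ← map_smul, toQpModZp_eq_zero]
    refine ⟨c, ?_⟩
    rw [padicInt_smul_eq_mul, PadicInt.coe_mul]
    field_simp
  -- The character `x ↦ x / r` generates the dual, with annihilator `(r)`.
  let c := Submodule.liftQ _ _ hz
  have hc : ∀ x : ℤ_[p], c (Submodule.Quotient.mk x) = toQpModZp p (x * (r : ℚ_[p])⁻¹) := fun x => by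
    rw [Submodule.liftQ_apply, LinearMap.toSpanSingleton_apply, ← map_smul, padicInt_smul_eq_mul]
  let Ψ : ℤ_[p] →ₗ[ℤ_[p]] ((ℤ_[p] ⧸ Ideal.span {r}) →ₗ[ℤ_[p]] QpModZp p) :=
    LinearMap.toSpanSingleton ℤ_[p] _ c
  have hker : LinearMap.ker Ψ = Ideal.span {r} := by
    ext x
    rw [LinearMap.mem_ker, LinearMap.toSpanSingleton_apply]
    constructor
    · intro h
      have h1 := LinearMap.congr_fun h (Submodule.Quotient.mk 1)
      rw [LinearMap.smul_apply, hc, ← map_smul, LinearMap.zero_apply, toQpModZp_eq_zero] at h1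
      obtain ⟨z, hz⟩ := h1
      refine Ideal.mem_span_singleton.2 ⟨z, ?_⟩
      rw [padicInt_smul_eq_mul, PadicInt.coe_one] at hz
      field_simp at hz
      rw [mul_comm]
      exact PadicInt.ext (by rw [PadicInt.coe_mul]; exact hz.symm)
    · intro h
      obtain ⟨z, rfl⟩ := Ideal.mem_span_singleton.1 h
      ext
      simp only [LinearMap.comp_apply, Submodule.mkQ_apply, LinearMap.smul_apply, hc,
        LinearMap.zero_apply, ← map_smul, toQpModZp_eq_zero, padicInt_smul_eq_mul]
      refine ⟨z, ?_⟩
      push_cast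
      field_simp
  have hsurj : Surjective Ψ := by
    intro φ
    obtain ⟨y, hy⟩ := toQpModZp_surjective (φ (Submodule.Quotient.mk 1))
    have h0 : toQpModZp p (r • y) = 0 := by
      rw [map_smul, hy, ← map_smul, ← Submodule.Quotient.mk_smul,
        (Submodule.Quotient.mk_eq_zero _).2, map_zero]
      exact Ideal.mem_span_singleton.2 ⟨1, rfl⟩
    obtain ⟨s, hs⟩ := toQpModZp_eq_zero.1 h0
    refine ⟨s, ?_⟩
    ext
    simp only [LinearMap.comp_apply, Submodule.mkQ_apply, Ψ, LinearMap.toSpanSingleton_apply,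
      LinearMap.smul_apply, hc, ← map_smul, ← hy]
    congr 1
    rw [padicInt_smul_eq_mul, hs, padicInt_smul_eq_mul, PadicInt.coe_one]
    field_simp
  exact ⟨(LinearMap.quotKerEquivOfSurjective Ψ hsurj).symm.trans (Submodule.quotEquivOfEq _ _ hker)⟩

/-- A finite `ℤ_p`-module is isomorphic to its dual. -/
theorem nonempty_dual_equiv (G : Type) [AddCommGroup G] [Module ℤ_[p] G] [Finite G] :
    Nonempty ((G →ₗ[ℤ_[p]] QpModZp p) ≃ₗ[ℤ_[p]] G) := by
  classical
  have hT : Module.IsTorsion ℤ_[p] G := fun {x} =>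
    ⟨⟨(Nat.card G : ℤ_[p]), mem_nonZeroDivisors_of_ne_zero (natCast_card_ne_zero G)⟩, by
      change (Nat.card G : ℤ_[p]) • x = 0
      rw [Nat.cast_smul_eq_nsmul, card_nsmul_eq_zero']⟩
  obtain ⟨ι, _, q, hq, e, ⟨l⟩⟩ := Module.equiv_directSum_of_isTorsion hT
  let l' := l.trans (DirectSum.linearEquivFunOnFintype ℤ_[p] ι fun i => ℤ_[p] ⧸ Ideal.span {q i ^ e i})
  have he : ∀ i, Nonempty (((ℤ_[p] ⧸ Ideal.span {q i ^ e i}) →ₗ[ℤ_[p]] QpModZp p) ≃ₗ[ℤ_[p]]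
      (ℤ_[p] ⧸ Ideal.span {q i ^ e i})) := fun i =>
    nonempty_dual_cyclic (pow_ne_zero _ (hq i).ne_zero)
  exact ⟨((LinearEquiv.congrLeft (QpModZp p) ℤ_[p] l').trans
    (LinearMap.lsum ℤ_[p] (fun i => ℤ_[p] ⧸ Ideal.span {q i ^ e i}) ℤ_[p]).symm).trans
    ((LinearEquiv.piCongrRight fun i => (he i).some).trans l'.symm)⟩

theorem card_dual (G : Type) [AddCommGroup G] [Module ℤ_[p] G] [Finite G] :
    Nat.card (G →ₗ[ℤ_[p]] QpModZp p) = Nat.card G :=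
  Nat.card_congr (nonempty_dual_equiv G).some.toEquiv

/-- The number of characters with a prescribed (admissible) value at a given element. -/
theorem card_characters_apply_eq (G : Type) [AddCommGroup G] [Module ℤ_[p] G] [Finite G] (m : G)
    (t : QpModZp p) (ht : ∀ r : ℤ_[p], r • m = 0 → r • t = 0) :
    Nat.card {χ : G →ₗ[ℤ_[p]] QpModZp p // χ m = t} =
      Nat.card (G ⧸ Submodule.span ℤ_[p] {m}) := by
  -- One such character exists by injectivity of `ℚ_p / ℤ_p`, extending from the span of `m`; the
  -- others differ from it by characters of `G / m`.
  obtain ⟨χ₀, h₀⟩ : ∃ χ : G →ₗ[ℤ_[p]] QpModZp p, χ m = t := by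
    have hk : LinearMap.ker (LinearMap.toSpanSingleton ℤ_[p] G m) ≤
        LinearMap.ker (LinearMap.toSpanSingleton ℤ_[p] (QpModZp p) t) := fun r hr => ht r hr
    obtain ⟨χ, hχ⟩ := exists_character_extension
      (Submodule.liftQ _ (LinearMap.toSpanSingleton ℤ_[p] G m) le_rfl)
      (by rw [← LinearMap.ker_eq_bot, Submodule.ker_liftQ_eq_bot _ _ _ le_rfl])
      (Submodule.liftQ _ _ hk)
    refine ⟨χ, ?_⟩
    have := LinearMap.congr_fun hχ (Submodule.Quotient.mk 1)
    rwa [LinearMap.comp_apply, Submodule.liftQ_apply, Submodule.liftQ_apply,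
      LinearMap.toSpanSingleton_apply_one, LinearMap.toSpanSingleton_apply_one] at this
  rw [← card_dual (p := p) (G ⧸ Submodule.span ℤ_[p] {m})]
  refine Nat.card_congr
    ⟨fun χ => Submodule.liftQ _ (χ.1 - χ₀) ?_, fun χ => ⟨χ ∘ₗ Submodule.mkQ _ + χ₀, ?_⟩, ?_, ?_⟩
  · rw [Submodule.span_singleton_le_iff_mem, LinearMap.mem_ker, LinearMap.sub_apply, χ.2, h₀,
      sub_self]
  · rw [LinearMap.add_apply, h₀, LinearMap.comp_apply, Submodule.mkQ_apply,
      (Submodule.Quotient.mk_eq_zero _).2 (Submodule.mem_span_singleton_self m), map_zero, zero_add]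
  · intro χ
    ext x
    simp
  · intro χ
    ext x
    simp

/-- `ker χ` is isomorphic to the quotient of the dual by the submodule generated by `χ`. -/
theorem nonempty_ker_equiv (G : Type) [AddCommGroup G] [Module ℤ_[p] G] [Finite G]
    (χ : G →ₗ[ℤ_[p]] QpModZp p) :
    Nonempty (LinearMap.ker χ ≃ₗ[ℤ_[p]]
      ((G →ₗ[ℤ_[p]] QpModZp p) ⧸ Submodule.span ℤ_[p] {χ})) := by
  -- Restriction to `ker χ` is onto and kills `χ`. It remains to see that its kernel, which has the
  -- order of the range of `χ`, is no larger than the span of `χ`.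
  let R : (G →ₗ[ℤ_[p]] QpModZp p) →ₗ[ℤ_[p]] (LinearMap.ker χ →ₗ[ℤ_[p]] QpModZp p) :=
    LinearMap.lcomp ℤ_[p] _ (LinearMap.ker χ).subtype
  have hR : Surjective R := fun φ =>
    exists_character_extension (LinearMap.ker χ).subtype (Submodule.injective_subtype _) φ
  have hle : Submodule.span ℤ_[p] {χ} ≤ LinearMap.ker R := by
    rw [Submodule.span_singleton_le_iff_mem, LinearMap.mem_ker]
    ext x
    exact x.2
  have h1 := card_eq_card_ker_mul_card_of_surjective R hR
  rw [card_dual, card_dual, ← card_ker_mul_card_range χ, mul_comm] at h1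
  have hfr : Finite (LinearMap.range χ) := Finite.of_surjective _ χ.surjective_rangeRestrict
  have h2 : Nat.card (LinearMap.range χ) = Nat.card (LinearMap.ker R) :=
    Nat.eq_of_mul_eq_mul_right (Nat.card_pos (α := LinearMap.ker χ)) h1
  have hI : LinearMap.ker (LinearMap.toSpanSingleton ℤ_[p] _ χ) ≠ ⊥ := by
    intro h
    refine natCast_card_ne_zero (p := p) G ?_
    rw [← Submodule.mem_bot (R := ℤ_[p]), ← h, LinearMap.mem_ker]
    ext x
    rw [LinearMap.toSpanSingleton_apply, LinearMap.smul_apply, ← map_smul, Nat.cast_smul_eq_nsmul,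
      card_nsmul_eq_zero', map_zero, LinearMap.zero_apply]
  obtain ⟨k, hk⟩ := exists_ideal_eq_span_pow hI
  have h3 : Nat.card (Submodule.span ℤ_[p] {χ}) = p ^ k := by
    rw [← LinearMap.range_toSpanSingleton, ← card_quotient_span_p_pow, ← hk]
    exact (Nat.card_congr (LinearMap.quotKerEquivRange _).toEquiv).symm
  -- The range of `χ` is killed by `p ^ k`, so it embeds in the `p ^ k`-torsion of `ℚ_p / ℤ_p`, that
  -- is, in the dual of `ℤ_p / p ^ k`.
  have h4 : Nat.card (LinearMap.range χ) ≤ p ^ k := by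
    have hp0 : (p : ℚ_[p]) ≠ 0 := by exact_mod_cast (Fact.out : p.Prime).ne_zero
    rw [← card_quotient_span_p_pow, ← Nat.card_congr
      (nonempty_dual_cyclic (p := p) (pow_ne_zero k (PadicInt.prime_p (p := p)).ne_zero)).some.toEquiv]
    have := finite_quotient_span_singleton (pow_ne_zero k (PadicInt.prime_p (p := p)).ne_zero)
    have hz : ∀ y ∈ LinearMap.range χ, (Ideal.span {(p : ℤ_[p]) ^ k}) ≤
        LinearMap.ker (LinearMap.toSpanSingleton ℤ_[p] _ y) := by
      rintro _ ⟨g, rfl⟩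
      rw [← hk]
      intro r hr
      exact LinearMap.congr_fun hr g
    refine Nat.card_le_card_of_injective
      (fun y : LinearMap.range χ => Submodule.liftQ _ _ (hz y.1 y.2)) fun y y' h => ?_
    ext
    have := LinearMap.congr_fun h (Submodule.Quotient.mk 1)
    rwa [Submodule.liftQ_apply, Submodule.liftQ_apply,
      LinearMap.toSpanSingleton_apply_one, LinearMap.toSpanSingleton_apply_one] at this
  have h5 : Submodule.span ℤ_[p] {χ} = LinearMap.ker R := by
    refine SetLike.coe_injective (Set.eq_of_subset_of_ncard_le hle ?_ (Set.toFinite _))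
    rw [← Nat.card_coe_set_eq, ← Nat.card_coe_set_eq]
    change Nat.card (LinearMap.ker R) ≤ Nat.card (Submodule.span ℤ_[p] {χ})
    omega
  exact ⟨(((Submodule.quotEquivOfEq _ _ h5).trans (R.quotKerEquivOfSurjective hR)).trans
    (nonempty_dual_equiv _).some).symm⟩

end Dual

/-- Since `Nat.card` of an infinite type is `0`, the condition `n ≠ 0` makes the fibres finite;
finiteness of `X` need not be known beforehand. -/
theorem card_eq_mul_of_card_fiber {X B : Type*} [Finite B] (π : X → B) {n : ℕ} (hn : n ≠ 0)
    (h : ∀ b, Nat.card {x // π x = b} = n) : Nat.card X = Nat.card B * n := by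
  have := Fintype.ofFinite B
  have : ∀ b, Finite {x // π x = b} := fun b => Nat.finite_of_card_ne_zero (by rw [h]; exact hn)
  rw [← Nat.card_congr (Equiv.sigmaFiberEquiv π), Nat.card_sigma]
  simp [h]

/-! ### Extensions of `G` by `ℤ_p` and maps from their middle terms -/

section

variable {p : ℕ} [Fact p.Prime]

theorem exists_comp_eq_of_ker_le {A B C : Type*} [AddCommGroup A] [Module ℤ_[p] A] [AddCommGroup B]
    [Module ℤ_[p] B] [AddCommGroup C] [Module ℤ_[p] C] (j : A →ₗ[ℤ_[p]] B) (hj : Surjective j)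
    (h : A →ₗ[ℤ_[p]] C) (hk : LinearMap.ker j ≤ LinearMap.ker h) :
    ∃ η : B →ₗ[ℤ_[p]] C, ∀ x, η (j x) = h x := by
  refine ⟨Submodule.liftQ _ h hk ∘ₗ (j.quotKerEquivOfSurjective hj).symm.toLinearMap, fun x => ?_⟩
  rw [LinearMap.comp_apply, LinearEquiv.coe_coe,
    show j x = j.quotKerEquivOfSurjective hj (Submodule.Quotient.mk x) from rfl,
    LinearEquiv.symm_apply_apply, Submodule.liftQ_apply]

/-- A representative of an extension class. -/
noncomputable def extRep {G : Type} [AddCommGroup G] [Module ℤ_[p] G] (c : ExtZp p G) :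
    Extension p G :=
  Quotient.out (s := extensionSetoid p G) c

theorem natCast_card_ne_zero_padic (G : Type*) [Finite G] [Nonempty G] :
    ((Nat.card G : ℤ_[p]) : ℚ_[p]) ≠ 0 :=
  PadicInt.coe_ne_zero.2 (natCast_card_ne_zero G)

namespace Extension

variable {G : Type} [AddCommGroup G] [Module ℤ_[p] G] (E : Extension p G)

theorem proj_inl (x : ℤ_[p]) : E.proj (E.inl x) = 0 := (E.exact (E.inl x)).2 ⟨x, rfl⟩

section Induced

variable {F : Type} [AddCommGroup F] [Module ℤ_[p] F] {a : F}
  (ψ : G →ₗ[ℤ_[p]] F ⧸ Submodule.span ℤ_[p] {a})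

/-- The fibre product of `G` and `F` over `F / a`. -/
noncomputable def fibreProduct : Submodule ℤ_[p] (G × F) :=
  LinearMap.eqLocus (ψ ∘ₗ LinearMap.fst _ _ _) (Submodule.mkQ _ ∘ₗ LinearMap.snd _ _ _)

theorem mem_fibreProduct {m : G × F} :
    m ∈ fibreProduct ψ ↔ ψ m.1 = Submodule.Quotient.mk m.2 := Iff.rfl


theorem map_inl (f : E.middle →ₗ[ℤ_[p]] F) (x : ℤ_[p]) : f (E.inl x) = x • f (E.inl 1) := by
  rw [← map_smul, ← map_smul, smul_eq_mul, mul_one]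

theorem exists_induced (f : E.middle →ₗ[ℤ_[p]] F) :
    ∃ ψ : G →ₗ[ℤ_[p]] F ⧸ Submodule.span ℤ_[p] {f (E.inl 1)},
      ∀ e, ψ (E.proj e) = Submodule.Quotient.mk (f e) := by
  refine exists_comp_eq_of_ker_le E.proj E.proj_surjective (Submodule.mkQ _ ∘ₗ f) fun e he => ?_
  obtain ⟨x, rfl⟩ := (E.exact e).1 he
  rw [LinearMap.mem_ker, LinearMap.comp_apply, Submodule.mkQ_apply, Submodule.Quotient.mk_eq_zero]
  exact Submodule.mem_span_singleton.2 ⟨x, (E.map_inl f x).symm⟩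

theorem surjective_iff_induced {f : E.middle →ₗ[ℤ_[p]] F} {ψ} (hfa : f (E.inl 1) = a)
    (h : ∀ e, ψ (E.proj e) = (Submodule.Quotient.mk (f e) : F ⧸ Submodule.span ℤ_[p] {a})) :
    Surjective f ↔ Surjective ψ := by
  subst hfa
  constructor
  · intro hf y
    obtain ⟨y, rfl⟩ := Submodule.Quotient.mk_surjective _ y
    obtain ⟨e, rfl⟩ := hf y
    exact ⟨_, h e⟩
  · intro hψ y
    obtain ⟨g, hg⟩ := hψ (Submodule.Quotient.mk y)
    obtain ⟨e, rfl⟩ := E.proj_surjective g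
    rw [h, eq_comm, Submodule.Quotient.eq] at hg
    obtain ⟨r, hr⟩ := Submodule.mem_span_singleton.1 hg
    exact ⟨e + E.inl r, by rw [map_add, map_inl, hr]; abel⟩

end Induced

theorem card_smul_mem_range (e : E.middle) :
    (Nat.card G : ℤ_[p]) • e ∈ LinearMap.range E.inl :=
  (E.exact _).1 (by rw [map_smul, Nat.cast_smul_eq_nsmul, card_nsmul_eq_zero'])

variable [Finite G]

/-- The unique linear extension to the middle term of the inclusion `ℤ_p → ℚ_p`. -/
noncomputable def toPadic : E.middle →ₗ[ℤ_[p]] ℚ_[p] :=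
  -- Multiplication by `#G` lands in the copy of `ℤ_p`; the result is divided by `#G` in `ℚ_p`.
  ((Nat.card G : ℤ_[p]) : ℚ_[p])⁻¹ • (Algebra.linearMap ℤ_[p] ℚ_[p] ∘ₗ
    (LinearEquiv.ofInjective E.inl E.inl_injective).symm.toLinearMap ∘ₗ
    LinearMap.codRestrict (LinearMap.range E.inl)
      ((Nat.card G : ℤ_[p]) • (LinearMap.id : E.middle →ₗ[ℤ_[p]] E.middle)) E.card_smul_mem_range)

theorem toPadic_unique {g : E.middle →ₗ[ℤ_[p]] ℚ_[p]} {g' : E.middle →ₗ[ℤ_[p]] ℚ_[p]}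
    (h : ∀ x, g (E.inl x) = g' (E.inl x)) : g = g' := by
  ext e
  obtain ⟨z, hz⟩ := E.card_smul_mem_range e
  have := h z
  rw [hz, map_smul, map_smul, padicInt_smul_eq_mul, padicInt_smul_eq_mul] at this
  exact mul_left_cancel₀ (natCast_card_ne_zero_padic G) this

@[simp]
theorem toPadic_inl (x : ℤ_[p]) : E.toPadic (E.inl x) = x := by
  have h : LinearMap.codRestrict (LinearMap.range E.inl)
      ((Nat.card G : ℤ_[p]) • (LinearMap.id : E.middle →ₗ[ℤ_[p]] E.middle)) E.card_smul_mem_range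
      (E.inl x) = LinearEquiv.ofInjective E.inl E.inl_injective ((Nat.card G : ℤ_[p]) * x) := by
    ext
    simp [← smul_eq_mul]
  rw [toPadic, LinearMap.smul_apply, LinearMap.comp_apply, LinearMap.comp_apply, h,
    LinearEquiv.coe_coe, LinearEquiv.symm_apply_apply, Algebra.linearMap_apply, map_mul, smul_eq_mul]
  exact inv_mul_cancel_left₀ (natCast_card_ne_zero_padic G) _

theorem eq_zero_of_proj_of_toPadic {e : E.middle} (h1 : E.proj e = 0) (h2 : E.toPadic e = 0) :
    e = 0 := by
  obtain ⟨x, rfl⟩ := (E.exact e).1 h1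
  rw [toPadic_inl, PadicInt.coe_eq_zero] at h2
  rw [h2, map_zero]

theorem toPadic_equiv {E' : Extension p G} (e : E.middle ≃ₗ[ℤ_[p]] E'.middle)
    (h : ∀ x, e (E.inl x) = E'.inl x) (y : E.middle) : E'.toPadic (e y) = E.toPadic y := by
  have : E'.toPadic ∘ₗ e.toLinearMap = E.toPadic := E.toPadic_unique fun x => by simp [h]
  exact LinearMap.congr_fun this y

section Fiber

variable {F : Type} [AddCommGroup F] [Module ℤ_[p] F]

/-- The joint map to `G × F × ℚ_p` given by a map to `F`. -/
noncomputable def joint (f : E.middle →ₗ[ℤ_[p]] F) : E.middle →ₗ[ℤ_[p]] (G × F) × ℚ_[p] :=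
  (E.proj.prod f).prod E.toPadic

/-- This realises every pair `(E, f)` as a submodule of the fixed module `(G × F) × ℚ_p`, where
pairs can be compared. -/
theorem joint_injective (f : E.middle →ₗ[ℤ_[p]] F) : Injective (E.joint f) := by
  rw [injective_iff_map_eq_zero]
  intro e he
  simp only [joint, LinearMap.prod_apply, Function.prod_apply, Prod.mk_eq_zero] at he
  exact E.eq_zero_of_proj_of_toPadic he.1.1 he.2

variable {a : F} (ψ : G →ₗ[ℤ_[p]] F ⧸ Submodule.span ℤ_[p] {a})

/-- The scaling by `p⁻ᵏ`, followed by reduction modulo `ℤ_p`. -/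
noncomputable def scaled (k : ℕ) : ℚ_[p] →ₗ[ℤ_[p]] QpModZp p :=
  toQpModZp p ∘ₗ (((p : ℚ_[p]) ^ k)⁻¹ • LinearMap.id)

theorem p_pow_ne_zero (k : ℕ) : (p : ℚ_[p]) ^ k ≠ 0 :=
  pow_ne_zero _ (by exact_mod_cast (Fact.out : p.Prime).ne_zero)

theorem scaled_eq_zero {k : ℕ} {x : ℚ_[p]} :
    scaled k x = 0 ↔ ∃ z : ℤ_[p], x = ((p ^ k * z : ℤ_[p]) : ℚ_[p]) := by
  rw [scaled, LinearMap.comp_apply, LinearMap.smul_apply, LinearMap.id_apply, toQpModZp_eq_zero]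
  refine exists_congr fun z => ?_
  rw [smul_eq_mul, eq_inv_mul_iff_mul_eq₀ (p_pow_ne_zero k), eq_comm, PadicInt.coe_mul,
    PadicInt.coe_pow, PadicInt.coe_natCast]

theorem scaled_surjective (k : ℕ) : Surjective (scaled (p := p) k) := fun y => by
  obtain ⟨x, rfl⟩ := toQpModZp_surjective y
  refine ⟨(p : ℚ_[p]) ^ k * x, ?_⟩
  rw [scaled, LinearMap.comp_apply, LinearMap.smul_apply, LinearMap.id_apply, smul_eq_mul,
    inv_mul_cancel_left₀ (p_pow_ne_zero k)]

variable {ψ} {k : ℕ}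

/-- The middle term maps onto the fibre product. An element of the kernel is some `inl x` with `x •
a = 0`, so `p ^ k` divides `x`, and `toPadic / p ^ k` modulo `ℤ_p` descends. -/
theorem exists_character (hk : ∀ r : ℤ_[p], r • a = 0 ↔ ∃ z, r = p ^ k * z)
    {f : E.middle →ₗ[ℤ_[p]] F} (hfa : f (E.inl 1) = a)
    (hψ : ∀ e, ψ (E.proj e) = Submodule.Quotient.mk (f e)) :
    ∃ η : fibreProduct ψ →ₗ[ℤ_[p]] QpModZp p, ∀ e,
      η ⟨(E.proj e, f e), hψ e⟩ = scaled k (E.toPadic e) := by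
  have hfx : ∀ x, f (E.inl x) = x • a := fun x => by
    rw [← hfa, ← map_smul, ← map_smul, smul_eq_mul, mul_one]
  have hψ' : ∀ e, (E.proj.prod f) e ∈ fibreProduct ψ := hψ
  let j := LinearMap.codRestrict (fibreProduct ψ) (E.proj.prod f) hψ'
  have hj : ∀ e, (j e : G × F) = (E.proj e, f e) := fun _ => rfl
  refine exists_comp_eq_of_ker_le j ?_ (scaled k ∘ₗ E.toPadic) ?_
  · rintro ⟨⟨g, y⟩, h⟩
    obtain ⟨e, rfl⟩ := E.proj_surjective g
    rw [mem_fibreProduct] at h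
    dsimp only at h
    rw [hψ, eq_comm, Submodule.Quotient.eq] at h
    obtain ⟨c, hc⟩ := Submodule.mem_span_singleton.1 h
    refine ⟨e + E.inl c, Subtype.ext ?_⟩
    rw [hj, map_add, map_add, proj_inl, hfx, hc, add_zero, add_sub_cancel]
  · intro e he
    have he' := congrArg Subtype.val (LinearMap.mem_ker.1 he)
    rw [hj, Submodule.coe_zero, Prod.mk_eq_zero] at he'
    obtain ⟨x, rfl⟩ := (E.exact e).1 he'.1
    rw [hfx, hk] at he'
    obtain ⟨z, rfl⟩ := he'.2
    rw [LinearMap.mem_ker, LinearMap.comp_apply, toPadic_inl, scaled_eq_zero]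
    exact ⟨z, rfl⟩

/-- The character `η` alone determines the submodule realising `(E, f)`, hence the pair up to
equivalence. -/
theorem mem_range_joint (hk : ∀ r : ℤ_[p], r • a = 0 ↔ ∃ z, r = p ^ k * z)
    {f : E.middle →ₗ[ℤ_[p]] F} (hfa : f (E.inl 1) = a)
    (hψ : ∀ e, ψ (E.proj e) = Submodule.Quotient.mk (f e))
    {η : fibreProduct ψ →ₗ[ℤ_[p]] QpModZp p}
    (hη : ∀ e, η ⟨(E.proj e, f e), hψ e⟩ = scaled k (E.toPadic e)) (m : (G × F) × ℚ_[p]) :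
    m ∈ LinearMap.range (E.joint f) ↔ ∃ h : m.1 ∈ fibreProduct ψ, η ⟨m.1, h⟩ = scaled k m.2 := by
  have hfx : ∀ x, f (E.inl x) = x • a := fun x => by
    rw [← hfa, ← map_smul, ← map_smul, smul_eq_mul, mul_one]
  constructor
  · rintro ⟨e, rfl⟩
    exact ⟨hψ e, hη e⟩
  · obtain ⟨⟨g, y⟩, x⟩ := m
    rintro ⟨h, hx⟩
    obtain ⟨e, rfl⟩ := E.proj_surjective g
    have h' := h
    rw [mem_fibreProduct] at h'
    dsimp only at h' hx
    rw [hψ, eq_comm, Submodule.Quotient.eq] at h'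
    obtain ⟨c, hc⟩ := Submodule.mem_span_singleton.1 h'
    have h1 : (⟨(E.proj e, y), h⟩ : fibreProduct ψ) = ⟨(E.proj (e + E.inl c), f (e + E.inl c)), hψ _⟩ := by
      refine Subtype.ext (Prod.ext ?_ ?_)
      · simp [proj_inl]
      · simp [hfx, hc]
    rw [h1, hη, ← sub_eq_zero, ← map_sub, scaled_eq_zero] at hx
    obtain ⟨z, hz⟩ := hx
    refine ⟨e + E.inl c - E.inl (p ^ k * z), ?_⟩
    have h2 : (p ^ k * z : ℤ_[p]) • a = 0 := (hk _).2 ⟨z, rfl⟩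
    simp only [joint, LinearMap.prod_apply, Function.prod_apply]
    refine Prod.ext (Prod.ext ?_ ?_) ?_
    · simp [proj_inl]
    · simp [hfx, h2, hc]
    · simp only [map_sub, toPadic_inl, ← hz]; ring

/-- The extension attached to a character of the fibre product. -/
noncomputable def ofCharacter (hk : ∀ r : ℤ_[p], r • a = 0 ↔ ∃ z, r = p ^ k * z)
    (η : fibreProduct ψ →ₗ[ℤ_[p]] QpModZp p)
    (h0 : (0, a) ∈ fibreProduct ψ) (hη : η ⟨(0, a), h0⟩ = scaled k 1) : Extension p G where
  middle := LinearMap.eqLocus (η ∘ₗ LinearMap.fst _ _ _) (scaled k ∘ₗ LinearMap.snd _ _ _)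
  inl := LinearMap.toSpanSingleton ℤ_[p] _ ⟨(⟨(0, a), h0⟩, 1), hη⟩
  proj := LinearMap.fst _ _ _ ∘ₗ (fibreProduct ψ).subtype ∘ₗ LinearMap.fst _ _ _ ∘ₗ
    Submodule.subtype _
  inl_injective := by
    rw [injective_iff_map_eq_zero]
    intro x hx
    have := congrArg (fun t => t.1.2) hx
    simpa [LinearMap.toSpanSingleton_apply, padicInt_smul_eq_mul] using this
  exact := by
    rintro ⟨⟨⟨⟨g, y⟩, h⟩, x⟩, hx⟩
    constructor
    · intro hg
      change g = 0 at hg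
      subst hg
      have hx' : η ⟨(0, y), h⟩ = scaled k x := hx
      have hy := h
      rw [mem_fibreProduct] at hy
      dsimp only at hy
      rw [map_zero, eq_comm, Submodule.Quotient.mk_eq_zero] at hy
      obtain ⟨c, rfl⟩ := Submodule.mem_span_singleton.1 hy
      have h1 : (⟨(0, c • a), h⟩ : fibreProduct ψ) = c • ⟨(0, a), h0⟩ := by
        ext <;> simp
      rw [h1, map_smul, hη, ← map_smul, eq_comm, ← sub_eq_zero, ← map_sub, scaled_eq_zero] at hx'
      obtain ⟨z, hz⟩ := hx'
      have hx2 : x = (c + p ^ k * z : ℤ_[p]) := by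
        rw [PadicInt.coe_add, ← hz, padicInt_smul_eq_mul]; ring
      have h2 : (p ^ k * z : ℤ_[p]) • a = 0 := (hk _).2 ⟨z, rfl⟩
      refine ⟨c + p ^ k * z, ?_⟩
      refine Subtype.ext (Prod.ext (Subtype.ext (Prod.ext ?_ ?_)) ?_)
      · simp
      · simp [add_smul, h2]
      · refine Eq.trans ?_ hx2.symm
        exact mul_one ((c + p ^ k * z : ℤ_[p]) : ℚ_[p])
    · rintro ⟨c, hc⟩
      rw [← hc]
      simp [LinearMap.toSpanSingleton_apply]
  proj_surjective := fun g => by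
    obtain ⟨y, hy⟩ := Submodule.Quotient.mk_surjective _ (ψ g)
    obtain ⟨x, hx⟩ := scaled_surjective k (η ⟨(g, y), hy.symm⟩)
    exact ⟨⟨(⟨(g, y), hy.symm⟩, x), hx.symm⟩, rfl⟩

variable (ψ) in
/-- Pairs of an extension class and a map from its middle term to `F` that sends the generator of
`ℤ_p` to `a` and induces `ψ` on `G`. -/
def LiftPair : Type 1 :=
  {x : Σ c : ExtZp p G, (extRep c).middle →ₗ[ℤ_[p]] F //
    x.2 ((extRep x.1).inl 1) = a ∧
      ∀ e, ψ ((extRep x.1).proj e) = Submodule.Quotient.mk (x.2 e)}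

theorem exists_span_pow [Finite F] (a : F) :
    ∃ k : ℕ, ∀ r : ℤ_[p], r • a = 0 ↔ ∃ z, r = (p : ℤ_[p]) ^ k * z := by
  have hI : LinearMap.ker (LinearMap.toSpanSingleton ℤ_[p] _ a) ≠ ⊥ := by
    intro h
    refine natCast_card_ne_zero (p := p) F ?_
    rw [← Submodule.mem_bot (R := ℤ_[p]), ← h, LinearMap.mem_ker, LinearMap.toSpanSingleton_apply,
      Nat.cast_smul_eq_nsmul, card_nsmul_eq_zero']
  obtain ⟨k, hk⟩ := exists_ideal_eq_span_pow hI
  refine ⟨k, fun r => ?_⟩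
  rw [← LinearMap.toSpanSingleton_apply, ← LinearMap.mem_ker, hk, Ideal.mem_span_singleton]
  rfl

/-- Pairs `(E, f)` correspond to characters of the fibre product with value `p⁻ᵏ` at `(0, a)`, where
`p ^ k` is the order of `a`. Their number is the index of the span of `(0, a)`, which is the kernel
of the projection onto `G`. The count does not depend on `F`, `a` or `ψ`. -/
theorem card_liftPair [Finite F] (ψ : G →ₗ[ℤ_[p]] F ⧸ Submodule.span ℤ_[p] {a}) :
    Nat.card (LiftPair ψ) = Nat.card G := by
  obtain ⟨k, hk⟩ := exists_span_pow (p := p) a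
  have h0 : (0, a) ∈ fibreProduct ψ := by
    rw [mem_fibreProduct]
    dsimp only
    rw [map_zero, eq_comm, Submodule.Quotient.mk_eq_zero]
    exact Submodule.mem_span_singleton_self a
  have hcard : Nat.card {η : fibreProduct ψ →ₗ[ℤ_[p]] QpModZp p // η ⟨(0, a), h0⟩ = scaled k 1} =
      Nat.card G := by
    rw [card_characters_apply_eq]
    · let π : fibreProduct ψ →ₗ[ℤ_[p]] G := LinearMap.fst _ _ _ ∘ₗ (fibreProduct ψ).subtype
      have hπ : Surjective π := fun g => by
        obtain ⟨y, hy⟩ := Submodule.Quotient.mk_surjective _ (ψ g)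
        exact ⟨⟨(g, y), hy.symm⟩, rfl⟩
      have hker : LinearMap.ker π = Submodule.span ℤ_[p] {⟨(0, a), h0⟩} := by
        ext ⟨⟨g, y⟩, h⟩
        rw [Submodule.mem_span_singleton]
        constructor
        · intro hg
          change g = 0 at hg
          subst hg
          rw [mem_fibreProduct] at h
          dsimp only at h
          rw [map_zero, eq_comm, Submodule.Quotient.mk_eq_zero] at h
          obtain ⟨c, rfl⟩ := Submodule.mem_span_singleton.1 h
          exact ⟨c, by ext <;> simp⟩
        · rintro ⟨c, hc⟩
          rw [← hc]
          simp [π]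
      rw [← hker]
      exact Nat.card_congr (π.quotKerEquivOfSurjective hπ).toEquiv
    · intro r hr
      have h1 := congrArg (fun t => t.1.2) hr
      obtain ⟨z, rfl⟩ := (hk r).1 h1
      rw [← map_smul, scaled_eq_zero]
      exact ⟨z, by rw [padicInt_smul_eq_mul, mul_one]⟩
  rw [← hcard]
  choose η hη using fun x : LiftPair ψ =>
    (extRep x.1.1).exists_character hk x.2.1 x.2.2
  refine Nat.card_congr (Equiv.ofBijective (fun x => ⟨η x, ?_⟩) ⟨?_, ?_⟩)
  · have := hη x ((extRep x.1.1).inl 1)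
    rw [toPadic_inl, PadicInt.coe_one] at this
    rw [← this]
    congr 3
    · exact (proj_inl _ _).symm
    · exact x.2.1.symm
  · rintro x x' hxx
    have hxx : η x = η x' := congrArg Subtype.val hxx
    -- Equal characters give equal submodules, hence an isomorphism of middle terms compatible with
    -- `proj`, `toPadic` and the maps to `F`.
    have hr : LinearMap.range ((extRep x.1.1).joint x.1.2) =
        LinearMap.range ((extRep x'.1.1).joint x'.1.2) := by
      ext m
      rw [mem_range_joint _ hk x.2.1 x.2.2 (hη x), mem_range_joint _ hk x'.2.1 x'.2.2 (hη x'), hxx]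
    let e := ((LinearEquiv.ofInjective _ ((extRep x.1.1).joint_injective x.1.2)).trans
      (LinearEquiv.ofEq _ _ hr)).trans
      (LinearEquiv.ofInjective _ ((extRep x'.1.1).joint_injective x'.1.2)).symm
    have he : ∀ y, (extRep x'.1.1).joint x'.1.2 (e y) = (extRep x.1.1).joint x.1.2 y := by
      intro y
      have h1 := (LinearEquiv.ofInjective _
        ((extRep x'.1.1).joint_injective x'.1.2)).apply_symm_apply
          (LinearEquiv.ofEq _ _ hr (LinearEquiv.ofInjective _
            ((extRep x.1.1).joint_injective x.1.2) y))
      exact congrArg Subtype.val h1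
    have he1 : ∀ y, (extRep x'.1.1).proj (e y) = (extRep x.1.1).proj y :=
      fun y => congrArg (fun t => t.1.1) (he y)
    have he2 : ∀ y, x'.1.2 (e y) = x.1.2 y := fun y => congrArg (fun t => t.1.2) (he y)
    have he3 : ∀ y, (extRep x'.1.1).toPadic (e y) = (extRep x.1.1).toPadic y :=
      fun y => congrArg (fun t => t.2) (he y)
    have he4 : ∀ z, e ((extRep x.1.1).inl z) = (extRep x'.1.1).inl z := fun z =>
      sub_eq_zero.1 (eq_zero_of_proj_of_toPadic _
        (by rw [map_sub, he1, proj_inl, proj_inl, sub_zero])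
        (by rw [map_sub, he3, toPadic_inl, toPadic_inl, sub_self]))
    have hc : x.1.1 = x'.1.1 := Quotient.out_equiv_out.1 ⟨e, he4, he1⟩
    obtain ⟨⟨c, f⟩, hx⟩ := x
    obtain ⟨⟨c', f'⟩, hx'⟩ := x'
    dsimp only at hc
    subst hc
    -- An extension has no self-equivalence but the identity, as `proj` and `toPadic` jointly
    -- separate points; this makes the two maps equal.
    have hid : ∀ y, e y = y := fun y => sub_eq_zero.1 (eq_zero_of_proj_of_toPadic _
        (by rw [map_sub]; exact sub_eq_zero.2 (he1 y)) (by rw [map_sub]; exact sub_eq_zero.2 (he3 y)))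
    have hf : f = f' := by
      ext y
      rw [← he2 y]
      exact congrArg f' (hid y)
    subst hf
    rfl
  · rintro ⟨θ, hθ⟩
    let S := ofCharacter hk θ h0 hθ
    obtain ⟨e, he1, he2⟩ : extRep (Quotient.mk (extensionSetoid p G) S) ≈ S :=
      Quotient.mk_out S
    let s : S.middle →ₗ[ℤ_[p]] F := LinearMap.snd _ _ _ ∘ₗ (fibreProduct ψ).subtype ∘ₗ
      LinearMap.fst _ _ _ ∘ₗ Submodule.subtype _
    have hsa : s (S.inl 1) = a := one_smul _ a
    have hsψ : ∀ y, ψ (S.proj y) = Submodule.Quotient.mk (s y) := fun y => y.1.1.2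
    let q : S.middle →ₗ[ℤ_[p]] ℚ_[p] := LinearMap.snd _ _ _ ∘ₗ Submodule.subtype _
    have hq : q = S.toPadic := S.toPadic_unique fun x => by
      rw [toPadic_inl]
      exact (mul_one (x : ℚ_[p]))
    have hsθ : ∀ y, θ ⟨(S.proj y, s y), hsψ y⟩ = scaled k (S.toPadic y) := fun y => by
      rw [← hq]
      exact y.2
    let x : LiftPair ψ := ⟨⟨Quotient.mk _ S, s ∘ₗ e.toLinearMap⟩, by
      change s (e _) = a
      rw [he1, hsa], fun y => by
      change _ = Submodule.Quotient.mk (s (e y))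
      rw [← hsψ, he2]⟩
    refine ⟨x, Subtype.ext ?_⟩
    dsimp only
    ext ⟨⟨g, y⟩, h⟩
    obtain ⟨c, hc⟩ := scaled_surjective k (η x ⟨(g, y), h⟩)
    obtain ⟨w, hw⟩ := ((extRep x.1.1).mem_range_joint hk x.2.1 x.2.2 (hη x) ((g, y), c)).2
      ⟨h, hc.symm⟩
    have h1 : (⟨(g, y), h⟩ : fibreProduct ψ) = ⟨_, x.2.2 w⟩ :=
      Subtype.ext (congrArg Prod.fst hw).symm
    rw [h1]
    refine (hη x w).trans (Eq.trans ?_ ((hsθ (e w)).symm.trans ?_))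
    · rw [toPadic_equiv _ e he1]
    · congr 3
      exact he2 w

end Fiber

end Extension

variable (p) in
-- For trivial `F` a lift carries no information, so lift pairs are just extension classes.
theorem card_extZp (G : Type) [AddCommGroup G] [Module ℤ_[p] G] [Finite G] :
    Nat.card (ExtZp p G) = Nat.card G := by
  rw [← Extension.card_liftPair (p := p) (F := PUnit) (a := 0) (0 : G →ₗ[ℤ_[p]] _)]
  exact (Nat.card_congr ⟨fun x => x.1.1, fun c => ⟨⟨c, 0⟩, rfl, fun _ => rfl⟩,
    fun x => Subtype.ext (Sigma.ext rfl (heq_of_eq (Subsingleton.elim _ _))), fun _ => rfl⟩).symm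

instance finite_extZp (G : Type) [AddCommGroup G] [Module ℤ_[p] G] [Finite G] :
    Finite (ExtZp p G) :=
  Nat.finite_of_card_ne_zero (by rw [card_extZp]; exact Nat.card_pos.ne')

/-- The average number of surjections to `F` from the middle term of a random extension. -/
theorem card_sigma_surj_extension (G : Type) [AddCommGroup G] [Module ℤ_[p] G] [Finite G]
    (F : Type) [AddCommGroup F] [Module ℤ_[p] F] [Finite F] :
    Nat.card (Σ c : ExtZp p G, {f : (extRep c).middle →ₗ[ℤ_[p]] F // Surjective f}) =
      Nat.card (Σ a : F, {ψ : G →ₗ[ℤ_[p]] F ⧸ Submodule.span ℤ_[p] {a} // Surjective ψ}) *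
        Nat.card G := by
  choose ψ hψ using fun (c : ExtZp p G) (f : (extRep c).middle →ₗ[ℤ_[p]] F) =>
    (extRep c).exists_induced f
  let Φ : (Σ c : ExtZp p G, {f : (extRep c).middle →ₗ[ℤ_[p]] F // Surjective f}) →
      Σ a : F, {ψ : G →ₗ[ℤ_[p]] F ⧸ Submodule.span ℤ_[p] {a} // Surjective ψ} :=
    fun x => ⟨x.2.1 ((extRep x.1).inl 1), ψ x.1 x.2.1,
      ((extRep x.1).surjective_iff_induced rfl (hψ x.1 x.2.1)).1 x.2.2⟩
  have hΦ : ∀ x a (φ : G →ₗ[ℤ_[p]] F ⧸ Submodule.span ℤ_[p] {a}) (hφ : Surjective φ), Φ x = ⟨a, φ, hφ⟩ ↔ x.2.1 ((extRep x.1).inl 1) = a ∧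
      ∀ e, φ ((extRep x.1).proj e) = Submodule.Quotient.mk (x.2.1 e) := by
    rintro ⟨c, f, hf⟩ a φ hφ
    constructor
    · intro h
      cases h
      exact ⟨rfl, hψ c f⟩
    · rintro ⟨rfl, h2⟩
      have : ψ c f = φ := by
        ext g
        obtain ⟨e, rfl⟩ := (extRep c).proj_surjective g
        rw [h2, hψ]
      subst this
      rfl
  -- The fibre of `Φ` over `(a, φ)` is `LiftPair φ`; surjectivity of the lift is automatic from that
  -- of `φ`.
  refine card_eq_mul_of_card_fiber Φ Nat.card_pos.ne' ?_
  rintro ⟨a, φ, hφ⟩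
  rw [← Extension.card_liftPair φ]
  exact Nat.card_congr
    ⟨fun x => ⟨⟨x.1.1, x.1.2.1⟩, (hΦ _ _ _ _).1 x.2⟩,
      fun x => ⟨⟨x.1.1, x.1.2, ((extRep x.1.1).surjective_iff_induced x.2.1 x.2.2).2 hφ⟩,
        (hΦ _ _ _ _).2 x.2⟩, fun _ => rfl, fun _ => rfl⟩

end

/-! ### Extensions with middle term `H` as surjections from `H` with cyclic kernel -/

section RankOne

variable {p : ℕ} [Fact p.Prime]

/-- A surjection to `ℤ_p` with torsion kernel. -/
structure IsTorsionProj {H : Type*} [AddCommGroup H] [Module ℤ_[p] H] (q : H →ₗ[ℤ_[p]] ℤ_[p]) :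
    Prop where
  surjective : Surjective q
  torsion : ∀ h, q h = 0 → ∃ r : ℤ_[p], r ≠ 0 ∧ r • h = 0

theorem p_pow_padicInt_ne_zero (m : ℕ) : (p : ℤ_[p]) ^ m ≠ 0 :=
  pow_ne_zero _ PadicInt.prime_p.ne_zero

theorem exists_isTorsionProj (H : Type*) [AddCommGroup H] [Module ℤ_[p] H] [Module.Finite ℤ_[p] H]
    (hH : Module.finrank ℤ_[p] H = 1) : ∃ q : H →ₗ[ℤ_[p]] ℤ_[p], IsTorsionProj q := by
  let T := Submodule.torsion ℤ_[p] H
  have : Module.IsTorsionFree ℤ_[p] (H ⧸ T) :=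
    Submodule.isTorsionFree_iff_torsion_eq_bot.2 Submodule.QuotientTorsion.torsion_eq_bot
  have : Module.Free ℤ_[p] (H ⧸ T) := Module.free_of_finite_type_torsion_free'
  have h1 : Module.finrank ℤ_[p] (H ⧸ T) = 1 := by
    rw [finrank_quotient_eq_of_le_torsion le_rfl, hH]
  let e : (H ⧸ T) ≃ₗ[ℤ_[p]] ℤ_[p] :=
    LinearEquiv.ofFinrankEq _ _ (by rw [h1, Module.finrank_self])
  refine ⟨e.toLinearMap ∘ₗ T.mkQ, e.surjective.comp T.mkQ_surjective, fun h hh => ?_⟩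
  have h2 : T.mkQ h = 0 := e.map_eq_zero_iff.1 hh
  rw [Submodule.mkQ_apply, Submodule.Quotient.mk_eq_zero] at h2
  obtain ⟨r, hr⟩ := (Submodule.mem_torsion_iff h).1 h2
  exact ⟨r, nonZeroDivisors.coe_ne_zero r, hr⟩

/-- This rigidifies generators: among the unit multiples of `h`, only one has a power of `p` as its
image under `q`. -/
theorem unit_eq_one_of_mul_pow_eq {u : ℤ_[p]} (hu : IsUnit u) {m n : ℕ}
    (h : u * (p : ℤ_[p]) ^ m = (p : ℤ_[p]) ^ n) : u = 1 := by
  have hn := congrArg norm h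
  rw [norm_mul, PadicInt.isUnit_iff.1 hu, one_mul, PadicInt.norm_p_pow, PadicInt.norm_p_pow] at hn
  have hmn : m = n := by
    have h1 : (1 : ℝ) < p := by exact_mod_cast (Fact.out : p.Prime).one_lt
    have := zpow_right_injective₀ (by positivity) h1.ne' hn
    omega
  subst hmn
  exact mul_right_cancel₀ (p_pow_padicInt_ne_zero m) (h.trans (one_mul _).symm)

namespace IsTorsionProj

variable {H : Type*} [AddCommGroup H] [Module ℤ_[p] H] {q : H →ₗ[ℤ_[p]] ℤ_[p]}

theorem map_eq_zero_of_smul_eq_zero {r : ℤ_[p]} (hr : r ≠ 0) {h : H} (hh : r • h = 0) : q h = 0 := by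
  have := congrArg q hh
  rw [map_smul, map_zero, smul_eq_mul] at this
  exact (mul_eq_zero.1 this).resolve_left hr

theorem smul_generator_injective {h : H} (hh : q h ≠ 0) {r s : ℤ_[p]} (hrs : r • h = s • h) :
    r = s := by
  have := congrArg q hrs
  rw [map_smul, map_smul, smul_eq_mul, smul_eq_mul] at this
  exact mul_right_cancel₀ hh this

variable (hq : IsTorsionProj q)

include hq

theorem exists_smul_mem_span {h : H} (hh : q h ≠ 0) (x : H) :
    ∃ r : ℤ_[p], r ≠ 0 ∧ r • x ∈ Submodule.span ℤ_[p] {h} := by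
  obtain ⟨r, hr, h1⟩ := hq.torsion (q h • x - q x • h) (by
    rw [map_sub, map_smul, map_smul, smul_eq_mul, smul_eq_mul, mul_comm, sub_self])
  refine ⟨r * q h, mul_ne_zero hr hh, Submodule.mem_span_singleton.2 ⟨r * q x, ?_⟩⟩
  rw [smul_sub, sub_eq_zero] at h1
  rw [mul_smul, mul_smul, h1]

theorem finite_quotient [Module.Finite ℤ_[p] H] {h : H} (hh : q h ≠ 0) :
    Finite (H ⧸ Submodule.span ℤ_[p] {h}) := by
  refine finite_of_isTorsion (p := p) fun a => ?_
  obtain ⟨x, rfl⟩ := Submodule.Quotient.mk_surjective _ a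
  obtain ⟨r, hr, h1⟩ := hq.exists_smul_mem_span hh x
  exact ⟨r, hr, by rwa [← Submodule.Quotient.mk_smul, Submodule.Quotient.mk_eq_zero]⟩

theorem map_ne_zero_of_finite_quotient {h : H} (hf : Finite (H ⧸ Submodule.span ℤ_[p] {h})) :
    q h ≠ 0 := by
  intro h0
  obtain ⟨x, hx⟩ := hq.surjective 1
  have h1 : (Nat.card (H ⧸ Submodule.span ℤ_[p] {h}) : ℤ_[p]) •
      (Submodule.Quotient.mk x : H ⧸ Submodule.span ℤ_[p] {h}) = 0 := by
    rw [Nat.cast_smul_eq_nsmul, card_nsmul_eq_zero']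
  rw [← Submodule.Quotient.mk_smul, Submodule.Quotient.mk_eq_zero] at h1
  obtain ⟨c, hc⟩ := Submodule.mem_span_singleton.1 h1
  have h2 := congrArg q hc
  rw [map_smul, map_smul, h0, hx, smul_zero, smul_eq_mul, mul_one] at h2
  exact natCast_card_ne_zero _ h2.symm

/-- An automorphism preserves the torsion, which is the kernel of `q`, so it acts on the quotient
`ℤ_p` by a unit. -/
theorem exists_isUnit_map_equiv (e : H ≃ₗ[ℤ_[p]] H) :
    ∃ u : ℤ_[p], IsUnit u ∧ ∀ x, q (e x) = u * q x := by
  obtain ⟨x₀, hx₀⟩ := hq.surjective 1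
  have key : ∀ x, q (e x) = q (e x₀) * q x := by
    intro x
    obtain ⟨r, hr, h⟩ := hq.torsion (x - q x • x₀) (by
      rw [map_sub, map_smul, hx₀, smul_eq_mul, mul_one, sub_self])
    have := map_eq_zero_of_smul_eq_zero (q := q) hr (h := e (x - q x • x₀))
      (by rw [← map_smul, h, map_zero])
    rw [map_sub, map_sub, map_smul, map_smul, smul_eq_mul, sub_eq_zero] at this
    rw [this, mul_comm]
  refine ⟨q (e x₀), IsUnit.of_mul_eq_one (q (e.symm x₀)) ?_, key⟩
  rw [← key, LinearEquiv.apply_symm_apply, hx₀]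

theorem finite_ker [Module.Finite ℤ_[p] H] : Finite (LinearMap.ker q) :=
  finite_of_isTorsion (p := p) fun a => by
    obtain ⟨r, hr, h⟩ := hq.torsion a a.2
    exact ⟨r, hr, Subtype.ext h⟩

end IsTorsionProj

/-- Surjections with cyclic kernel. -/
def CyclicSurj (p : ℕ) [Fact p.Prime] (H G : Type*) [AddCommGroup H] [Module ℤ_[p] H]
    [AddCommGroup G] [Module ℤ_[p] G] : Type _ :=
  {π : H →ₗ[ℤ_[p]] G // Surjective π ∧ ∃ h, LinearMap.ker π = Submodule.span ℤ_[p] {h}}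

instance (H G : Type*) [AddCommGroup H] [Module ℤ_[p] H] [Module.Finite ℤ_[p] H]
    [AddCommGroup G] [Module ℤ_[p] G] [Finite G] : Finite (CyclicSurj p H G) :=
  inferInstanceAs (Finite {_π : H →ₗ[ℤ_[p]] G // _})

/-- The automorphisms that are compatible with a map to `ℤ_p`. -/
def AutOver {H : Type*} [AddCommGroup H] [Module ℤ_[p] H] (q : H →ₗ[ℤ_[p]] ℤ_[p]) : Type _ :=
  {e : H ≃ₗ[ℤ_[p]] H // ∀ x, q (e x) = q x}

instance {H : Type*} [AddCommGroup H] [Module ℤ_[p] H] (q : H →ₗ[ℤ_[p]] ℤ_[p]) :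
    Nonempty (AutOver q) := ⟨⟨LinearEquiv.refl _ _, fun _ => rfl⟩⟩

/-- The difference `e - id` is a linear map to the finite module `ker q`. The full automorphism
group contains all unit scalars and is infinite, so only `AutOver q` can serve as a weight. -/
theorem IsTorsionProj.finite_autOver {H : Type*} [AddCommGroup H] [Module ℤ_[p] H]
    [Module.Finite ℤ_[p] H] {q : H →ₗ[ℤ_[p]] ℤ_[p]} (hq : IsTorsionProj q) :
    Finite (AutOver q) := by
  have := hq.finite_ker
  refine Finite.of_injective (fun e : AutOver q => LinearMap.codRestrict (LinearMap.ker q)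
    (e.1.toLinearMap - LinearMap.id) fun x => ?_) fun e e' h => ?_
  · rw [LinearMap.mem_ker, LinearMap.sub_apply, map_sub, LinearEquiv.coe_coe, e.2,
      LinearMap.id_apply, sub_self]
  · refine Subtype.ext (LinearEquiv.ext fun x => ?_)
    have := congrArg Subtype.val (LinearMap.congr_fun h x)
    exact sub_left_injective this

section Count

variable {H G : Type} [AddCommGroup H] [Module ℤ_[p] H]
  [AddCommGroup G] [Module ℤ_[p] G] {q : H →ₗ[ℤ_[p]] ℤ_[p]}

theorem card_smul_mem_ker (π : H →ₗ[ℤ_[p]] G) (x : H) :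
    (Nat.card G : ℤ_[p]) • x ∈ LinearMap.ker π := by
  rw [LinearMap.mem_ker, map_smul, Nat.cast_smul_eq_nsmul, card_nsmul_eq_zero']

variable [Finite G]

namespace IsTorsionProj

variable (hq : IsTorsionProj q)

include hq

theorem map_ne_zero_of_ker_eq {π : H →ₗ[ℤ_[p]] G} (hπ : Surjective π) {h : H}
    (hh : LinearMap.ker π = Submodule.span ℤ_[p] {h}) : q h ≠ 0 := by
  refine hq.map_ne_zero_of_finite_quotient ?_
  rw [← hh]
  exact Finite.of_equiv _ (π.quotKerEquivOfSurjective hπ).symm.toEquiv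

theorem exists_generator (π : CyclicSurj p H G) :
    ∃ h, LinearMap.ker π.1 = Submodule.span ℤ_[p] {h} ∧ ∃ m : ℕ, q h = (p : ℤ_[p]) ^ m := by
  obtain ⟨h, hh⟩ := π.2.2
  have h0 := hq.map_ne_zero_of_ker_eq π.2.1 hh
  refine ⟨(↑(PadicInt.unitCoeff h0)⁻¹ : ℤ_[p]) • h, ?_, (q h).valuation, ?_⟩
  · rw [hh, Submodule.span_singleton_smul_eq (Units.isUnit _)]
  · rw [map_smul, smul_eq_mul, Units.inv_mul_eq_iff_eq_mul]
    exact PadicInt.unitCoeff_spec h0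

theorem generator_unique {π : H →ₗ[ℤ_[p]] G} (hπ : Surjective π) {h h' : H}
    (hh : LinearMap.ker π = Submodule.span ℤ_[p] {h}) {m : ℕ} (hm : q h = (p : ℤ_[p]) ^ m)
    (hh' : LinearMap.ker π = Submodule.span ℤ_[p] {h'}) {m' : ℕ} (hm' : q h' = (p : ℤ_[p]) ^ m') :
    h = h' := by
  have h0 := hq.map_ne_zero_of_ker_eq hπ hh
  obtain ⟨u, hu⟩ := Submodule.mem_span_singleton.1
    (hh ▸ hh' ▸ Submodule.mem_span_singleton_self h' : h' ∈ Submodule.span ℤ_[p] {h})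
  obtain ⟨v, hv⟩ := Submodule.mem_span_singleton.1
    (hh' ▸ hh ▸ Submodule.mem_span_singleton_self h : h ∈ Submodule.span ℤ_[p] {h'})
  have huv : v * u = 1 := smul_generator_injective (q := q) h0 (by rw [mul_smul, hu, hv, one_smul])
  have hu1 : u = 1 := by
    refine unit_eq_one_of_mul_pow_eq (IsUnit.of_mul_eq_one v (by rw [mul_comm, huv])) (m := m) (n := m') ?_
    rw [← hm, ← hm', ← hu, map_smul, smul_eq_mul]
  rw [← hu, hu1, one_smul]

/-- The normalized generator of the kernel. -/
noncomputable def generator (π : CyclicSurj p H G) : H := (hq.exists_generator π).choose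

theorem ker_eq_generator (π : CyclicSurj p H G) :
    LinearMap.ker π.1 = Submodule.span ℤ_[p] {hq.generator π} :=
  (hq.exists_generator π).choose_spec.1

theorem map_generator (π : CyclicSurj p H G) : ∃ m : ℕ, q (hq.generator π) = (p : ℤ_[p]) ^ m :=
  (hq.exists_generator π).choose_spec.2

theorem generator_eq (π : CyclicSurj p H G) {h : H}
    (hh : LinearMap.ker π.1 = Submodule.span ℤ_[p] {h}) {m : ℕ} (hm : q h = (p : ℤ_[p]) ^ m) :
    hq.generator π = h := by
  obtain ⟨n, hn⟩ := hq.map_generator π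
  exact hq.generator_unique π.2.1 (hq.ker_eq_generator π) hn hh hm

/-- The extension attached to a surjection with cyclic kernel. -/
noncomputable def extension (π : CyclicSurj p H G) : Extension p G where
  middle := H
  inl := LinearMap.toSpanSingleton ℤ_[p] H (hq.generator π)
  proj := π.1
  inl_injective := fun _ _ h => smul_generator_injective (q := q)
    (hq.map_ne_zero_of_ker_eq π.2.1 (hq.ker_eq_generator π)) h
  exact := by
    rw [LinearMap.exact_iff, hq.ker_eq_generator, LinearMap.range_toSpanSingleton]
  proj_surjective := π.2.1

/-- Pulling back a surjection with cyclic kernel by an automorphism. -/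
noncomputable def pullback (π : CyclicSurj p H G) (e : AutOver q) : CyclicSurj p H G :=
  ⟨π.1 ∘ₗ e.1.toLinearMap, π.2.1.comp e.1.surjective, e.1.symm (hq.generator π), by
    rw [LinearMap.ker_comp, hq.ker_eq_generator]
    ext x
    rw [Submodule.mem_comap, Submodule.mem_span_singleton, Submodule.mem_span_singleton]
    refine exists_congr fun c => ?_
    rw [← map_smul, LinearEquiv.symm_apply_eq]
    rfl⟩

theorem generator_pullback (π : CyclicSurj p H G) (e : AutOver q) :
    hq.generator (hq.pullback π e) = e.1.symm (hq.generator π) := by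
  obtain ⟨m, hm⟩ := hq.map_generator π
  refine hq.generator_eq _ (m := m) ?_ ?_
  · change LinearMap.ker (π.1 ∘ₗ e.1.toLinearMap) = _
    rw [LinearMap.ker_comp, hq.ker_eq_generator]
    ext x
    rw [Submodule.mem_comap, Submodule.mem_span_singleton, Submodule.mem_span_singleton]
    refine exists_congr fun c => ?_
    rw [← map_smul, LinearEquiv.symm_apply_eq]
    rfl
  · rw [← hm, ← e.2, LinearEquiv.apply_symm_apply]

theorem extension_pullback (π : CyclicSurj p H G) (e : AutOver q) :
    hq.extension (hq.pullback π e) ≈ hq.extension π := by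
  refine ⟨e.1, fun x => ?_, fun y => rfl⟩
  change e.1 (x • hq.generator _) = x • hq.generator π
  rw [generator_pullback, map_smul, LinearEquiv.apply_symm_apply]

/-- If two pullbacks agree, `e x - e' x` lies in the kernel of `π`, which is torsion-free, and is
killed by `#G`. -/
theorem pullback_injective (π : CyclicSurj p H G) : Injective (hq.pullback π) := by
  intro e e' h
  have hg : e.1.symm (hq.generator π) = e'.1.symm (hq.generator π) := by
    rw [← generator_pullback, ← generator_pullback, h]
  refine Subtype.ext (LinearEquiv.ext fun x => ?_)
  have h1 : (Nat.card G : ℤ_[p]) • x ∈ LinearMap.ker (hq.pullback π e).1 := card_smul_mem_ker _ _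
  rw [hq.ker_eq_generator, generator_pullback] at h1
  obtain ⟨c, hc⟩ := Submodule.mem_span_singleton.1 h1
  have h2 : (Nat.card G : ℤ_[p]) • (e.1 x - e'.1 x) = 0 := by
    rw [smul_sub, ← map_smul, ← map_smul, ← hc, map_smul, map_smul, LinearEquiv.apply_symm_apply,
      hg, LinearEquiv.apply_symm_apply, sub_self]
  have h3 : e.1 x - e'.1 x ∈ LinearMap.ker π.1 := by
    rw [LinearMap.mem_ker, map_sub, sub_eq_zero]
    exact LinearMap.congr_fun (congrArg Subtype.val h) x
  rw [hq.ker_eq_generator] at h3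
  obtain ⟨s, hs⟩ := Submodule.mem_span_singleton.1 h3
  have h4 : (Nat.card G : ℤ_[p]) * s = 0 := by
    refine smul_generator_injective (q := q)
      (hq.map_ne_zero_of_ker_eq π.2.1 (hq.ker_eq_generator π)) ?_
    rw [mul_smul, hs, h2, zero_smul]
  rw [← sub_eq_zero, ← hs, (mul_eq_zero.1 h4).resolve_left (natCast_card_ne_zero G), zero_smul]

/-- An equivalence is an automorphism of `H` that matches the normalized generators, so the unit by
which it acts on `ℤ_p` is `1`. -/
theorem exists_pullback_eq {π π' : CyclicSurj p H G} (h : hq.extension π' ≈ hq.extension π) :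
    ∃ e, hq.pullback π e = π' := by
  obtain ⟨e, he1, he2⟩ := h
  change H ≃ₗ[ℤ_[p]] H at e
  change ∀ x : ℤ_[p], e (x • hq.generator π') = x • hq.generator π at he1
  obtain ⟨u, hu, hqe⟩ := hq.exists_isUnit_map_equiv e
  have h1 := he1 1
  rw [one_smul, one_smul] at h1
  obtain ⟨m, hm⟩ := hq.map_generator π
  obtain ⟨m', hm'⟩ := hq.map_generator π'
  have hu1 : u = 1 := unit_eq_one_of_mul_pow_eq hu (m := m') (n := m) (by
    rw [← hm, ← hm', ← hqe, h1])
  exact ⟨⟨e, fun x => by rw [hqe, hu1, one_mul]⟩, Subtype.ext (LinearMap.ext he2)⟩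

/-- Rescaling the isomorphism by a unit makes the image of `1 ∈ ℤ_p` the normalized generator and
leaves the kernel unchanged. -/
theorem exists_extension_equiv {E : Extension p G} (e : E.middle ≃ₗ[ℤ_[p]] H) :
    ∃ π : CyclicSurj p H G, hq.extension π ≈ E := by
  have hker : ∀ v : ℤ_[p]ˣ, LinearMap.ker (E.proj ∘ₗ e.symm.toLinearMap) =
      Submodule.span ℤ_[p] {(v : ℤ_[p]) • e (E.inl 1)} := by
    intro v
    rw [Submodule.span_singleton_smul_eq v.isUnit]
    ext x
    rw [LinearMap.mem_ker, LinearMap.comp_apply, Submodule.mem_span_singleton]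
    refine (E.exact _).trans (exists_congr fun c => ?_)
    rw [← map_smul, ← map_smul, smul_eq_mul, mul_one, LinearEquiv.coe_coe,
      LinearEquiv.eq_symm_apply]
  have hs : Surjective (E.proj ∘ₗ e.symm.toLinearMap) := E.proj_surjective.comp e.symm.surjective
  have h0 : q (e (E.inl 1)) ≠ 0 := hq.map_ne_zero_of_ker_eq hs (by simpa using hker 1)
  let u := PadicInt.unitCoeff h0
  have hu : q (e (E.inl 1)) = u * (p : ℤ_[p]) ^ (q (e (E.inl 1))).valuation :=
    PadicInt.unitCoeff_spec h0
  let e' : E.middle ≃ₗ[ℤ_[p]] H := e.trans (LinearEquiv.smulOfUnit u⁻¹)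
  have he' : ∀ y, e' y = (↑u⁻¹ : ℤ_[p]) • e y := fun _ => rfl
  have hes : ∀ x, e'.symm x = (u : ℤ_[p]) • e.symm x := fun x => by
    rw [LinearEquiv.symm_apply_eq, he', map_smul, LinearEquiv.apply_symm_apply, smul_smul,
      Units.inv_mul, one_smul]
  have hker' : LinearMap.ker (E.proj ∘ₗ e'.symm.toLinearMap) =
      Submodule.span ℤ_[p] {(↑u⁻¹ : ℤ_[p]) • e (E.inl 1)} := by
    rw [← hker]
    ext x
    rw [LinearMap.mem_ker, LinearMap.mem_ker, LinearMap.comp_apply, LinearMap.comp_apply,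
      LinearEquiv.coe_coe, LinearEquiv.coe_coe, hes, map_smul, u.isUnit.smul_eq_zero]
  let π : CyclicSurj p H G :=
    ⟨E.proj ∘ₗ e'.symm.toLinearMap, E.proj_surjective.comp e'.symm.surjective, _, hker'⟩
  have hg : hq.generator π = e' (E.inl 1) := by
    refine hq.generator_eq π hker' (m := (q (e (E.inl 1))).valuation) ?_
    rw [he', map_smul, smul_eq_mul, Units.inv_mul_eq_iff_eq_mul]
    exact hu
  refine ⟨π, e'.symm, fun x => ?_, fun y => rfl⟩
  change e'.symm (x • hq.generator π) = _
  rw [hg, map_smul, LinearEquiv.symm_apply_apply, ← map_smul, smul_eq_mul, mul_one]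

/-- `AutOver q` acts freely by pullback, and its orbits are the extension classes with middle term
`H`. -/
theorem card_cyclicSurj [Module.Finite ℤ_[p] H] :
    Nat.card (CyclicSurj p H G) = Nat.card {c : ExtZp p G // ∃ E : Extension p G,
      Quotient.mk (extensionSetoid p G) E = c ∧ Nonempty (E.middle ≃ₗ[ℤ_[p]] H)} *
        Nat.card (AutOver q) := by
  have := hq.finite_autOver
  refine card_eq_mul_of_card_fiber (fun π => ⟨Quotient.mk _ (hq.extension π), hq.extension π, rfl,
    ⟨LinearEquiv.refl _ _⟩⟩) Nat.card_pos.ne' ?_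
  rintro ⟨_, E, rfl, ⟨e⟩⟩
  obtain ⟨π, hπ⟩ := hq.exists_extension_equiv e
  have hcls : ∀ e, hq.extension (hq.pullback π e) ≈ E := fun e =>
    Setoid.trans (hq.extension_pullback π e) hπ
  refine (Nat.card_congr (Equiv.ofBijective
    (fun e => ⟨hq.pullback π e, Subtype.ext (Quotient.sound (hcls e))⟩) ⟨?_, ?_⟩)).symm
  · intro e e' h
    exact hq.pullback_injective π (congrArg Subtype.val h)
  · rintro ⟨π', hπ'⟩
    have h1 : hq.extension π' ≈ E := Quotient.exact (congrArg Subtype.val hπ')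
    obtain ⟨e, he⟩ := hq.exists_pullback_eq (Setoid.trans h1 (Setoid.symm hπ))
    exact ⟨e, Subtype.ext he⟩

end IsTorsionProj

end Count

end RankOne

theorem dStarProb_eq {p : ℕ} [Fact p.Prime] (G : XZero p) (H : XOne p)
    {q : H.Mod →ₗ[ℤ_[p]] ℤ_[p]} (hq : IsTorsionProj q) :
    dStarProb p G H = (Nat.card (CyclicSurj p H.Mod G.Grp) : ℝ) /
      (Nat.card (AutOver q) * Nat.card G.Grp) := by
  have := hq.finite_autOver
  have h : (Nat.card (AutOver q) : ℝ) ≠ 0 := Nat.cast_ne_zero.2 Nat.card_pos.ne'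
  rw [dStarProb, card_extZp, hq.card_cyclicSurj, Nat.cast_mul, mul_comm (Nat.card (AutOver q) : ℝ),
    mul_div_mul_right _ _ h]

open MeasureTheory

/-! ### Haar measure of finite-index submodules -/

section Haar

variable {p : ℕ} [Fact p.Prime]

/-- A measure for which submodules of finite index are measurable, with the inverse of the index
as measure. -/
def HasIndexMeasure (p : ℕ) [Fact p.Prime] {M : Type*} [AddCommGroup M] [Module ℤ_[p] M]
    [MeasurableSpace M] (μ : Measure M) : Prop :=
  ∀ N : Submodule ℤ_[p] M, Finite (M ⧸ N) →
    MeasurableSet (N : Set M) ∧ μ.real N = (Nat.card (M ⧸ N) : ℝ)⁻¹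

theorem continuousSMul_of_finite_discrete (A : Type*) [AddCommGroup A] [Module ℤ_[p] A] [Finite A]
    [TopologicalSpace A] [DiscreteTopology A] : ContinuousSMul ℤ_[p] A := by
  refine ⟨continuous_prod_of_discrete_right.2 fun a => continuous_def.2 fun s _ => ?_⟩
  have hI : IsOpen ((Ideal.span {(Nat.card A : ℤ_[p])} : Ideal ℤ_[p]) : Set ℤ_[p]) :=
    IsDedekindDomain.isOpen_of_ne_bot (by
      rw [Ne, Ideal.span_singleton_eq_bot]; exact natCast_card_ne_zero A)
  refine isOpen_iff_mem_nhds.2 fun r hr => ?_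
  have h1 : {x : ℤ_[p] | x - r ∈ Ideal.span {(Nat.card A : ℤ_[p])}} ∈ nhds r := by
    have hc : Continuous fun x : ℤ_[p] => x - r := by fun_prop
    exact (hI.preimage hc).mem_nhds (by simp)
  refine Filter.mem_of_superset h1 fun x hx => ?_
  obtain ⟨c, hc⟩ := Ideal.mem_span_singleton.1 hx
  have : x • a = r • a := by
    rw [← sub_eq_zero, ← sub_smul, hc, mul_smul, Nat.cast_smul_eq_nsmul, card_nsmul_eq_zero']
  change x • a ∈ s
  rw [this]
  exact hr

/-- Submodules of finite index are open and their cosets share the total mass equally. The topology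
plays no further role. -/
theorem exists_haar (M : Type*) [AddCommGroup M] [Module ℤ_[p] M] [Module.Finite ℤ_[p] M] :
    ∃ (_ : MeasurableSpace M) (μ : Measure M), IsProbabilityMeasure μ ∧
      (∀ s, haarProb p M s = μ.real s) ∧ HasIndexMeasure p μ := by
  let : TopologicalSpace M := moduleTopology ℤ_[p] M
  have : IsModuleTopology ℤ_[p] M := ⟨rfl⟩
  have : IsTopologicalAddGroup M := IsModuleTopology.topologicalAddGroup ℤ_[p] M
  have : CompactSpace M := compactSpace_moduleTopology p M
  let : MeasurableSpace M := borel M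
  have : BorelSpace M := ⟨rfl⟩
  have hμ : IsProbabilityMeasure
      (Measure.addHaarMeasure (⊤ : TopologicalSpace.PositiveCompacts M)) :=
    ⟨Measure.addHaarMeasure_self⟩
  refine ⟨inferInstance, Measure.addHaarMeasure (⊤ : TopologicalSpace.PositiveCompacts M),
    hμ, fun _ => rfl, fun N hN => ?_⟩
  let : TopologicalSpace (M ⧸ N) := ⊥
  have : DiscreteTopology (M ⧸ N) := ⟨rfl⟩
  have := continuousSMul_of_finite_discrete (p := p) (M ⧸ N)
  have hc : Continuous N.mkQ := IsModuleTopology.continuous_of_linearMap N.mkQ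
  have hopen : IsOpen (N : Set M) := by
    have : (N : Set M) = N.mkQ ⁻¹' {0} := by
      ext x
      simp
    rw [this]
    exact (isOpen_discrete _).preimage hc
  have hN' : Finite (M ⧸ N.toAddSubgroup) := hN
  have hfi : N.toAddSubgroup.FiniteIndex := AddSubgroup.finiteIndex_of_finite_quotient
  have h := N.toAddSubgroup.index_mul_measure hopen.measurableSet
    (Measure.addHaarMeasure (⊤ : TopologicalSpace.PositiveCompacts M))
  rw [measure_univ] at h
  have h2 := congrArg ENNReal.toReal h
  rw [ENNReal.toReal_mul, ENNReal.toReal_natCast, ENNReal.toReal_one] at h2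
  exact ⟨hopen.measurableSet, eq_inv_of_mul_eq_one_right h2⟩

end Haar

/-! ### The probability that `H` modulo a random element is `G` -/

section Generators

/-- Double counting: integrate the sum of the indicators, which is `n` on `t` and `0` elsewhere. -/
theorem sum_measureReal_eq {X ι : Type*} [MeasurableSpace X] {μ : Measure X} [Fintype ι]
    [IsFiniteMeasure μ] {s : ι → Set X} {t : Set X}
    (hs : ∀ i, MeasurableSet (s i)) (ht : MeasurableSet t) (hst : ∀ i, s i ⊆ t) {n : ℕ}
    (h : ∀ x ∈ t, Nat.card {i // x ∈ s i} = n) : ∑ i, μ.real (s i) = n * μ.real t := by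
  classical
  have h1 : ∀ x, ∑ i, (s i).indicator (fun _ => (1 : ℝ)) x = n * t.indicator (fun _ => (1 : ℝ)) x := by
    intro x
    by_cases hx : x ∈ t
    · rw [Set.indicator_of_mem hx, mul_one, ← h x hx, Nat.card_eq_fintype_card, Fintype.card_subtype,
        Finset.card_eq_sum_ones, Nat.cast_sum, Finset.sum_filter]
      simp [Set.indicator_apply]
    · rw [Set.indicator_of_notMem hx, mul_zero]
      exact Finset.sum_eq_zero fun i _ => Set.indicator_of_notMem (fun hi => hx (hst i hi)) _
  have h2 : ∀ i, μ.real (s i) = ∫ x, (s i).indicator (fun _ => (1 : ℝ)) x ∂μ := fun i =>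
    (integral_indicator_one (hs i)).symm
  have h3 : μ.real t = ∫ x, t.indicator (fun _ => (1 : ℝ)) x ∂μ := (integral_indicator_one ht).symm
  simp_rw [h2]
  rw [h3, ← integral_finsetSum _ fun i _ => (integrable_const (1 : ℝ)).indicator (hs i),
    ← integral_const_mul]
  simp_rw [h1]

variable {p : ℕ} [Fact p.Prime] {H : Type} [AddCommGroup H] [Module ℤ_[p] H]
  {q : H →ₗ[ℤ_[p]] ℤ_[p]} {G : Type} [AddCommGroup G] [Module ℤ_[p] G]

/-- The set of elements with quotient isomorphic to `G`. -/
def quotientSet (p : ℕ) [Fact p.Prime] (H G : Type) [AddCommGroup H] [Module ℤ_[p] H]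
    [AddCommGroup G] [Module ℤ_[p] G] : Set H :=
  {h | Nonempty ((H ⧸ Submodule.span ℤ_[p] {h}) ≃ₗ[ℤ_[p]] G)}

/-- The set of generators of the kernel. -/
def generatorSet (π : CyclicSurj p H G) : Set H :=
  {h | LinearMap.ker π.1 = Submodule.span ℤ_[p] {h}}

theorem quotientSet_eq_iUnion :
    quotientSet p H G = ⋃ π : CyclicSurj p H G, generatorSet π := by
  ext h
  rw [Set.mem_iUnion]
  constructor
  · rintro ⟨e⟩
    refine ⟨⟨e.toLinearMap ∘ₗ Submodule.mkQ _, e.surjective.comp (Submodule.mkQ_surjective _),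
      h, ?_⟩, ?_⟩ <;>
    · change LinearMap.ker (e.toLinearMap ∘ₗ Submodule.mkQ _) = _
      rw [LinearEquiv.ker_comp, Submodule.ker_mkQ]
  · rintro ⟨π, hπ⟩
    exact ⟨(Submodule.quotEquivOfEq _ _ hπ.symm).trans (π.1.quotKerEquivOfSurjective π.2.1)⟩

/-- Two surjections to `G` with the same kernel differ by a unique automorphism of `G`. -/
theorem card_cyclicSurj_generator {h : H} (hh : h ∈ quotientSet p H G) :
    Nat.card {π : CyclicSurj p H G // h ∈ generatorSet π} = numAut p G := by
  obtain ⟨e⟩ := hh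
  have hker : ∀ α : G ≃ₗ[ℤ_[p]] G,
      LinearMap.ker (α.toLinearMap ∘ₗ e.toLinearMap ∘ₗ Submodule.mkQ _) =
        Submodule.span ℤ_[p] {h} := fun α => by
    rw [LinearEquiv.ker_comp, LinearEquiv.ker_comp, Submodule.ker_mkQ]
  refine (Nat.card_congr (Equiv.ofBijective (fun α : G ≃ₗ[ℤ_[p]] G =>
    (⟨⟨α.toLinearMap ∘ₗ e.toLinearMap ∘ₗ Submodule.mkQ _,
      α.surjective.comp (e.surjective.comp (Submodule.mkQ_surjective _)), h, hker α⟩, hker α⟩ :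
        {π : CyclicSurj p H G // h ∈ generatorSet π})) ⟨?_, ?_⟩)).symm
  · intro α β hαβ
    ext g
    obtain ⟨x, rfl⟩ := (e.surjective.comp (Submodule.mkQ_surjective _)) g
    exact LinearMap.congr_fun (congrArg (fun t => t.1.1) hαβ) x
  · rintro ⟨π, hπ⟩
    have hπ' : LinearMap.ker π.1 = Submodule.span ℤ_[p] {h} := hπ
    refine ⟨e.symm.trans ((Submodule.quotEquivOfEq _ _ hπ'.symm).trans
      (π.1.quotKerEquivOfSurjective π.2.1)), Subtype.ext (Subtype.ext ?_)⟩
    ext x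
    simp

variable [Finite G]

theorem index_span_p_smul {g : H}
    (hg : q g ≠ 0) : Nat.card (H ⧸ Submodule.span ℤ_[p] {(p : ℤ_[p]) • g}) =
      p * Nat.card (H ⧸ Submodule.span ℤ_[p] {g}) := by
  have hle : Submodule.span ℤ_[p] {(p : ℤ_[p]) • g} ≤ Submodule.span ℤ_[p] {g} := by
    rw [Submodule.span_singleton_le_iff_mem]
    exact Submodule.smul_mem _ _ (Submodule.mem_span_singleton_self g)
  rw [card_eq_card_ker_mul_card_of_surjective (Submodule.factor hle) (Submodule.factor_surjective hle)]
  congr 1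
  let φ : ℤ_[p] →ₗ[ℤ_[p]] H ⧸ Submodule.span ℤ_[p] {(p : ℤ_[p]) • g} :=
    Submodule.mkQ _ ∘ₗ LinearMap.toSpanSingleton ℤ_[p] H g
  have h1 : LinearMap.ker φ = Ideal.span {(p : ℤ_[p]) ^ 1} := by
    ext r
    rw [LinearMap.mem_ker, LinearMap.comp_apply, Submodule.mkQ_apply, Submodule.Quotient.mk_eq_zero,
      Submodule.mem_span_singleton, Ideal.mem_span_singleton', LinearMap.toSpanSingleton_apply, pow_one]
    refine exists_congr fun c => ⟨fun h => ?_, fun h => ?_⟩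
    · rw [smul_smul] at h
      exact IsTorsionProj.smul_generator_injective hg h
    · rw [← h, mul_smul]
  have h2 : LinearMap.range φ = LinearMap.ker (Submodule.factor hle) := by
    ext y
    obtain ⟨x, rfl⟩ := Submodule.Quotient.mk_surjective _ y
    rw [LinearMap.mem_ker]
    constructor
    · rintro ⟨r, hr⟩
      rw [← hr]
      change (Submodule.Quotient.mk (r • g) : H ⧸ Submodule.span ℤ_[p] {g}) = 0
      rw [Submodule.Quotient.mk_eq_zero]
      exact Submodule.smul_mem _ _ (Submodule.mem_span_singleton_self g)
    · intro h
      change (Submodule.Quotient.mk x : H ⧸ Submodule.span ℤ_[p] {g}) = 0 at h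
      rw [Submodule.Quotient.mk_eq_zero] at h
      obtain ⟨r, rfl⟩ := Submodule.mem_span_singleton.1 h
      exact ⟨r, rfl⟩
  rw [← h2, ← Nat.card_congr φ.quotKerEquivRange.toEquiv, h1, card_quotient_span_p_pow, pow_one]

theorem generatorSet_eq_diff (hq : IsTorsionProj q) (π : CyclicSurj p H G) {g : H}
    (hg : LinearMap.ker π.1 = Submodule.span ℤ_[p] {g}) :
    generatorSet π = (Submodule.span ℤ_[p] {g} : Set H) \
      (Submodule.span ℤ_[p] {(p : ℤ_[p]) • g} : Set H) := by
  have hg0 := hq.map_ne_zero_of_ker_eq π.2.1 hg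
  ext h
  rw [generatorSet, Set.mem_ofPred_eq, hg, Set.mem_sdiff, SetLike.mem_coe, SetLike.mem_coe]
  constructor
  · intro hs
    refine ⟨hs ▸ Submodule.mem_span_singleton_self h, fun hp => ?_⟩
    have h1 : g ∈ Submodule.span ℤ_[p] {(p : ℤ_[p]) • g} := by
      have h2 : g ∈ Submodule.span ℤ_[p] {h} := hs ▸ Submodule.mem_span_singleton_self g
      exact (Submodule.span_singleton_le_iff_mem _ _).2 hp h2
    obtain ⟨c, hc⟩ := Submodule.mem_span_singleton.1 h1
    rw [smul_smul] at hc
    have := IsTorsionProj.smul_generator_injective hg0 (hc.trans (one_smul ℤ_[p] g).symm)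
    exact PadicInt.prime_p.not_isUnit (IsUnit.of_mul_eq_one c (by rw [mul_comm, this]))
  · rintro ⟨h1, h2⟩
    obtain ⟨r, rfl⟩ := Submodule.mem_span_singleton.1 h1
    have hr : IsUnit r := by
      by_contra hr
      rw [← mem_nonunits_iff, ← IsLocalRing.mem_maximalIdeal, PadicInt.maximalIdeal_eq_span_p,
        Ideal.mem_span_singleton'] at hr
      obtain ⟨c, rfl⟩ := hr
      exact h2 (Submodule.mem_span_singleton.2 ⟨c, by rw [smul_smul]⟩)
    exact (Submodule.span_singleton_smul_eq hr g).symm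

variable [MeasurableSpace H] {μ : Measure H}

/-- The kernel lies in submodules of index `p ^ n` for all `n`. Outside it the quotient by an
element is finite, so `d(H)` lies in `X₀` almost surely. -/
theorem measure_ker_torsionProj [IsFiniteMeasure μ] (hμ : HasIndexMeasure p μ)
    (hq : IsTorsionProj q) : μ (LinearMap.ker q : Set H) = 0 := by
  have h1 : ∀ n : ℕ, μ.real (LinearMap.ker q : Set H) ≤ ((p : ℝ)⁻¹) ^ n := by
    intro n
    let f : H →ₗ[ℤ_[p]] ℤ_[p] ⧸ Ideal.span {(p : ℤ_[p]) ^ n} := Submodule.mkQ _ ∘ₗ q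
    have hf : Surjective f := (Submodule.mkQ_surjective _).comp hq.surjective
    have e := f.quotKerEquivOfSurjective hf
    have hfin := finite_quotient_span_singleton (p_pow_padicInt_ne_zero (p := p) n)
    have h2 := (hμ (LinearMap.ker f) (Finite.of_equiv _ e.symm.toEquiv)).2
    rw [Nat.card_congr e.toEquiv, card_quotient_span_p_pow, Nat.cast_pow, ← inv_pow] at h2
    rw [← h2]
    exact measureReal_mono (LinearMap.ker_le_ker_comp q (Submodule.mkQ _))
  have hp : (1 : ℝ) < p := by exact_mod_cast (Fact.out : p.Prime).one_lt
  have h2 := ge_of_tendsto' (tendsto_pow_atTop_nhds_zero_of_lt_one (by positivity)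
    (inv_lt_one_of_one_lt₀ hp)) h1
  exact (measureReal_eq_zero_iff).1 (le_antisymm h2 measureReal_nonneg)

variable [Module.Finite ℤ_[p] H]

theorem measure_generatorSet [IsFiniteMeasure μ] (hμ : HasIndexMeasure p μ) (hq : IsTorsionProj q)
    (π : CyclicSurj p H G) : MeasurableSet (generatorSet π) ∧
      μ.real (generatorSet π) = (1 - 1 / (p : ℝ)) / Nat.card G := by
  obtain ⟨g, hg⟩ := π.2.2
  have hg0 := hq.map_ne_zero_of_ker_eq π.2.1 hg
  have hp0 : (p : ℤ_[p]) ≠ 0 := PadicInt.prime_p.ne_zero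
  have hpg : q ((p : ℤ_[p]) • g) ≠ 0 := by
    rw [map_smul, smul_eq_mul]; exact mul_ne_zero hp0 hg0
  obtain ⟨m1, h1⟩ := hμ _ (hq.finite_quotient hg0)
  obtain ⟨m2, h2⟩ := hμ _ (hq.finite_quotient hpg)
  have hcard : Nat.card (H ⧸ Submodule.span ℤ_[p] {g}) = Nat.card G := by
    rw [← hg]
    exact Nat.card_congr (π.1.quotKerEquivOfSurjective π.2.1).toEquiv
  have hle : (Submodule.span ℤ_[p] {(p : ℤ_[p]) • g} : Set H) ⊆ Submodule.span ℤ_[p] {g} :=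
    (Submodule.span_singleton_le_iff_mem _ _).2
      (Submodule.smul_mem _ _ (Submodule.mem_span_singleton_self g))
  rw [generatorSet_eq_diff hq π hg]
  refine ⟨m1.diff m2, ?_⟩
  rw [measureReal_sdiff hle m2, h1, h2, index_span_p_smul hg0, hcard]
  have : (p : ℝ) ≠ 0 := by exact_mod_cast (Fact.out : p.Prime).ne_zero
  have : (Nat.card G : ℝ) ≠ 0 := by exact_mod_cast Nat.card_pos.ne'
  push_cast
  field_simp

theorem measurableSet_quotientSet [IsFiniteMeasure μ] (hμ : HasIndexMeasure p μ)
    (hq : IsTorsionProj q) : MeasurableSet (quotientSet p H G) := by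
  rw [quotientSet_eq_iUnion]
  exact MeasurableSet.iUnion fun π => (measure_generatorSet hμ hq π).1

theorem measure_quotientSet [IsFiniteMeasure μ] (hμ : HasIndexMeasure p μ) (hq : IsTorsionProj q) :
    μ.real (quotientSet p H G) = (1 - 1 / (p : ℝ)) * Nat.card (CyclicSurj p H G) /
      (Nat.card G * numAut p G) := by
  have := Fintype.ofFinite (CyclicSurj p H G)
  have h := sum_measureReal_eq (μ := μ) (s := fun π : CyclicSurj p H G => generatorSet π)
    (fun π => (measure_generatorSet hμ hq π).1) (measurableSet_quotientSet hμ hq)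
    (fun π => quotientSet_eq_iUnion (p := p) (H := H) (G := G) ▸ Set.subset_iUnion _ π)
    (fun x hx => card_cyclicSurj_generator hx)
  simp_rw [fun π => (measure_generatorSet hμ hq π).2] at h
  rw [Finset.sum_const, Finset.card_univ, ← Nat.card_eq_fintype_card, nsmul_eq_mul] at h
  have h1 : (numAut p G : ℝ) ≠ 0 := by exact_mod_cast numAut_pos.ne'
  have h2 : (Nat.card G : ℝ) ≠ 0 := by exact_mod_cast Nat.card_pos.ne'
  rw [eq_div_iff (mul_ne_zero h2 h1)]
  rw [mul_div_assoc', div_eq_iff h2] at h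
  linarith

end Generators

/-! ### The expected number of surjections from `d(H)` -/

section Sum

variable {p : ℕ} [Fact p.Prime]

theorem dProb_eq (H : XOne p) (G : XZero p) :
    dProb p H G = (1 - 1 / (p : ℝ)) * Nat.card (CyclicSurj p H.Mod G.Grp) /
      (Nat.card G.Grp * numAut p G.Grp) := by
  obtain ⟨q, hq⟩ := exists_isTorsionProj (p := p) H.Mod (Quotient.out H).finrank_eq
  obtain ⟨m, μ, h1, h2, h3⟩ := exists_haar (p := p) H.Mod
  rw [dProb, h2]
  exact measure_quotientSet h3 hq

theorem mk_eq_iff {M : Type} [AddCommGroup M] [Module ℤ_[p] M] [Finite M] {G : XZero p} :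
    XZero.mk p M = G ↔ Nonempty (M ≃ₗ[ℤ_[p]] G.Grp) := by
  conv_lhs => rw [← Quotient.out_eq G]
  exact Quotient.eq

/-- The average number of surjections to `F` from a random quotient of `H`. -/
theorem hasSum_numSurj_mul_dProb [Countable (XZero p)] (H : XOne p) (F : Type) [AddCommGroup F]
    [Module ℤ_[p] F] [Finite F] :
    HasSum (fun G : XZero p => (numSurj p G.Grp F : ℝ) * dProb p H G)
      (numSurj p H.Mod F / Nat.card F) := by
  obtain ⟨q, hq⟩ := exists_isTorsionProj (p := p) H.Mod (Quotient.out H).finrank_eq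
  obtain ⟨m, μ, hμp, h2, hμ⟩ := exists_haar (p := p) H.Mod
  have := Fintype.ofFinite {f : H.Mod →ₗ[ℤ_[p]] F // Surjective f}
  have hker : ∀ f : {f : H.Mod →ₗ[ℤ_[p]] F // Surjective f},
      MeasurableSet (LinearMap.ker f.1 : Set H.Mod) ∧
        μ.real (LinearMap.ker f.1 : Set H.Mod) = (Nat.card F : ℝ)⁻¹ := fun f => by
    have e := f.1.quotKerEquivOfSurjective f.2
    have h := hμ (LinearMap.ker f.1) (Finite.of_equiv _ e.symm.toEquiv)
    rwa [Nat.card_congr e.toEquiv] at h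
  have hX : ∀ G : XZero p, MeasurableSet (quotientSet p H.Mod G.Grp) := fun G =>
    measurableSet_quotientSet hμ hq
  have hdisj : Pairwise (Disjoint on fun G : XZero p => quotientSet p H.Mod G.Grp) := by
    intro G G' hne
    refine Set.disjoint_left.2 ?_
    rintro h ⟨e⟩ ⟨e'⟩
    exact hne (Quotient.out_equiv_out.1 ⟨e.symm.trans e'⟩)
  have hcover : (⋃ G : XZero p, quotientSet p H.Mod G.Grp)ᶜ ⊆ (LinearMap.ker q : Set H.Mod) := by
    intro h hh
    by_contra h0
    have := hq.finite_quotient h0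
    refine hh (Set.mem_iUnion.2 ⟨XZero.mk p (H.Mod ⧸ Submodule.span ℤ_[p] {h}), mk_eq_iff.1 rfl⟩)
  have hnull : μ (⋃ G : XZero p, quotientSet p H.Mod G.Grp)ᶜ = 0 :=
    measure_mono_null hcover (measure_ker_torsionProj hμ hq)
  -- An `h` with `H/h ≅ G` is killed by exactly those surjections to `F` that factor through `H/h`,
  -- and there are `#Sur(G, F)` of them.
  have key1 : ∀ G : XZero p,
      ∑ f : {f : H.Mod →ₗ[ℤ_[p]] F // Surjective f},
        μ.real ((LinearMap.ker f.1 : Set H.Mod) ∩ quotientSet p H.Mod G.Grp) =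
      numSurj p G.Grp F * dProb p H G := by
    intro G
    rw [sum_measureReal_eq (fun f => (hker f).1.inter (hX G)) (hX G)
      (fun f => Set.inter_subset_right) (n := numSurj p G.Grp F), dProb, h2]
    · rfl
    · rintro h ⟨e⟩
      rw [← numSurj_congr_left e]
      refine Nat.card_congr ⟨fun f => ⟨Submodule.liftQ _ f.1.1 ?_, ?_⟩,
        fun f => ⟨⟨f.1 ∘ₗ Submodule.mkQ _, f.2.comp (Submodule.mkQ_surjective _)⟩, ?_, ⟨e⟩⟩, ?_, ?_⟩
      · rw [Submodule.span_singleton_le_iff_mem]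
        exact f.2.1
      · intro y
        obtain ⟨x, rfl⟩ := f.1.2 y
        exact ⟨Submodule.Quotient.mk x, rfl⟩
      · change f.1 (Submodule.Quotient.mk h) = 0
        rw [(Submodule.Quotient.mk_eq_zero _).2 (Submodule.mem_span_singleton_self h), map_zero]
      · intro f
        rfl
      · intro f
        refine Subtype.ext ?_
        ext x
        rfl
  -- The sets of `h` with prescribed quotient partition `H` up to a null set, so their pieces of
  -- `ker f` add up to its measure.
  have key2 : ∀ f : {f : H.Mod →ₗ[ℤ_[p]] F // Surjective f},
      HasSum (fun G : XZero p =>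
        μ.real ((LinearMap.ker f.1 : Set H.Mod) ∩ quotientSet p H.Mod G.Grp))
        (Nat.card F : ℝ)⁻¹ := by
    intro f
    have hu : μ (⋃ G : XZero p, (LinearMap.ker f.1 : Set H.Mod) ∩ quotientSet p H.Mod G.Grp) =
        ∑' G : XZero p, μ ((LinearMap.ker f.1 : Set H.Mod) ∩ quotientSet p H.Mod G.Grp) :=
      measure_iUnion (fun G G' hne => (hdisj hne).mono Set.inter_subset_right Set.inter_subset_right)
        fun G => (hker f).1.inter (hX G)
    rw [← Set.inter_iUnion, measure_inter_conull hnull] at hu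
    have hne : ∑' G : XZero p, μ ((LinearMap.ker f.1 : Set H.Mod) ∩ quotientSet p H.Mod G.Grp) ≠ ⊤ := by
      rw [← hu]
      exact measure_ne_top _ _
    have h3 := ENNReal.hasSum_toReal hne
    rw [← ENNReal.tsum_toReal_eq fun G => measure_ne_top _ _, ← hu] at h3
    rw [← (hker f).2]
    exact h3
  have h3 := hasSum_sum (s := Finset.univ) fun f _ => key2 f
  simp_rw [key1] at h3
  convert h3 using 1
  rw [Finset.sum_const, Finset.card_univ, ← Nat.card_eq_fintype_card, nsmul_eq_mul, div_eq_mul_inv]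
  rfl

end Sum

open scoped ENNReal

/-! ### A uniform bound for the submodule zeta function -/

section Zeta

variable {p : ℕ} [Fact p.Prime]

/-- Submodules of finite index. -/
abbrev FiniteIndexSubmodule (p : ℕ) [Fact p.Prime] (L : Type*) [AddCommGroup L] [Module ℤ_[p] L] :
    Type _ :=
  {N : Submodule ℤ_[p] L // Finite (L ⧸ N)}

instance finite_quotient_finiteIndexSubmodule {L : Type*} [AddCommGroup L] [Module ℤ_[p] L]
    (N : FiniteIndexSubmodule p L) : Finite (L ⧸ N.1) := N.2

/-- The submodule zeta function. -/
noncomputable def submoduleZeta (p : ℕ) [Fact p.Prime] (L : Type*) [AddCommGroup L]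
    [Module ℤ_[p] L] (s : ℕ) : ℝ≥0∞ :=
  ∑' N : FiniteIndexSubmodule p L, ((Nat.card (L ⧸ N.1) : ℝ≥0∞) ^ s)⁻¹

theorem submoduleZeta_le_of_equiv {L L' : Type*} [AddCommGroup L] [Module ℤ_[p] L]
    [AddCommGroup L'] [Module ℤ_[p] L'] (e : L ≃ₗ[ℤ_[p]] L') (s : ℕ) :
    submoduleZeta p L s ≤ submoduleZeta p L' s := by
  have he : ∀ N : Submodule ℤ_[p] L, (L ⧸ N) ≃ₗ[ℤ_[p]] (L' ⧸ N.map e.toLinearMap) := fun N =>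
    Submodule.Quotient.equiv N _ e rfl
  let Φ : FiniteIndexSubmodule p L → FiniteIndexSubmodule p L' := fun N =>
    ⟨N.1.map e.toLinearMap, Finite.of_equiv _ (he N.1).toEquiv⟩
  have hΦ : Injective Φ := fun N N' h =>
    Subtype.ext (Submodule.map_injective_of_injective e.injective (congrArg Subtype.val h))
  refine le_trans (le_of_eq ?_) (ENNReal.tsum_comp_le_tsum_of_injective hΦ _)
  refine tsum_congr fun N => ?_
  rw [Nat.card_congr (he N.1).toEquiv]

section Prod

variable {L : Type*} [AddCommGroup L] [Module ℤ_[p] L]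

theorem ideal_ne_bot_of_finite_quotient (I : Ideal ℤ_[p]) [Finite (ℤ_[p] ⧸ I)] : I ≠ ⊥ := by
  intro h
  have h1 : (Nat.card (ℤ_[p] ⧸ I) : ℤ_[p]) ∈ I := by
    rw [← Ideal.Quotient.eq_zero_iff_mem, map_natCast, ← nsmul_one, card_nsmul_eq_zero']
  exact natCast_card_ne_zero (p := p) (ℤ_[p] ⧸ I) (Ideal.mem_bot.1 (h.le h1))

/-- The quotient is an extension of `ℤ_p / p ^ k`, where `p ^ k` generates the first projection of
`N`, by `L / (N ∩ L)`. -/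
theorem card_quotient_prod (N : Submodule ℤ_[p] (ℤ_[p] × L)) [Finite ((ℤ_[p] × L) ⧸ N)] :
    Finite (L ⧸ N.comap (LinearMap.inr ℤ_[p] ℤ_[p] L)) ∧
    ∃ k : ℕ, N.map (LinearMap.fst ℤ_[p] ℤ_[p] L) = Ideal.span {(p : ℤ_[p]) ^ k} ∧
      Nat.card ((ℤ_[p] × L) ⧸ N) =
        Nat.card (L ⧸ N.comap (LinearMap.inr ℤ_[p] ℤ_[p] L)) * p ^ k := by
  let I : Ideal ℤ_[p] := N.map (LinearMap.fst ℤ_[p] ℤ_[p] L)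
  let f : ((ℤ_[p] × L) ⧸ N) →ₗ[ℤ_[p]] ℤ_[p] ⧸ I :=
    N.mapQ I (LinearMap.fst _ _ _) (Submodule.map_le_iff_le_comap.1 le_rfl)
  have hf : Surjective f := fun y => by
    obtain ⟨x, rfl⟩ := Submodule.Quotient.mk_surjective _ y
    exact ⟨Submodule.Quotient.mk (x, 0), rfl⟩
  let g : L →ₗ[ℤ_[p]] (ℤ_[p] × L) ⧸ N := N.mkQ ∘ₗ LinearMap.inr _ _ _
  have hg : LinearMap.ker g = N.comap (LinearMap.inr ℤ_[p] ℤ_[p] L) := by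
    rw [LinearMap.ker_comp, Submodule.ker_mkQ]
  have hrange : LinearMap.range g = LinearMap.ker f := by
    ext y
    obtain ⟨⟨r, y⟩, rfl⟩ := Submodule.Quotient.mk_surjective _ y
    rw [LinearMap.mem_ker]
    constructor
    · rintro ⟨z, hz⟩
      rw [← hz]
      exact map_zero (Submodule.mkQ I)
    · intro h
      change (Submodule.Quotient.mk r : ℤ_[p] ⧸ I) = 0 at h
      rw [Submodule.Quotient.mk_eq_zero] at h
      obtain ⟨⟨r', z⟩, hz, hr⟩ := h
      change r' = r at hr
      subst hr
      refine ⟨y - z, ?_⟩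
      change (Submodule.Quotient.mk (0, y - z) : (ℤ_[p] × L) ⧸ N) = Submodule.Quotient.mk (r', y)
      rw [eq_comm, Submodule.Quotient.eq]
      simpa using hz
  have e := g.quotKerEquivRange
  rw [hg, hrange] at e
  have hI : Finite (ℤ_[p] ⧸ I) := Finite.of_surjective f hf
  obtain ⟨k, hk⟩ := exists_ideal_eq_span_pow (ideal_ne_bot_of_finite_quotient I)
  have hcard : Nat.card (ℤ_[p] ⧸ I) = p ^ k := by rw [hk, card_quotient_span_p_pow]
  refine ⟨Finite.of_equiv _ e.symm.toEquiv, k, hk, ?_⟩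
  rw [card_eq_card_ker_mul_card_of_surjective f hf, Nat.card_congr e.toEquiv, hcard]

theorem sigma_quotient_eq {N N' : FiniteIndexSubmodule p L} {k k' : ℕ} {v v' : L}
    (h : (⟨N, k, Submodule.Quotient.mk v⟩ : Σ N : FiniteIndexSubmodule p L, ℕ × (L ⧸ N.1)) =
      ⟨N', k', Submodule.Quotient.mk v'⟩) : N = N' ∧ k = k' ∧ v - v' ∈ N'.1 := by
  rw [Sigma.mk.inj_iff] at h
  obtain ⟨rfl, h⟩ := h
  rw [heq_eq_eq, Prod.mk.injEq] at h
  exact ⟨rfl, h.1, (Submodule.Quotient.eq _).1 h.2⟩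

/-- A submodule `N` is determined by `N ∩ L`, by `k`, and by the class modulo `N ∩ L` of any `v`
with `(p ^ k, v) ∈ N`. -/
theorem le_of_same_invariants {N N' : Submodule ℤ_[p] (ℤ_[p] × L)} {k : ℕ} {v v' : L}
    (hN : N.comap (LinearMap.inr ℤ_[p] ℤ_[p] L) = N'.comap (LinearMap.inr ℤ_[p] ℤ_[p] L))
    (hk : N.map (LinearMap.fst ℤ_[p] ℤ_[p] L) = Ideal.span {(p : ℤ_[p]) ^ k})
    (hv : ((p : ℤ_[p]) ^ k, v) ∈ N) (hv' : ((p : ℤ_[p]) ^ k, v') ∈ N')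
    (hvv : v - v' ∈ N'.comap (LinearMap.inr ℤ_[p] ℤ_[p] L)) : N ≤ N' := by
  rintro ⟨r, y⟩ hy
  have hr : r ∈ N.map (LinearMap.fst ℤ_[p] ℤ_[p] L) := ⟨(r, y), hy, rfl⟩
  rw [hk] at hr
  obtain ⟨c, rfl⟩ := Ideal.mem_span_singleton'.1 hr
  have h5 : y - c • v ∈ N.comap (LinearMap.inr ℤ_[p] ℤ_[p] L) := by
    have := N.sub_mem hy (N.smul_mem c hv)
    simpa using this
  rw [hN] at h5
  have h6 := N'.add_mem (N'.add_mem h5 (N'.smul_mem c hvv)) (N'.smul_mem c hv')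
  convert h6 using 1
  ext
  · simp
  · simp [smul_sub]

/-- Encode `N` by `(N ∩ L, k, v)`. The `#(L / (N ∩ L))` choices of `v` lower the exponent from `s +
1` to `s`, and the sum over `k` is geometric. -/
theorem submoduleZeta_prod_le (s : ℕ) : submoduleZeta p (ℤ_[p] × L) (s + 1) ≤
    (1 - ((p : ℝ≥0∞) ^ (s + 1))⁻¹)⁻¹ * submoduleZeta p L s := by
  have key : ∀ N : FiniteIndexSubmodule p (ℤ_[p] × L),
      Finite (L ⧸ N.1.comap (LinearMap.inr ℤ_[p] ℤ_[p] L)) ∧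
      ∃ (k : ℕ) (v : L), N.1.map (LinearMap.fst ℤ_[p] ℤ_[p] L) = Ideal.span {(p : ℤ_[p]) ^ k} ∧
      Nat.card ((ℤ_[p] × L) ⧸ N.1) =
        Nat.card (L ⧸ N.1.comap (LinearMap.inr ℤ_[p] ℤ_[p] L)) * p ^ k ∧
      ((p : ℤ_[p]) ^ k, v) ∈ N.1 := by
    intro N
    obtain ⟨h1, k, h2, h3⟩ := card_quotient_prod N.1
    refine ⟨h1, k, ?_⟩
    have h4 : (p : ℤ_[p]) ^ k ∈ N.1.map (LinearMap.fst ℤ_[p] ℤ_[p] L) :=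
      h2 ▸ Ideal.mem_span_singleton_self _
    obtain ⟨⟨r, v⟩, hv, hr⟩ := h4
    change r = _ at hr
    exact ⟨v, h2, h3, hr ▸ hv⟩
  choose hfin k v hmap hcard hv using key
  let Φ : FiniteIndexSubmodule p (ℤ_[p] × L) →
      Σ N : FiniteIndexSubmodule p L, ℕ × (L ⧸ N.1) := fun N =>
    ⟨⟨N.1.comap (LinearMap.inr ℤ_[p] ℤ_[p] L), hfin N⟩, k N, Submodule.Quotient.mk (v N)⟩
  have hΦ : Injective Φ := by
    intro N N' h
    obtain ⟨h1, h2, h3⟩ := sigma_quotient_eq h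
    obtain ⟨-, -, h3'⟩ := sigma_quotient_eq h.symm
    have h1' := congrArg Subtype.val h1
    have hv2 := hv N'
    rw [← h2] at hv2
    have hm := hmap N'
    rw [← h2] at hm
    exact Subtype.ext (le_antisymm (le_of_same_invariants h1' (hmap N) (hv N) hv2 h3)
      (le_of_same_invariants h1'.symm hm hv2 (hv N) h3'))
  let w : (Σ N : FiniteIndexSubmodule p L, ℕ × (L ⧸ N.1)) → ℝ≥0∞ := fun t =>
    (((Nat.card (L ⧸ t.1.1) * p ^ t.2.1 : ℕ) : ℝ≥0∞) ^ (s + 1))⁻¹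
  have h1 : submoduleZeta p (ℤ_[p] × L) (s + 1) ≤ ∑' t, w t := by
    refine le_trans (le_of_eq ?_) (ENNReal.tsum_comp_le_tsum_of_injective hΦ _)
    refine tsum_congr fun N => ?_
    rw [hcard]
  refine h1.trans (le_of_eq ?_)
  rw [ENNReal.tsum_sigma', submoduleZeta, ← ENNReal.tsum_mul_left]
  refine tsum_congr fun N => ?_
  rw [ENNReal.tsum_prod (f := fun k v => w ⟨N, k, v⟩), ← ENNReal.tsum_geometric,
    ← ENNReal.tsum_mul_right]
  refine tsum_congr fun k => ?_
  have := Fintype.ofFinite (L ⧸ N.1)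
  have hc0 : (Nat.card (L ⧸ N.1) : ℝ≥0∞) ≠ 0 := Nat.cast_ne_zero.2 Nat.card_pos.ne'
  have hct : (Nat.card (L ⧸ N.1) : ℝ≥0∞) ≠ ⊤ := ENNReal.natCast_ne_top _
  simp only [w]
  rw [tsum_fintype, Finset.sum_const, Finset.card_univ, ← Nat.card_eq_fintype_card, nsmul_eq_mul]
  push_cast
  rw [mul_pow, pow_succ (Nat.card (L ⧸ N.1) : ℝ≥0∞), ENNReal.mul_inv (Or.inr (by finiteness))
    (Or.inr (by simp [(Fact.out : p.Prime).ne_zero])), ENNReal.mul_inv (Or.inr hct) (Or.inr hc0),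
    ← ENNReal.inv_pow, ← pow_mul, ← pow_mul, mul_comm k]
  calc _ = (Nat.card (L ⧸ N.1) * (Nat.card (L ⧸ N.1) : ℝ≥0∞)⁻¹) *
        ((((Nat.card (L ⧸ N.1) : ℝ≥0∞) ^ s)⁻¹) * ((p : ℝ≥0∞) ^ ((s + 1) * k))⁻¹) := by ring
    _ = _ := by rw [ENNReal.mul_inv_cancel hc0 hct, one_mul, mul_comm]

end Prod

/-- With `y = 2^{-(j+1)} ≤ 1/2` one has `1/(1 - y) ≤ 1 + 2y ≤ exp (2y)`. The exponents `2y = 2^{-j}`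
have sum at most `2` over all `j`, whence the constant `exp 2`. -/
theorem inv_one_sub_le (j : ℕ) : (1 - ((p : ℝ≥0∞) ^ (j + 1))⁻¹)⁻¹ ≤
    ENNReal.ofReal (Real.exp ((1 / 2) ^ j)) := by
  have hp2 : (2 : ℝ) ≤ p := by exact_mod_cast (Fact.out : p.Prime).two_le
  set y : ℝ := (1 / 2) ^ (j + 1) with hy
  have hy0 : 0 ≤ y := by positivity
  have hy1 : y ≤ 1 / 2 := by
    rw [hy, pow_succ]
    have : (1 / 2 : ℝ) ^ j ≤ 1 := pow_le_one₀ (by norm_num) (by norm_num)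
    linarith
  have hx : ((p : ℝ≥0∞) ^ (j + 1))⁻¹ ≤ ENNReal.ofReal y := by
    rw [hy, one_div, inv_pow, ENNReal.ofReal_inv_of_pos (by positivity), ENNReal.inv_le_inv,
      ENNReal.ofReal_pow (by norm_num), ENNReal.ofReal_ofNat]
    gcongr
    exact_mod_cast (Fact.out : p.Prime).two_le
  have h1 : (1 - ((p : ℝ≥0∞) ^ (j + 1))⁻¹)⁻¹ ≤ (ENNReal.ofReal (1 - y))⁻¹ := by
    rw [ENNReal.inv_le_inv, ENNReal.ofReal_sub _ hy0, ENNReal.ofReal_one]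
    exact tsub_le_tsub_left hx _
  refine h1.trans ?_
  rw [← ENNReal.ofReal_inv_of_pos (by linarith)]
  refine ENNReal.ofReal_le_ofReal ?_
  have h2 : (1 / 2 : ℝ) ^ j = 2 * y := by rw [hy, pow_succ]; ring
  rw [h2, inv_le_iff_one_le_mul₀ (by linarith)]
  have h3 := Real.add_one_le_exp (2 * y)
  nlinarith

/-- The bound for the submodule zeta function. -/
theorem submoduleZeta_free_le (n : ℕ) :
    submoduleZeta p (Fin n → ℤ_[p]) n ≤ ENNReal.ofReal (Real.exp 2) := by
  have h1 : submoduleZeta p (Fin n → ℤ_[p]) n ≤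
      ENNReal.ofReal (Real.exp (∑ j ∈ Finset.range n, (1 / 2) ^ j)) := by
    induction n with
    | zero =>
      have : Subsingleton (FiniteIndexSubmodule p (Fin 0 → ℤ_[p])) :=
        ⟨fun N N' => Subtype.ext (Subsingleton.elim _ _)⟩
      have hfin : Finite ((Fin 0 → ℤ_[p]) ⧸ (⊤ : Submodule ℤ_[p] (Fin 0 → ℤ_[p]))) := inferInstance
      rw [submoduleZeta, tsum_eq_single ⟨⊤, hfin⟩ fun N hN => (hN (Subsingleton.elim _ _)).elim]
      simp
    | succ n ih =>
      have e : (Fin (n + 1) → ℤ_[p]) ≃ₗ[ℤ_[p]] ℤ_[p] × (Fin n → ℤ_[p]) :=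
        (Fin.consLinearEquiv ℤ_[p] fun _ : Fin (n + 1) => ℤ_[p]).symm
      refine (submoduleZeta_le_of_equiv e _).trans ?_
      refine (submoduleZeta_prod_le n).trans ?_
      rw [Finset.sum_range_succ, Real.exp_add, mul_comm (Real.exp _),
        ENNReal.ofReal_mul (Real.exp_nonneg _)]
      exact mul_le_mul' (inv_one_sub_le n) ih
  refine h1.trans (ENNReal.ofReal_le_ofReal (Real.exp_le_exp.2 ?_))
  rw [geom_sum_eq (by norm_num)]
  have : (0 : ℝ) < (1 / 2) ^ n := by positivity
  rw [div_le_iff_of_neg (by norm_num)]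
  linarith

end Zeta

/-! ### Summability of `#Sur(G, F) / #Aut G` and countability of `X₀` -/

section Weighted

variable {p : ℕ} [Fact p.Prime] {F : Type} [AddCommGroup F] [Module ℤ_[p] F]

theorem card_linearMap_fin (n : ℕ) (A : Type*) [AddCommGroup A] [Module ℤ_[p] A] :
    Nat.card ((Fin n → ℤ_[p]) →ₗ[ℤ_[p]] A) = Nat.card A ^ n := by
  rw [← Nat.card_congr ((Pi.basisFun ℤ_[p] (Fin n)).constr ℤ_[p] (M' := A)).toEquiv, Nat.card_fun,
    Nat.card_fin]

theorem card_quotient_of_le_ker {L : Type} [AddCommGroup L] [Module ℤ_[p] L] {f : L →ₗ[ℤ_[p]] F}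
    (hf : Surjective f) {N : Submodule ℤ_[p] L} (hN : N ≤ LinearMap.ker f) [Finite (L ⧸ N)] :
    Finite (LinearMap.ker f ⧸ N.comap (LinearMap.ker f).subtype) ∧
    Nat.card (L ⧸ N) =
      Nat.card F * Nat.card (LinearMap.ker f ⧸ N.comap (LinearMap.ker f).subtype) := by
  let φ : LinearMap.ker f →ₗ[ℤ_[p]] L ⧸ N := N.mkQ ∘ₗ (LinearMap.ker f).subtype
  have hs : Surjective (N.liftQ f hN) := fun y => by
    obtain ⟨x, rfl⟩ := hf y
    exact ⟨Submodule.Quotient.mk x, rfl⟩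
  have e := φ.quotKerEquivRange
  have h1 : LinearMap.range φ = LinearMap.ker (N.liftQ f hN) := by
    rw [Submodule.ker_liftQ, LinearMap.range_comp, Submodule.range_subtype]
  rw [LinearMap.ker_comp, Submodule.ker_mkQ, h1] at e
  refine ⟨Finite.of_equiv _ e.symm.toEquiv, ?_⟩
  rw [card_eq_card_ker_mul_card_of_surjective _ hs, Nat.card_congr e.toEquiv, mul_comm]

variable [Finite F]

theorem nonempty_ker_equiv_free {n : ℕ} (f : (Fin n → ℤ_[p]) →ₗ[ℤ_[p]] F) :
    Nonempty (LinearMap.ker f ≃ₗ[ℤ_[p]] (Fin n → ℤ_[p])) := by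
  refine ⟨LinearEquiv.ofFinrankEq _ _ (le_antisymm (Submodule.finrank_le _) ?_)⟩
  let g : (Fin n → ℤ_[p]) →ₗ[ℤ_[p]] LinearMap.ker f :=
    LinearMap.codRestrict _ ((Nat.card F : ℤ_[p]) • LinearMap.id) fun x => by
      rw [LinearMap.mem_ker, LinearMap.smul_apply, map_smul, Nat.cast_smul_eq_nsmul,
        card_nsmul_eq_zero']
  refine LinearMap.finrank_le_finrank_of_injective (f := g) fun x y h => ?_
  have := congrArg Subtype.val h
  exact smul_right_injective _ (natCast_card_ne_zero (p := p) F) this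

/-- Exchange the sums: a surjection from the quotient by `N` is a surjection `f` on `ℤ_p^n` with `N
≤ ker f`. As `ker f ≅ ℤ_p^n` has index `#F`, each `f` contributes at most `#F^{-n}` times the zeta
value, and there are at most `#F^n` of them. -/
theorem tsum_numSurj_quotient_le (n : ℕ) (F : Type) [AddCommGroup F] [Module ℤ_[p] F] [Finite F] :
    ∑' N : FiniteIndexSubmodule p (Fin n → ℤ_[p]),
      (numSurj p ((Fin n → ℤ_[p]) ⧸ N.1) F : ℝ≥0∞) *
        ((Nat.card ((Fin n → ℤ_[p]) ⧸ N.1) : ℝ≥0∞) ^ n)⁻¹ ≤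
      submoduleZeta p (Fin n → ℤ_[p]) n := by
  classical
  have := Fintype.ofFinite {f : (Fin n → ℤ_[p]) →ₗ[ℤ_[p]] F // Surjective f}
  have h1 : ∀ N : FiniteIndexSubmodule p (Fin n → ℤ_[p]),
      (numSurj p ((Fin n → ℤ_[p]) ⧸ N.1) F : ℝ≥0∞) *
      ((Nat.card ((Fin n → ℤ_[p]) ⧸ N.1) : ℝ≥0∞) ^ n)⁻¹ =
      ∑ f : {f : (Fin n → ℤ_[p]) →ₗ[ℤ_[p]] F // Surjective f},
        {N : FiniteIndexSubmodule p (Fin n → ℤ_[p]) | N.1 ≤ LinearMap.ker f.1}.indicator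
          (fun N => ((Nat.card ((Fin n → ℤ_[p]) ⧸ N.1) : ℝ≥0∞) ^ n)⁻¹) N := by
    intro N
    have h2 : numSurj p ((Fin n → ℤ_[p]) ⧸ N.1) F =
        Nat.card {f : {f : (Fin n → ℤ_[p]) →ₗ[ℤ_[p]] F // Surjective f} //
          N.1 ≤ LinearMap.ker f.1} :=
      Nat.card_congr
        ⟨fun f => ⟨⟨f.1 ∘ₗ N.1.mkQ, f.2.comp N.1.mkQ_surjective⟩, by
            rw [LinearMap.ker_comp]
            intro x hx
            rw [Submodule.mem_comap, Submodule.mkQ_apply, (Submodule.Quotient.mk_eq_zero _).2 hx]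
            exact Submodule.zero_mem _⟩,
          fun f => ⟨N.1.liftQ f.1.1 f.2, fun y => by
            obtain ⟨x, rfl⟩ := f.1.2 y
            exact ⟨Submodule.Quotient.mk x, rfl⟩⟩,
          fun f => by
            refine Subtype.ext ?_
            ext x
            rfl,
          fun f => rfl⟩
    rw [h2, Nat.card_eq_fintype_card, Fintype.card_subtype, ← nsmul_eq_mul, ← Finset.sum_const,
      Finset.sum_filter]
    simp [Set.indicator_apply]
  have h3 : ∀ f : {f : (Fin n → ℤ_[p]) →ₗ[ℤ_[p]] F // Surjective f},
      ∑' N : FiniteIndexSubmodule p (Fin n → ℤ_[p]),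
        {N : FiniteIndexSubmodule p (Fin n → ℤ_[p]) | N.1 ≤ LinearMap.ker f.1}.indicator
          (fun N => ((Nat.card ((Fin n → ℤ_[p]) ⧸ N.1) : ℝ≥0∞) ^ n)⁻¹) N ≤
        ((Nat.card F : ℝ≥0∞) ^ n)⁻¹ * submoduleZeta p (Fin n → ℤ_[p]) n := by
    intro f
    rw [← tsum_subtype]
    have h4 : submoduleZeta p (LinearMap.ker f.1) n ≤ submoduleZeta p (Fin n → ℤ_[p]) n :=
      submoduleZeta_le_of_equiv (nonempty_ker_equiv_free f.1).some n
    refine le_trans ?_ (mul_le_mul_right h4 _)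
    rw [submoduleZeta, ← ENNReal.tsum_mul_left]
    let Φ : {N : FiniteIndexSubmodule p (Fin n → ℤ_[p]) | N.1 ≤ LinearMap.ker f.1} →
        FiniteIndexSubmodule p (LinearMap.ker f.1) := fun N =>
      ⟨N.1.1.comap (LinearMap.ker f.1).subtype, (card_quotient_of_le_ker f.2 N.2).1⟩
    have hΦ : Injective Φ := by
      rintro ⟨N, hN⟩ ⟨N', hN'⟩ h
      have h5 := congrArg (fun t => t.1.map (LinearMap.ker f.1).subtype) h
      simp only [Φ, Submodule.map_comap_subtype] at h5
      rw [inf_eq_right.2 hN, inf_eq_right.2 hN'] at h5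
      exact Subtype.ext (Subtype.ext h5)
    refine le_trans (le_of_eq ?_) (ENNReal.tsum_comp_le_tsum_of_injective hΦ _)
    refine tsum_congr fun N => ?_
    have := (card_quotient_of_le_ker f.2 N.2).1
    rw [(card_quotient_of_le_ker f.2 N.2).2, Nat.cast_mul, mul_pow, ENNReal.mul_inv
      (Or.inr (by finiteness)) (Or.inr (pow_ne_zero _ (Nat.cast_ne_zero.2 Nat.card_pos.ne')))]
  rw [tsum_congr h1, Summable.tsum_finsetSum fun _ _ => ENNReal.summable]
  refine (Finset.sum_le_sum fun f _ => h3 f).trans ?_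
  rw [Finset.sum_const, Finset.card_univ, ← Nat.card_eq_fintype_card, nsmul_eq_mul, ← mul_assoc]
  refine mul_le_of_le_one_left' ?_
  rw [← div_eq_mul_inv]
  refine ENNReal.div_le_of_le_mul ?_
  rw [one_mul]
  have : Nat.card {f : (Fin n → ℤ_[p]) →ₗ[ℤ_[p]] F // Surjective f} ≤ Nat.card F ^ n := by
    rw [← card_linearMap_fin (p := p) n F]
    exact Finite.card_subtype_le _
  exact_mod_cast this

/-- Surjections to `G` are counted by their kernels and the automorphisms of `G`. -/
theorem numSurj_eq_card_mul_numAut {L : Type} [AddCommGroup L] [Module ℤ_[p] L]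
    [Module.Finite ℤ_[p] L] (G : XZero p) :
    Finite {N : FiniteIndexSubmodule p L // XZero.mk p (L ⧸ N.1) = G} ∧
    numSurj p L G.Grp =
      Nat.card {N : FiniteIndexSubmodule p L // XZero.mk p (L ⧸ N.1) = G} * numAut p G.Grp := by
  have hfq : ∀ f : {f : L →ₗ[ℤ_[p]] G.Grp // Surjective f}, Finite (L ⧸ LinearMap.ker f.1) :=
    fun f => Finite.of_equiv _ (f.1.quotKerEquivOfSurjective f.2).symm.toEquiv
  let Φ : {f : L →ₗ[ℤ_[p]] G.Grp // Surjective f} →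
      {N : FiniteIndexSubmodule p L // XZero.mk p (L ⧸ N.1) = G} := fun f =>
    ⟨⟨LinearMap.ker f.1, hfq f⟩, mk_eq_iff.2 ⟨f.1.quotKerEquivOfSurjective f.2⟩⟩
  have hker : ∀ (N : Submodule ℤ_[p] L) (e : (L ⧸ N) ≃ₗ[ℤ_[p]] G.Grp),
      LinearMap.ker (e.toLinearMap ∘ₗ N.mkQ) = N := fun N e => by
    rw [LinearEquiv.ker_comp, Submodule.ker_mkQ]
  have hfib : ∀ N, Nat.card {f // Φ f = N} = numAut p G.Grp := by
    rintro ⟨N, hN⟩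
    obtain ⟨e⟩ := mk_eq_iff.1 hN
    refine (Nat.card_congr (Equiv.ofBijective (fun α : G.Grp ≃ₗ[ℤ_[p]] G.Grp =>
      ⟨⟨(e.trans α).toLinearMap ∘ₗ N.1.mkQ, (e.trans α).surjective.comp N.1.mkQ_surjective⟩,
        Subtype.ext (Subtype.ext (hker _ _))⟩) ⟨?_, ?_⟩)).symm
    · intro α β hαβ
      ext g
      obtain ⟨x, rfl⟩ := (e.surjective.comp N.1.mkQ_surjective) g
      exact LinearMap.congr_fun (congrArg (fun t => t.1.1) hαβ) x
    · rintro ⟨⟨f, hf⟩, h⟩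
      have h' : LinearMap.ker f = N.1 := congrArg (fun t => t.1.1) h
      refine ⟨e.symm.trans ((Submodule.quotEquivOfEq _ _ h'.symm).trans
        (f.quotKerEquivOfSurjective hf)), Subtype.ext (Subtype.ext ?_)⟩
      ext x
      simp
  have hfin : Finite {N : FiniteIndexSubmodule p L // XZero.mk p (L ⧸ N.1) = G} := by
    refine Finite.of_surjective Φ fun N => ?_
    have h : Nat.card {f // Φ f = N} ≠ 0 := by rw [hfib]; exact numAut_pos.ne'
    obtain ⟨f⟩ := (Nat.card_ne_zero.1 h).1
    exact ⟨f.1, f.2⟩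
  exact ⟨hfin, card_eq_mul_of_card_fiber Φ numAut_pos.ne' hfib⟩

/-- Group the submodules of `ℤ_p^n` by the class of the quotient. The extra weight is the
probability that `n` random elements generate `G`. -/
theorem tsum_weighted_le (n : ℕ) (F : Type) [AddCommGroup F] [Module ℤ_[p] F] [Finite F] :
    ∑' G : XZero p, (numSurj p G.Grp F : ℝ≥0∞) / numAut p G.Grp *
      (numSurj p (Fin n → ℤ_[p]) G.Grp / (Nat.card G.Grp : ℝ≥0∞) ^ n) ≤
      ENNReal.ofReal (Real.exp 2) := by
  refine le_trans ?_ ((tsum_numSurj_quotient_le (p := p) n F).trans (submoduleZeta_free_le n))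
  rw [← (Equiv.sigmaFiberEquiv fun N : FiniteIndexSubmodule p (Fin n → ℤ_[p]) =>
    XZero.mk p ((Fin n → ℤ_[p]) ⧸ N.1)).tsum_eq, ENNReal.tsum_sigma']
  refine ENNReal.tsum_le_tsum fun G => le_of_eq ?_
  obtain ⟨hfin, hcard⟩ := numSurj_eq_card_mul_numAut (L := Fin n → ℤ_[p]) G
  have := Fintype.ofFinite {N : FiniteIndexSubmodule p (Fin n → ℤ_[p]) //
    XZero.mk p ((Fin n → ℤ_[p]) ⧸ N.1) = G}
  have h1 : ∀ N : {N : FiniteIndexSubmodule p (Fin n → ℤ_[p]) //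
      XZero.mk p ((Fin n → ℤ_[p]) ⧸ N.1) = G},
      (numSurj p ((Fin n → ℤ_[p]) ⧸ N.1.1) F : ℝ≥0∞) *
        ((Nat.card ((Fin n → ℤ_[p]) ⧸ N.1.1) : ℝ≥0∞) ^ n)⁻¹ =
      (numSurj p G.Grp F : ℝ≥0∞) * ((Nat.card G.Grp : ℝ≥0∞) ^ n)⁻¹ := by
    intro N
    obtain ⟨e⟩ := mk_eq_iff.1 N.2
    rw [numSurj_congr_left e, Nat.card_congr e.toEquiv]
  refine Eq.trans ?_ (tsum_congr h1).symm
  rw [tsum_fintype, Finset.sum_const, Finset.card_univ, ← Nat.card_eq_fintype_card,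
    nsmul_eq_mul, hcard]
  have ha0 : (numAut p G.Grp : ℝ≥0∞) ≠ 0 := Nat.cast_ne_zero.2 numAut_pos.ne'
  have hat : (numAut p G.Grp : ℝ≥0∞) ≠ ⊤ := ENNReal.natCast_ne_top _
  push_cast
  simp only [div_eq_mul_inv]
  calc _ = ((numAut p G.Grp : ℝ≥0∞) * (numAut p G.Grp : ℝ≥0∞)⁻¹) *
        ((Nat.card {N : FiniteIndexSubmodule p (Fin n → ℤ_[p]) //
          XZero.mk p ((Fin n → ℤ_[p]) ⧸ N.1) = G} : ℝ≥0∞) *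
            ((numSurj p G.Grp F : ℝ≥0∞) * ((Nat.card G.Grp : ℝ≥0∞) ^ n)⁻¹)) := by ring
    _ = _ := by rw [ENNReal.mul_inv_cancel ha0 hat, one_mul]

/-- Union bound: a map that is not onto lands in a proper submodule, of order at most `#G / 2`,
which has probability at most `2⁻ⁿ` for each submodule. -/
theorem card_le_two_mul_numSurj (G : Type) [AddCommGroup G] [Module ℤ_[p] G] [Finite G] {n : ℕ}
    (hn : 2 * Nat.card (Submodule ℤ_[p] G) ≤ 2 ^ n) :
    Nat.card G ^ n ≤ 2 * numSurj p (Fin n → ℤ_[p]) G := by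
  classical
  have := Fintype.ofFinite {K : Submodule ℤ_[p] G // K ≠ ⊤}
  have h1 : Nat.card G ^ n = numSurj p (Fin n → ℤ_[p]) G +
      Nat.card {f : (Fin n → ℤ_[p]) →ₗ[ℤ_[p]] G // ¬ Surjective f} := by
    rw [← card_linearMap_fin (p := p) n G, numSurj, ← Nat.card_sum]
    exact (Nat.card_congr (Equiv.sumCompl _)).symm
  have h2 : Nat.card {f : (Fin n → ℤ_[p]) →ₗ[ℤ_[p]] G // ¬ Surjective f} ≤
      ∑ K : {K : Submodule ℤ_[p] G // K ≠ ⊤}, Nat.card K.1 ^ n := by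
    simp_rw [← card_linearMap_fin (p := p)]
    rw [← Nat.card_sigma]
    refine Nat.card_le_card_of_injective (fun f => ⟨⟨LinearMap.range f.1, fun h =>
      f.2 (LinearMap.range_eq_top.1 h)⟩, f.1.rangeRestrict⟩) fun f f' h => ?_
    have h3 : ∀ t t' : (Σ K : {K : Submodule ℤ_[p] G // K ≠ ⊤}, (Fin n → ℤ_[p]) →ₗ[ℤ_[p]] K.1),
        t = t' → t.1.1.subtype ∘ₗ t.2 = t'.1.1.subtype ∘ₗ t'.2 := by
      rintro t _ rfl
      rfl
    exact Subtype.ext (h3 _ _ h)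
  have h3 : ∀ K : {K : Submodule ℤ_[p] G // K ≠ ⊤}, 2 * Nat.card K.1 ≤ Nat.card G := by
    intro K
    rw [Submodule.card_eq_card_quotient_mul_card K.1, mul_comm]
    rw [mul_comm]
    refine Nat.mul_le_mul_right _ ?_ |>.trans (le_of_eq (mul_comm _ _))
    have : Nontrivial (G ⧸ K.1) := Submodule.Quotient.nontrivial_iff.2 K.2
    exact Finite.one_lt_card
  have h4 : 2 ^ n * Nat.card {f : (Fin n → ℤ_[p]) →ₗ[ℤ_[p]] G // ¬ Surjective f} ≤
      Nat.card (Submodule ℤ_[p] G) * Nat.card G ^ n := by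
    refine (Nat.mul_le_mul_left _ h2).trans ?_
    rw [Finset.mul_sum]
    refine (Finset.sum_le_card_nsmul _ _ (Nat.card G ^ n) fun K _ => ?_).trans ?_
    · rw [← mul_pow]
      exact Nat.pow_le_pow_left (h3 K) n
    · rw [smul_eq_mul, Finset.card_univ, ← Nat.card_eq_fintype_card]
      exact Nat.mul_le_mul_right _ (Finite.card_subtype_le _)
  have hpos : 0 < Nat.card (Submodule ℤ_[p] G) := Nat.card_pos
  have h5 : 2 * Nat.card {f : (Fin n → ℤ_[p]) →ₗ[ℤ_[p]] G // ¬ Surjective f} ≤ Nat.card G ^ n := by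
    refine Nat.le_of_mul_le_mul_left ?_ hpos
    calc _ = 2 * Nat.card (Submodule ℤ_[p] G) *
          Nat.card {f : (Fin n → ℤ_[p]) →ₗ[ℤ_[p]] G // ¬ Surjective f} := by ring
      _ ≤ 2 ^ n * Nat.card {f : (Fin n → ℤ_[p]) →ₗ[ℤ_[p]] G // ¬ Surjective f} :=
        Nat.mul_le_mul_right _ hn
      _ ≤ _ := h4
  omega

theorem summable_numSurj_div_numAut (F : Type) [AddCommGroup F] [Module ℤ_[p] F] [Finite F] :
    Summable fun G : XZero p => (numSurj p G.Grp F : ℝ) / numAut p G.Grp := by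
  have h : ∑' G : XZero p, (numSurj p G.Grp F : ℝ≥0∞) / numAut p G.Grp ≠ ⊤ := by
    refine ne_top_of_le_ne_top (b := 2 * ENNReal.ofReal (Real.exp 2)) (by finiteness) ?_
    rw [ENNReal.tsum_eq_iSup_sum]
    refine iSup_le fun S => ?_
    -- For a finite set `S` of groups one `n` makes every generation probability at least `1/2`; the
    -- resulting bound `2 exp 2` does not depend on `S`.
    let n := ∑ G ∈ S, 2 * Nat.card (Submodule ℤ_[p] G.Grp)
    have hn : ∀ G ∈ S, 2 * Nat.card (Submodule ℤ_[p] G.Grp) ≤ 2 ^ n := fun G hG =>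
      (Finset.single_le_sum (f := fun G : XZero p => 2 * Nat.card (Submodule ℤ_[p] G.Grp))
        (fun _ _ => Nat.zero_le _) hG).trans Nat.lt_two_pow_self.le
    have h1 : ∀ G ∈ S, (numSurj p G.Grp F : ℝ≥0∞) / numAut p G.Grp ≤
        2 * ((numSurj p G.Grp F : ℝ≥0∞) / numAut p G.Grp *
          (numSurj p (Fin n → ℤ_[p]) G.Grp / (Nat.card G.Grp : ℝ≥0∞) ^ n)) := by
      intro G hG
      have h2 := card_le_two_mul_numSurj (p := p) G.Grp (hn G hG)
      have h3 : (1 : ℝ≥0∞) ≤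
          2 * (numSurj p (Fin n → ℤ_[p]) G.Grp / (Nat.card G.Grp : ℝ≥0∞) ^ n) := by
        rw [← mul_div_assoc, ENNReal.le_div_iff_mul_le
          (Or.inl (pow_ne_zero _ (Nat.cast_ne_zero.2 Nat.card_pos.ne'))) (Or.inl (by finiteness)),
          one_mul]
        exact_mod_cast h2
      calc _ = (numSurj p G.Grp F : ℝ≥0∞) / numAut p G.Grp * 1 := (mul_one _).symm
        _ ≤ _ := mul_le_mul_right h3 _
        _ = _ := by ring
    refine (Finset.sum_le_sum h1).trans ?_
    rw [← Finset.mul_sum]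
    refine mul_le_mul_right ?_ _
    exact (ENNReal.sum_le_tsum S).trans (tsum_weighted_le n F)
  have := ENNReal.summable_toReal h
  simpa [ENNReal.toReal_div] using this

/-- For trivial `F` the summable family has no zero term, and summable families have countable
support. -/
instance countable_xZero : Countable (XZero p) := by
  have h := (summable_numSurj_div_numAut (p := p) PUnit).countable_support
  refine (Set.countable_univ_iff.1 (h.mono fun G _ => ?_))
  have h1 : 0 < numSurj p G.Grp PUnit :=
    (Nat.card_pos_iff.2 ⟨⟨⟨0, fun y => ⟨0, Subsingleton.elim _ _⟩⟩⟩, inferInstance⟩)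
  rw [mem_support]
  exact div_ne_zero (Nat.cast_ne_zero.2 h1.ne') (Nat.cast_ne_zero.2 numAut_pos.ne')

end Weighted

/-! ### Detailed balance between `d` and `d^*` -/

section Operators

variable {p : ℕ} [Fact p.Prime]

theorem muZero_eq (G : XZero p) : muZero p G = cZero p / numAut p G.Grp := by
  rw [muZero, card_addAut_eq_numAut (p := p)]

theorem moment_apply (F : Type*) [AddCommGroup F] [Module ℤ_[p] F] [Finite F] (G : XZero p) :
    moment p F G = numSurj p G.Grp F * muZero p G := by
  rw [moment, card_addSurj_eq_numSurj (p := p)]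

theorem moment_congr {F F' : Type*} [AddCommGroup F] [AddCommGroup F'] (e : F ≃+ F') :
    moment p F = moment p F' := by
  ext G
  have h : Nat.card {f : G.Grp →+ F // Surjective f} = Nat.card {f : G.Grp →+ F' // Surjective f} :=
    Nat.card_congr
      ⟨fun f => ⟨e.toAddMonoidHom.comp f.1, e.surjective.comp f.2⟩,
        fun f => ⟨e.symm.toAddMonoidHom.comp f.1, e.symm.surjective.comp f.2⟩,
        fun f => Subtype.ext (AddMonoidHom.ext fun x => e.symm_apply_apply _),
        fun f => Subtype.ext (AddMonoidHom.ext fun x => e.apply_symm_apply _)⟩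
  rw [moment, moment, h]

theorem moment_mk (M : Type) [AddCommGroup M] [Module ℤ_[p] M] [Finite M] :
    moment p (XZero.mk p M).Grp = moment p M :=
  (moment_congr (mk_eq_iff (p := p).1 (rfl : XZero.mk p M = _)).some.toAddEquiv).symm

theorem summable_moment (F : Type) [AddCommGroup F] [Module ℤ_[p] F] [Finite F] :
    Summable (moment p F) := by
  refine ((summable_numSurj_div_numAut (p := p) F).mul_left (cZero p)).congr fun G => ?_
  rw [moment_apply, muZero_eq]
  ring

theorem one_sub_inv_prime_ne_zero : (1 - 1 / (p : ℝ)) ≠ 0 := by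
  have h1 : (1 : ℝ) < p := by exact_mod_cast (Fact.out : p.Prime).one_lt
  rw [sub_ne_zero, ne_comm, Ne, div_eq_iff (by positivity), one_mul]
  exact h1.ne

/-- The first factor of the sum is the weight `μ₁(H)`; balance turns each term into `μ₁(H) #Sur(G,
F) P(d H = G)`. -/
theorem hasSum_moment_mul_dStarProb (F : Type) [AddCommGroup F] [Module ℤ_[p] F] [Finite F]
    (H : XOne p) {q : H.Mod →ₗ[ℤ_[p]] ℤ_[p]} (hq : IsTorsionProj q) :
    HasSum (fun G : XZero p => moment p F G * dStarProb p G H)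
      (cZero p / ((1 - 1 / (p : ℝ)) * Nat.card (AutOver q)) *
        (numSurj p H.Mod F / Nat.card F)) := by
  have := hq.finite_autOver
  have h1 : (Nat.card (AutOver q) : ℝ) ≠ 0 := Nat.cast_ne_zero.2 Nat.card_pos.ne'
  have h2 := one_sub_inv_prime_ne_zero (p := p)
  refine ((hasSum_numSurj_mul_dProb H F).mul_left _).congr_fun fun G => ?_
  have h3 : (numAut p G.Grp : ℝ) ≠ 0 := Nat.cast_ne_zero.2 numAut_pos.ne'
  have h4 : (Nat.card G.Grp : ℝ) ≠ 0 := Nat.cast_ne_zero.2 Nat.card_pos.ne'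
  rw [moment_apply, muZero_eq, dStarProb_eq G H hq, dProb_eq]
  generalize (1 - 1 / (p : ℝ)) = x at h2 ⊢
  field_simp

/-- Balance used in the opposite direction, returning from `μ₁(H)` to `μ₀(G)`; the order of
`AutOver` cancels. -/
theorem dStarOp_moment_mul_dProb (F : Type) [AddCommGroup F] [Module ℤ_[p] F] [Finite F]
    (H : XOne p) (G : XZero p) : dStarOp p (moment p F) H * dProb p H G =
      muZero p G / Nat.card F * (numSurj p H.Mod F * dStarProb p G H) := by
  obtain ⟨q, hq⟩ := exists_isTorsionProj (p := p) H.Mod (Quotient.out H).finrank_eq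
  have := hq.finite_autOver
  have h1 : (Nat.card (AutOver q) : ℝ) ≠ 0 := Nat.cast_ne_zero.2 Nat.card_pos.ne'
  have h2 := one_sub_inv_prime_ne_zero (p := p)
  have h3 : (numAut p G.Grp : ℝ) ≠ 0 := Nat.cast_ne_zero.2 numAut_pos.ne'
  have h4 : (Nat.card G.Grp : ℝ) ≠ 0 := Nat.cast_ne_zero.2 Nat.card_pos.ne'
  have h5 : (Nat.card F : ℝ) ≠ 0 := Nat.cast_ne_zero.2 Nat.card_pos.ne'
  rw [dStarOp, (hasSum_moment_mul_dStarProb F H hq).tsum_eq, muZero_eq, dStarProb_eq G H hq,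
    dProb_eq]
  generalize (1 - 1 / (p : ℝ)) = x at h2 ⊢
  field_simp

end Operators

/-! ### The expected number of surjections from `d^*(G)`, and `Δ₀` on moments -/

section Middle

variable {p : ℕ} [Fact p.Prime]

namespace Extension

variable {G : Type} [AddCommGroup G] [Module ℤ_[p] G] [Finite G] (E : Extension p G)

theorem finite_middle : Module.Finite ℤ_[p] E.middle := by
  have h1 : Module.Finite ℤ_[p] (LinearMap.range E.inl) := inferInstance
  have h2 : Module.Finite ℤ_[p] (E.middle ⧸ LinearMap.range E.inl) := by
    rw [← LinearMap.exact_iff.1 E.exact]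
    exact Module.Finite.equiv (E.proj.quotKerEquivOfSurjective E.proj_surjective).symm
  exact Module.Finite.of_submodule_quotient (LinearMap.range E.inl)

theorem finrank_middle : Module.finrank ℤ_[p] E.middle = 1 := by
  have := E.finite_middle
  have h1 := (LinearMap.range E.inl).finrank_quotient_add_finrank
  have h2 : Module.finrank ℤ_[p] (LinearMap.range E.inl) = 1 := by
    rw [← (LinearEquiv.ofInjective E.inl E.inl_injective).finrank_eq, Module.finrank_self]
  have h3 : Module.finrank ℤ_[p] (E.middle ⧸ LinearMap.range E.inl) = 0 := by
    rw [← LinearMap.exact_iff.1 E.exact,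
      (E.proj.quotKerEquivOfSurjective E.proj_surjective).finrank_eq]
    refine Module.finrank_eq_zero_iff.2 fun x => ⟨Nat.card G, natCast_card_ne_zero G, ?_⟩
    rw [Nat.cast_smul_eq_nsmul, card_nsmul_eq_zero']
  omega

/-- The isomorphism class of the middle term. -/
noncomputable def middleClass : XOne p :=
  Quotient.mk (rankOneModSetoid p)
    { carrier := E.middle, fg := E.finite_middle, finrank_eq := E.finrank_middle }

theorem middleClass_eq_iff {H : XOne p} :
    E.middleClass = H ↔ Nonempty (E.middle ≃ₗ[ℤ_[p]] H.Mod) := by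
  conv_lhs => rw [← Quotient.out_eq H]
  exact Quotient.eq

end Extension

theorem dStarProb_eq_card (G : XZero p) (H : XOne p) : dStarProb p G H =
    (Nat.card {c : ExtZp p G.Grp // (extRep c).middleClass = H} : ℝ) / Nat.card G.Grp := by
  rw [dStarProb, card_extZp]
  congr 2
  refine Nat.card_congr (Equiv.subtypeEquivRight fun c => ?_)
  rw [Extension.middleClass_eq_iff]
  constructor
  · rintro ⟨E, rfl, ⟨e⟩⟩
    obtain ⟨e', -, -⟩ := Quotient.mk_out (s := extensionSetoid p G.Grp) E
    exact ⟨LinearEquiv.trans e' e⟩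
  · rintro ⟨e⟩
    exact ⟨extRep c, Quotient.out_eq c, ⟨e⟩⟩

theorem hasSum_numSurj_mul_dStarProb (F : Type) [AddCommGroup F] [Module ℤ_[p] F] [Fintype F]
    (G : XZero p) : HasSum (fun H : XOne p => (numSurj p H.Mod F : ℝ) * dStarProb p G H)
      (∑ a : F, (numSurj p G.Grp (F ⧸ Submodule.span ℤ_[p] {a}) : ℝ)) := by
  classical
  have := Fintype.ofFinite (ExtZp p G.Grp)
  have hfin : ∀ c : ExtZp p G.Grp,
      Finite {f : (extRep c).middle →ₗ[ℤ_[p]] F // Surjective f} := fun c => by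
    have := (extRep c).finite_middle
    infer_instance
  have h1 := hasSum_sum (s := Finset.univ) fun (c : ExtZp p G.Grp) _ =>
    hasSum_ite_eq (extRep c).middleClass (numSurj p (extRep c).middleClass.Mod F : ℝ)
  have h4 : (Nat.card G.Grp : ℝ) ≠ 0 := Nat.cast_ne_zero.2 Nat.card_pos.ne'
  have h2 : ∑ c : ExtZp p G.Grp, (numSurj p (extRep c).middleClass.Mod F : ℝ) =
      (∑ a : F, (numSurj p G.Grp (F ⧸ Submodule.span ℤ_[p] {a}) : ℝ)) * Nat.card G.Grp := by
    have h3 := card_sigma_surj_extension (p := p) G.Grp F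
    rw [Nat.card_sigma, Nat.card_sigma] at h3
    have h5 : ∀ c : ExtZp p G.Grp, numSurj p (extRep c).middleClass.Mod F =
        Nat.card {f : (extRep c).middle →ₗ[ℤ_[p]] F // Surjective f} := fun c =>
      (numSurj_congr_left ((extRep c).middleClass_eq_iff.1 rfl).some).symm
    simp_rw [h5]
    exact_mod_cast h3
  rw [h2] at h1
  have h6 := h1.div_const (Nat.card G.Grp : ℝ)
  rw [mul_div_cancel_right₀ _ h4] at h6
  refine h6.congr_fun fun H => ?_
  rw [dStarProb_eq_card, Nat.card_eq_fintype_card, Fintype.card_subtype, mul_div_assoc']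
  congr 1
  rw [Finset.card_eq_sum_ones, Finset.sum_filter, Nat.cast_sum, Finset.mul_sum]
  refine Finset.sum_congr rfl fun c _ => ?_
  by_cases h : (extRep c).middleClass = H
  · rw [if_pos h, if_pos h.symm, h, Nat.cast_one, mul_one]
  · rw [if_neg h, if_neg (Ne.symm h), Nat.cast_zero, mul_zero]

theorem deltaZero_moment (F : Type) [AddCommGroup F] [Module ℤ_[p] F] [Fintype F] :
    DeltaZero p (moment p F) =
      (1 / (Nat.card F : ℝ)) • ∑ a : F, moment p (F ⧸ Submodule.span ℤ_[p] {a}) := by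
  ext G
  rw [DeltaZero, dOp]
  simp_rw [dStarOp_moment_mul_dProb]
  rw [((hasSum_numSurj_mul_dStarProb F G).mul_left _).tsum_eq, Pi.smul_apply, Finset.sum_apply]
  simp_rw [moment_apply]
  rw [← Finset.sum_mul, smul_eq_mul]
  ring

/-- `dProb` and `dStarProb` vanish together, both being multiples of the number of cyclic-kernel
surjections. So only the finitely many middle terms of extensions of `G` contribute, and `d` is
linear without convergence conditions. -/
theorem dOp_eq_sum (G : XZero p) : ∃ S : Finset (XOne p), ∀ ν : XOne p → ℝ,
    dOp p ν G = ∑ H ∈ S, ν H * dProb p H G := by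
  classical
  have := Fintype.ofFinite (ExtZp p G.Grp)
  refine ⟨Finset.univ.image fun c : ExtZp p G.Grp => (extRep c).middleClass, fun ν => ?_⟩
  refine tsum_eq_sum fun H hH => ?_
  have h1 : dStarProb p G H = 0 := by
    rw [dStarProb_eq_card]
    have : IsEmpty {c : ExtZp p G.Grp // (extRep c).middleClass = H} :=
      ⟨fun c => hH (Finset.mem_image.2 ⟨c.1, Finset.mem_univ _, c.2⟩)⟩
    rw [Nat.card_of_isEmpty, Nat.cast_zero, zero_div]
  obtain ⟨q, hq⟩ := exists_isTorsionProj (p := p) H.Mod (Quotient.out H).finrank_eq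
  have := hq.finite_autOver
  rw [dStarProb_eq G H hq, div_eq_zero_iff] at h1
  have h2 : (Nat.card (AutOver q) * Nat.card G.Grp : ℝ) ≠ 0 :=
    mul_ne_zero (Nat.cast_ne_zero.2 Nat.card_pos.ne') (Nat.cast_ne_zero.2 Nat.card_pos.ne')
  rw [dProb_eq, h1.resolve_right h2, mul_zero, zero_div, mul_zero]

theorem deltaZero_sum {ι : Type*} (s : Finset ι) (b : ι → ℝ) (F : ι → XZero p) :
    DeltaZero p (∑ i ∈ s, b i • moment p (F i).Grp) =
      ∑ i ∈ s, b i • DeltaZero p (moment p (F i).Grp) := by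
  have h1 : dStarOp p (∑ i ∈ s, b i • moment p (F i).Grp) =
      ∑ i ∈ s, b i • dStarOp p (moment p (F i).Grp) := by
    ext H
    obtain ⟨q, hq⟩ := exists_isTorsionProj (p := p) H.Mod (Quotient.out H).finrank_eq
    have h2 := (hasSum_sum (s := s) fun i _ =>
      (hasSum_moment_mul_dStarProb (F i).Grp H hq).mul_left (b i)).tsum_eq
    rw [dStarOp, Finset.sum_apply]
    simp_rw [Finset.sum_apply, Pi.smul_apply, smul_eq_mul, Finset.sum_mul, mul_assoc]
    rw [h2]
    refine Finset.sum_congr rfl fun i _ => ?_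
    rw [dStarOp, (hasSum_moment_mul_dStarProb (F i).Grp H hq).tsum_eq]
  ext G
  obtain ⟨S, hS⟩ := dOp_eq_sum G
  simp only [DeltaZero, h1, hS, Finset.sum_apply, Pi.smul_apply, smul_eq_mul, Finset.sum_mul,
    Finset.mul_sum, mul_assoc]
  exact Finset.sum_comm

end Middle

/-! ### The three statements for finite `ℤ_p`-modules -/

section Moments

variable {p : ℕ} [Fact p.Prime]

theorem momentOp_apply (ν : XZero p →₀ ℝ) :
    momentOp p ν = ∑ F ∈ ν.support, ν F • moment p F.Grp := by
  rw [momentOp, Finsupp.linearCombination_apply, Finsupp.sum]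

theorem momentOp_single (F : XZero p) : momentOp p (Finsupp.single F 1) = moment p F.Grp := by
  rw [momentOp, Finsupp.linearCombination_single, one_smul]

theorem momentOp_deltaLaw (F : XZero p) :
    momentOp p (deltaLaw p F) = DeltaZero p (moment p F.Grp) := by
  have := Fintype.ofFinite F.Grp
  obtain ⟨e⟩ := nonempty_dual_equiv (p := p) F.Grp
  rw [deltaLaw, map_smul, map_sum, card_dual, deltaZero_moment]
  congr 1
  refine Fintype.sum_equiv e.toEquiv _ _ fun χ => ?_
  rw [momentOp_single, moment_mk]
  obtain ⟨e'⟩ := nonempty_ker_equiv F.Grp χ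
  refine moment_congr (e'.trans (Submodule.Quotient.equiv _ _ e ?_)).toAddEquiv
  rw [Submodule.map_span, Set.image_singleton]
  rfl

theorem summable_momentOp (ν : XZero p →₀ ℝ) : Summable (momentOp p ν) := by
  rw [momentOp_apply]
  have := summable_sum (s := ν.support) fun F _ => (summable_moment (p := p) F.Grp).const_smul (ν F)
  refine this.congr fun G => ?_
  rw [Finset.sum_apply]
  rfl

theorem deltaZero_momentOp (ν : XZero p →₀ ℝ) :
    DeltaZero p (momentOp p ν) = momentOp p (deltaOp p ν) := by
  rw [momentOp_apply, deltaZero_sum, deltaOp, Finsupp.linearCombination_apply, Finsupp.sum, map_sum]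
  refine Finset.sum_congr rfl fun F _ => ?_
  rw [map_smul, momentOp_deltaLaw]

theorem exists_upper_triangular (F : XZero p) : ∃ b : XZero p →₀ ℝ,
    (∀ F' ∈ b.support, F' ≤ F) ∧ b F = 1 / (Nat.card F.Grp : ℝ) ∧
      DeltaZero p (moment p F.Grp) = ∑ F' ∈ b.support, b F' • moment p F'.Grp := by
  classical
  have := Fintype.ofFinite F.Grp
  refine ⟨(1 / (Nat.card F.Grp : ℝ)) • ∑ a : F.Grp,
    Finsupp.single (XZero.mk p (F.Grp ⧸ Submodule.span ℤ_[p] {a})) (1 : ℝ), ?_, ?_, ?_⟩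
  · intro F' hF'
    have h1 := Finsupp.support_smul hF'
    rw [Finsupp.mem_support_iff, Finsupp.finsetSum_apply] at h1
    obtain ⟨a, -, ha⟩ := Finset.exists_ne_zero_of_sum_ne_zero h1
    have h2 : XZero.mk p (F.Grp ⧸ Submodule.span ℤ_[p] {a}) = F' := by
      by_contra h
      exact ha (Finsupp.single_eq_of_ne (Ne.symm h))
    obtain ⟨e⟩ := mk_eq_iff.1 h2
    exact ⟨e.toLinearMap ∘ₗ Submodule.mkQ _, e.surjective.comp (Submodule.mkQ_surjective _)⟩
  · rw [Finsupp.smul_apply, Finsupp.finsetSum_apply, smul_eq_mul]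
    -- By cardinality, `F / a ≅ F` forces the span of `a` to be trivial.
    have h1 : ∀ a : F.Grp, XZero.mk p (F.Grp ⧸ Submodule.span ℤ_[p] {a}) = F ↔ a = 0 := by
      intro a
      rw [mk_eq_iff]
      constructor
      · rintro ⟨e⟩
        have h2 := Submodule.card_eq_card_quotient_mul_card (Submodule.span ℤ_[p] {a})
        rw [Nat.card_congr e.toEquiv] at h2
        have h3 : Nat.card (Submodule.span ℤ_[p] {a}) = 1 :=
          Nat.eq_of_mul_eq_mul_left (Nat.card_pos (α := F.Grp)) (by rw [mul_one, mul_comm]; exact h2.symm)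
        have := (Nat.card_eq_one_iff_unique.1 h3).1
        exact congrArg Subtype.val
          (Subsingleton.elim (⟨a, Submodule.mem_span_singleton_self a⟩ : Submodule.span ℤ_[p] {a}) 0)
      · rintro rfl
        exact ⟨Submodule.quotEquivOfEqBot _ (by simp)⟩
    have h2 : ∑ a : F.Grp,
        (Finsupp.single (XZero.mk p (F.Grp ⧸ Submodule.span ℤ_[p] {a})) (1 : ℝ)) F = 1 := by
      rw [Finset.sum_eq_single 0]
      · rw [(h1 0).2 rfl, Finsupp.single_eq_same]
      · intro a _ ha
        exact Finsupp.single_eq_of_ne fun h => ha ((h1 a).1 h.symm)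
      · exact fun h => (h (Finset.mem_univ _)).elim
    rw [h2, mul_one]
  · rw [← momentOp_apply, map_smul, map_sum, deltaZero_moment]
    simp_rw [momentOp_single, moment_mk]

/-! ### Arbitrary finite abelian groups `F` -/

section General

theorem moment_eq_zero (F : Type*) [AddCommGroup F] (h : ∀ k : ℕ, Nat.card F ≠ p ^ k) : moment p F = 0 := by
  ext G
  have : IsEmpty {f : G.Grp →+ F // Surjective f} := ⟨fun f => by
    obtain ⟨m, hm⟩ := exists_card_eq_pow (p := p) G.Grp
    have h1 : Nat.card F ∣ p ^ m := hm ▸ AddSubgroup.card_dvd_of_surjective f.1 f.2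
    obtain ⟨k, -, hk⟩ := (Nat.dvd_prime_pow Fact.out).1 h1
    exact h k hk⟩
  rw [moment, Nat.card_of_isEmpty, Nat.cast_zero, zero_mul, Pi.zero_apply]

variable (F : Type*) [AddCommGroup F] [Finite F]

/-- `F` is replaced by a copy in `Type`, a module over `ℤ / p ^ k` and hence over `ℤ_p`. -/
theorem exists_module_model {k : ℕ} (h : Nat.card F = p ^ k) :
    ∃ (F' : Type) (_ : AddCommGroup F') (_ : Module ℤ_[p] F') (_ : Fintype F'),
      Nonempty (F ≃+ F') := by
  have e₀ : Shrink.{0} F ≃+ F := Shrink.addEquiv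
  have e := e₀.symm
  have : Finite (Shrink.{0} F) := Finite.of_equiv _ e.toEquiv
  let : Module (ZMod (p ^ k)) (Shrink.{0} F) := AddCommGroup.zmodModule fun x => by
    rw [← h, Nat.card_congr e.toEquiv, card_nsmul_eq_zero']
  exact ⟨Shrink.{0} F, inferInstance, Module.compHom _ (PadicInt.toZModPow k), Fintype.ofFinite _,
    ⟨e⟩⟩

/-- The prime-to-`p` part of `#F` is a unit of `ℤ_p`, so `p ^ k x` is a multiple of `#F` in `ℤ_p`
and is killed by `φ`. -/
theorem exists_card_range_eq_pow (φ : ℤ_[p] →+ F) : ∃ j : ℕ, Nat.card φ.range = p ^ j := by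
  obtain ⟨k, u, h⟩ := exists_eq_pow_mul_unit (p := p) (n := Nat.card F) Nat.card_pos.ne'
  refine exists_card_eq_pow_of_nsmul φ.range (k := k) ?_
  rintro ⟨_, x, rfl⟩
  refine Subtype.ext ?_
  change p ^ k • φ x = 0
  have h1 : p ^ k • x = Nat.card F • ((↑u⁻¹ : ℤ_[p]) * x) := by
    rw [nsmul_eq_mul, nsmul_eq_mul, h, Nat.cast_pow, mul_comm (u : ℤ_[p]), mul_assoc,
      Units.mul_inv_cancel_left]
  rw [← map_nsmul, h1, map_nsmul, card_nsmul_eq_zero']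

/-- Both sides vanish: the image of `φ` has `p`-power order, so the cokernel, like `F`, does not,
and neither is a quotient of a `p`-group. -/
theorem deltaZero_moment_of_not_pow (h : ∀ k : ℕ, Nat.card F ≠ p ^ k) :
    DeltaZero p (moment p F) =
      (1 / (Nat.card F : ℝ)) • ∑ φ : ℤ_[p] →+ F, moment p (F ⧸ φ.range) := by
  have h1 : ∀ φ : ℤ_[p] →+ F, moment p (F ⧸ φ.range) = 0 := fun φ =>
    moment_eq_zero _ fun k hk => by
      obtain ⟨j, hj⟩ := exists_card_range_eq_pow F φ
      refine h (k + j) ?_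
      rw [AddSubgroup.card_eq_card_quotient_mul_card_addSubgroup φ.range, hk, hj, pow_add]
  simp_rw [h1]
  rw [moment_eq_zero F h, Finset.sum_const_zero, smul_zero]
  ext G
  simp [DeltaZero, dOp, dStarOp]

theorem deltaZero_moment_of_equiv {F' : Type} [AddCommGroup F'] [Module ℤ_[p] F'] [Fintype F']
    (e : F ≃+ F') : DeltaZero p (moment p F) =
      (1 / (Nat.card F : ℝ)) • ∑ φ : ℤ_[p] →+ F, moment p (F ⧸ φ.range) := by
  rw [moment_congr e, deltaZero_moment, Nat.card_congr e.toEquiv]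
  congr 1
  -- A homomorphism from `ℤ_p` is determined by the image of `1`, so the sum over `φ` becomes a sum
  -- over `a ∈ F'`.
  let E : (ℤ_[p] →+ F) ≃ F' :=
    ((AddEquiv.addMonoidHomCongrRightEquiv e).trans
      (addMonoidHomEquivLinearMap ℤ_[p] F')).trans
        (LinearMap.ringLmapEquivSelf ℤ_[p] ℤ_[p] F').toEquiv
  refine (Fintype.sum_equiv E _ _ fun φ => ?_).symm
  have hE : E φ = e (φ 1) := rfl
  rw [hE]
  let f : F →+ F' ⧸ Submodule.span ℤ_[p] {e (φ 1)} :=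
    (Submodule.mkQ (Submodule.span ℤ_[p] {e (φ 1)})).toAddMonoidHom.comp e.toAddMonoidHom
  have hf : Surjective f := (Submodule.mkQ_surjective _).comp e.surjective
  have hk : φ.range = f.ker := by
    ext x
    have h1 : x ∈ f.ker ↔ e x ∈ Submodule.span ℤ_[p] {e (φ 1)} :=
      AddMonoidHom.mem_ker.trans (Submodule.Quotient.mk_eq_zero _)
    rw [h1, Submodule.mem_span_singleton]
    refine exists_congr fun c => ?_
    have h2 := map_padicInt_smul (e.toAddMonoidHom.comp φ) c 1
    rw [smul_eq_mul, mul_one] at h2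
    change e (φ c) = c • e (φ 1) at h2
    rw [← h2, e.injective.eq_iff]
  exact moment_congr ((QuotientAddGroup.quotientAddEquivOfEq hk).trans
    (QuotientAddGroup.quotientKerEquivOfSurjective f hf))

end General

end Moments

end CohenLenstra

theorem mainTheorem6 (p : ℕ) [Fact p.Prime] :
    (∀ (F : Type*) [AddCommGroup F] [Finite F],
      Summable (moment p F) ∧
      DeltaZero p (moment p F) =
        (1 / (Nat.card F : ℝ)) • ∑ φ : ℤ_[p] →+ F, moment p (F ⧸ φ.range)) ∧
    (∀ ν : XZero p →₀ ℝ,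
      Summable (momentOp p ν) ∧
      DeltaZero p (momentOp p ν) = momentOp p (deltaOp p ν)) ∧
    (∀ F : XZero p, ∃ b : XZero p →₀ ℝ,
      (∀ F' ∈ b.support, F' ≤ F) ∧
      b F = 1 / (Nat.card F.Grp : ℝ) ∧
      DeltaZero p (moment p F.Grp) = ∑ F' ∈ b.support, b F' • moment p F'.Grp) := by
  refine ⟨fun F _ _ => ?_, fun ν => ⟨summable_momentOp ν, deltaZero_momentOp ν⟩,
    exists_upper_triangular⟩
  by_cases h : ∃ k : ℕ, Nat.card F = p ^ k
  · obtain ⟨k, hk⟩ := h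
    obtain ⟨F', _, _, _, ⟨e⟩⟩ := exists_module_model F hk
    refine ⟨?_, deltaZero_moment_of_equiv F e⟩
    rw [moment_congr e]
    exact summable_moment F'
  · have h' : ∀ k : ℕ, Nat.card F ≠ p ^ k := fun k hk => h ⟨k, hk⟩
    refine ⟨?_, deltaZero_moment_of_not_pow F h'⟩
    rw [moment_eq_zero F h']
    exact summable_zero
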